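/- **Setting.** Let $\{p(y|x)\}$, $x\in\{0,1\}$, $y\in\mathcal Y$, be a memoryless channel with binary input and arbitrary (discrete or continuous) output alphabet, $p(\cdot|x)$ being densities with respect to a fixed reference measure $dy$. Let $X$ be uniform on $\{0,1\}$, $Y$ the corresponding output, $p(x|y)=p(y|x)/(p(y|0)+p(y|1))$, and assume the channel is symmetric (a BIMSC): $-\ln p(0|Y)$ given $X=0$ and $-\ln p(1|Y)$ given $X=1$ have the same distribution. All logarithms are natural. Let $H=H(X|Y)=\mathbf E[-\ln p(X|Y)]$, $\sigma_H^2=\mathbf{Var}[-\ln p(X|Y)]$, $M_H=\mathbf E|-\ln p(X|Y)-H|^3$, and assume $\sigma_H>0$. Let $C$ be the capacity, $C=\max_t\sum_x t(x)\int p(y|x)\ln\frac{p(y|x)}{\sum_u t(u)p(y|u)}\,dy$ over input distributions $t$. For $\lambda\ge 0$ let $\phi(\lambda)=\mathbf E[p(X|Y)^{-\lambda}]$ and $\lambda^*=\sup\{\lambda\ge0:\phi(\lambda)<\infty\}$. For $\lambda\in[0,\lambda^*)$ let $(X_\lambda,Y_\lambda)$ have density $p(x|y)^{-\lambda}/\phi(\lambda)$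 with respect to the law of $(X,Y)$; let $\mu_\lambda$, $\sigma_\lambda^2$, $M_\lambda$ be the mean, the variance and the third absolute central moment of $-\ln p(X_\lambda|Y_\lambda)$, and let $\delta(\lambda)=\mu_\lambda-H$. Let $r(\delta)=\sup_{\lambda\ge0}[\lambda(H+\delta)-\ln\phi(\lambda)]$. Let $Q(z)=\frac1{\sqrt{2\pi}}\int_z^\infty e^{-t^2/2}dt$ and let $C_{BE}$ be a constant not smaller than the best universal constant of the i.i.d. Berry–Esseen theorem. Put $$\underline\xi(\lambda,n)=e^{n\lambda^2\sigma_\lambda^2/2}\,Q\big(\rho_*+\sqrt n\,\lambda\sigma_\lambda\big),\qquad Q(\rho_*)=\tfrac12-\tfrac{2C_{BE}M_\lambda}{\sqrt n\,\sigma_\lambda^3},$$ whenever the last expression is positive. For $n\ge1$ let $(X_i,Y_i)$, $i\le n$, be independent copies of $(X,Y)$, and $p(x^n|y^n)=\prod_i p(x_i|y_i)$. For real $\delta$ let $B_{n,\delta}$ be the set of all $y^n$ for which some $x^n\in\{0,1\}^n$ satisfies $\infty>-\frac1n\ln p(x^n|y^n)>H+\delta$, and let $P(B_{n,\delta})=\Pr\{Y^n\in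 B_{n,\delta}\}$. A code $\mathcal C_n$ of block length $n$ consists of $M\ge1$ equiprobable messages, a codeword in $\{0,1\}^n$ for each message, and disjoint decision regions in $\mathcal Y^n$; its rate is $R(\mathcal C_n)=\frac{\ln M}{n}$, and $P_e(\mathcal C_n)$ is its average word error probability. **Theorem.** Let $n\ge1$, $\epsilon_n\in(0,1)$, and let $\delta$ be any real number, in particular the largest one if it exists, such that $$\Big(1+\frac{2}{\sigma_H}\sqrt{\frac{-2\ln\epsilon_n}{n}}\Big)\epsilon_n\le\Pr\Big\{-\frac1n\ln p(X^n|Y^n)>H+\delta\Big\}.$$ Then every code $\mathcal C_n$ of block length $n$ with $P_e(\mathcal C_n)\le\epsilon_n$ satisfies $$R(\mathcal C_n)\le C-\delta-\frac{\ln\epsilon_n-\ln P(B_{n,\delta})+\ln\frac{-2\ln\epsilon_n}{\sigma_H^2n}-\ln\Big(1+\frac1{\sigma_H}\sqrt{\frac{-2\ln\epsilon_n}{n}}\Big)}{n}.\qquad(*)$$ Moreover: 1. $(*)$ also holds for every code with $P_e(\mathcal C_n)\le\epsilon_n$ when $\delta=\delta(\lambda)$ for some $\lambda\in[0,\lambda^*)$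 with $\frac{2C_{BE}M_\lambda}{\sqrt n\,\sigma_\lambda^3}<\frac12$ and $\big(1+\frac{2}{\sigma_H}\sqrt{\frac{-2\ln\epsilon_n}{n}}\big)\epsilon_n=\underline\xi(\lambda,n)\,e^{-n\,r(\delta)}$. 2. For every $\alpha\in(0,1)$, codes with $P_e(\mathcal C_n)\le\frac{e^{-n^\alpha}}{2\sqrt{\pi n^\alpha}}\big(1-\frac1{2n^\alpha}\big)$ satisfy $R(\mathcal C_n)\le C-\sqrt2\,\sigma_H\,n^{-\frac{1-\alpha}2}+O(n^{-(1-\alpha)})$. 3. For every $\alpha>0$, codes with $P_e(\mathcal C_n)\le\frac{n^{-\alpha}}{2\sqrt{\pi\alpha\ln n}}\big(1-\frac1{2\alpha\ln n}\big)$ satisfy $R(\mathcal C_n)\le C-\sigma_H\sqrt{\frac{2\alpha\ln n}{n}}+O\big(\frac{\ln n}n\big)$. 4. Let $\epsilon\in(0,1)$ and $a_n=\epsilon+\frac1{\sqrt n}\Big(\frac{2\sqrt{-2\ln\epsilon}}{\sigma_H}\epsilon+\frac{C_{BE}M_H}{\sigma_H^3}\Big)$. If $a_n<1$, then every code with $P_e(\mathcal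 C_n)\le\epsilon$ satisfies $$R(\mathcal C_n)\le C-\frac{\ln\epsilon+\ln\frac{-2\ln\epsilon}{\sigma_H^2n}-\ln\Big(1+\frac1{\sigma_H}\sqrt{\frac{-2\ln\epsilon}{n}}\Big)}{n}-\frac{\sigma_H}{\sqrt n}Q^{-1}(a_n),$$ and as $n\to\infty$ the right side equals $C-\frac{\sigma_H}{\sqrt n}Q^{-1}(\epsilon)+\frac{\ln n}{n}+O(n^{-1})$. The implied constants in 2 and 3 depend only on the channel and $\alpha$ (not on the code), those in 4 only on the channel, $\epsilon$ and $C_{BE}$. -/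

import Mathlib

open MeasureTheory ProbabilityTheory
open scoped ENNReal NNReal

noncomputable section

/-- The Gaussian tail function `Q(z) = (2π)^{-1/2} ∫_z^∞ e^{-t²/2} dt`. -/
def gaussianQ (z : ℝ) : ℝ :=
  (√(2 * Real.pi))⁻¹ * ∫ t in Set.Ioi z, Real.exp (-t ^ 2 / 2)

/-- The inverse function of `Q : ℝ → (0, 1)`; only its values on `(0, 1)` are meaningful. -/
def gaussianQInv (q : ℝ) : ℝ := Function.invFun gaussianQ q

/-- `C` is a constant for which the Berry-Esseen central limit theorem for sums of `n` i.i.d. real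
random variables (common law `ν`, positive variance, finite third absolute moment) holds, written
with the tail probabilities of the normalized sum. -/
def IsBerryEsseenBound (C : ℝ) : Prop :=
  ∀ ν : Measure ℝ, IsProbabilityMeasure ν →
    Integrable (fun x : ℝ => |x| ^ 3) ν → 0 < Var[id; ν] →
    ∀ n : ℕ, 0 < n → ∀ t : ℝ,
      |(Measure.pi (fun _ : Fin n => ν)).real
          {x | n * (∫ u, u ∂ν) + t * (√n * √(Var[id; ν])) < ∑ i, x i} - gaussianQ t|
        ≤ C * (∫ u, |u - ∫ v, v ∂ν| ^ 3 ∂ν) / (√n * √(Var[id; ν]) ^ 3)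

/-- The (best) universal constant of the i.i.d. Berry-Esseen central limit theorem. -/
def berryEsseenConst : ℝ := sInf {C : ℝ | IsBerryEsseenBound C}

/-- A binary-input channel `{p(y|x)}` with input alphabet `{0, 1}` and arbitrary output alphabet
`𝓨`, given by probability densities with respect to a reference measure `μ` (for instance counting
measure for discrete outputs and Lebesgue measure for continuous outputs). -/
structure BinaryChannel (𝓨 : Type*) [MeasurableSpace 𝓨] (μ : Measure 𝓨) where
  /-- the transition density `p x y = p(y|x)` -/
  p : Fin 2 → 𝓨 → ℝ≥0
  measurable_p : ∀ x, Measurable (p x)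
  lintegral_p : ∀ x, ∫⁻ y, (p x y : ℝ≥0∞) ∂μ = 1

namespace BinaryChannel

variable {𝓨 : Type*} [MeasurableSpace 𝓨] {μ : Measure 𝓨} (W : BinaryChannel 𝓨 μ)

/-- Law of the channel output given the input `x`. -/
def law (x : Fin 2) : Measure 𝓨 := μ.withDensity (fun y => (W.p x y : ℝ≥0∞))

/-- Joint law of `(X, Y)`, with `X` uniform on `{0, 1}` and `Y` the channel output. -/
def joint : Measure (Fin 2 × 𝓨) :=
  ∑ x : Fin 2, (2⁻¹ : ℝ≥0∞) • (W.law x).map (Prod.mk x)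

/-- Law of `Y` when `X` is uniform on `{0, 1}`. -/
def output : Measure 𝓨 := ∑ x : Fin 2, (2⁻¹ : ℝ≥0∞) • W.law x

/-- The conditional probability `p(x|y)` of `X = x` given `Y = y`, for uniform `X`. -/
def posteriorProb (x : Fin 2) (y : 𝓨) : ℝ := W.p x y / (W.p 0 y + W.p 1 y)

/-- Symmetry: `-ln p(0|Y)` given `X = 0` and `-ln p(1|Y)` given `X = 1` have the same
distribution. (`p(x|Y) > 0` almost surely given `X = x`, so the value of `log 0` is irrelevant.) -/
def IsSymmetric : Prop :=
  (W.law 0).map (fun y => -Real.log (W.posteriorProb 0 y)) =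
    (W.law 1).map (fun y => -Real.log (W.posteriorProb 1 y))

/-- The mutual information (in nats) between the channel input, of distribution `t`, and the
channel output: `I(t; P) = ∑ₓ t(x) ∫ p(y|x) ln (p(y|x) / q_t(y)) dy`, `q_t = ∑ₓ t(x) p(·|x)`. -/
def mutualInfo (t : Fin 2 → ℝ) : ℝ :=
  ∑ x, t x * ∫ y, (W.p x y : ℝ) * Real.log (W.p x y / ∑ u, t u * W.p u y) ∂μ

/-- The channel capacity (in nats). -/
def capacity : ℝ := sSup (W.mutualInfo '' stdSimplex ℝ (Fin 2))

/-- The random variable `-ln p(X|Y)` on the space of pairs `(x, y)`. It is almost surely given by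
the true logarithm, as `p(X|Y) > 0` almost surely. -/
def info (w : Fin 2 × 𝓨) : ℝ := -Real.log (W.posteriorProb w.1 w.2)

/-- The conditional entropy `H(X|Y)` (in nats). -/
def condEntropy : ℝ := ∫ w, W.info w ∂W.joint

/-- `σ_H(X|Y)`, the standard deviation of `-ln p(X|Y)`. -/
def sigmaH : ℝ := √(Var[W.info; W.joint])

/-- `M_H(X|Y)`, the third absolute central moment of `-ln p(X|Y)`. -/
def thirdH : ℝ := ∫ w, |W.info w - W.condEntropy| ^ 3 ∂W.joint

/-! ### Exponentially tilted quantities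

Note `p(X|Y)^{-l} = exp (l * (-ln p(X|Y)))`, and
`∑ₓ ∫ p(y) p(x|y)^{1-l} dy = E[p(X|Y)^{-l}]` is the moment generating function of `-ln p(X|Y)`. -/

/-- `λ*(X|Y)`, the supremum (possibly `∞`) of the `l ≥ 0` with `E[p(X|Y)^{-l}] < ∞`. -/
def lambdaStar : EReal :=
  sSup ((fun l : ℝ => (l : EReal)) '' {l : ℝ | 0 ≤ l ∧ l ∈ integrableExpSet W.info W.joint})

/-- `r_{X|Y}(δ) = sup_{l ≥ 0} [l (H(X|Y) + δ) - ln E[p(X|Y)^{-l}]]`. Those `l` with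
`E[p(X|Y)^{-l}] = ∞` contribute `-∞` and are left out. -/
def rateFn (δ : ℝ) : ℝ :=
  sSup ((fun l : ℝ => l * (W.condEntropy + δ) - cgf W.info W.joint l) ''
    {l : ℝ | 0 ≤ l ∧ l ∈ integrableExpSet W.info W.joint})

/-- The law of `(X_l, Y_l)`: density `p(x|y)^{-l} / E[p(X|Y)^{-l}]` relative to that of
`(X, Y)`. -/
def tiltedJoint (l : ℝ) : Measure (Fin 2 × 𝓨) := W.joint.tilted (fun w => l * W.info w)

/-- `E[-ln p(X_l|Y_l)]`. -/
def tiltedMean (l : ℝ) : ℝ := ∫ w, W.info w ∂W.tiltedJoint l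

/-- `δ(l) = E[-ln p(X_l|Y_l)] - H(X|Y)`. -/
def tiltedDelta (l : ℝ) : ℝ := W.tiltedMean l - W.condEntropy

/-- `σ_H(X|Y, l)`, the standard deviation of `-ln p(X_l|Y_l)`. -/
def tiltedSigma (l : ℝ) : ℝ := √(Var[W.info; W.tiltedJoint l])

/-- `M_H(X|Y, l)`, the third absolute central moment of `-ln p(X_l|Y_l)`. -/
def tiltedThird (l : ℝ) : ℝ := ∫ w, |W.info w - W.tiltedMean l| ^ 3 ∂W.tiltedJoint l

/-- The lower prefactor `e^{n l² σ_H²(X|Y,l) / 2} Q(ρ + √n l σ_H(X|Y,l))`, where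
`Q(ρ) = 1/2 - 2 C M_H(X|Y,l) / (√n σ_H³(X|Y,l))`; `C` is the Berry-Esseen constant. -/
def xiLower (C l : ℝ) (n : ℕ) : ℝ :=
  Real.exp (n * l ^ 2 * W.tiltedSigma l ^ 2 / 2) *
    gaussianQ (gaussianQInv (1 / 2 - 2 * C * W.tiltedThird l / (√n * W.tiltedSigma l ^ 3)) +
      √n * l * W.tiltedSigma l)

/-! ### Blocks of length `n` over the memoryless channel -/

/-- The law `P_{xⁿ}` of the output block given the input block `xⁿ`. -/
def blockLaw {n : ℕ} (x : Fin n → Fin 2) : Measure (Fin n → 𝓨) :=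
  Measure.pi (fun i => W.law (x i))

/-- The law of `Yⁿ`, the output block for `n` independent uniform inputs. -/
def blockOutput (n : ℕ) : Measure (Fin n → 𝓨) := Measure.pi (fun _ => W.output)

/-- `p(xⁿ|yⁿ)`, for independent uniform inputs. -/
def blockPosterior {n : ℕ} (x : Fin n → Fin 2) (y : Fin n → 𝓨) : ℝ :=
  ∏ i, W.posteriorProb (x i) (y i)

/-- `Pr{-(1/n) ln p(Xⁿ|Yⁿ) > H(X|Y) + δ}`, where `(Xᵢ, Yᵢ)` are independent copies of
`(X, Y)`. -/
def tailProb (n : ℕ) (δ : ℝ) : ℝ :=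
  (Measure.pi (fun _ : Fin n => W.joint)).real
    {w | W.condEntropy + δ <
      -(1 / n) * Real.log (W.blockPosterior (fun i => (w i).1) (fun i => (w i).2))}

/-- `B(xⁿ, δ) = {yⁿ : ∞ > -(1/n) ln p(xⁿ|yⁿ) > H(X|Y) + δ}`, the outer mirror image of jar. -/
def outerMirror {n : ℕ} (x : Fin n → Fin 2) (δ : ℝ) : Set (Fin n → 𝓨) :=
  {y | 0 < W.blockPosterior x y ∧
    W.condEntropy + δ < -(1 / n) * Real.log (W.blockPosterior x y)}

/-- `P(B_{n,δ}) = Pr{Yⁿ ∈ B_{n,δ}}`, where `B_{n,δ}` is the union of all `B(xⁿ, δ)`. -/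
def mirrorProb (n : ℕ) (δ : ℝ) : ℝ :=
  (W.blockOutput n).real (⋃ x : Fin n → Fin 2, W.outerMirror x δ)

/-- The left side `(1 + (2/σ_H) √(-2 ln ε / n)) ε` of the conditions that determine `δ`. -/
def errorLevel (n : ℕ) (ε : ℝ) : ℝ :=
  (1 + 2 / W.sigmaH * √(-2 * Real.log ε / n)) * ε

/-- The converse bound
`C - δ - [ln ε - ln P(B_{n,δ}) + ln (-2 ln ε / (σ_H² n)) - ln (1 + √(-2 ln ε / n) / σ_H)] / n`. -/
def converseBound (n : ℕ) (ε δ : ℝ) : ℝ :=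
  W.capacity - δ -
    (Real.log ε - Real.log (W.mirrorProb n δ) + Real.log (-2 * Real.log ε / (W.sigmaH ^ 2 * n))
      - Real.log (1 + √(-2 * Real.log ε / n) / W.sigmaH)) / n

/-- The argument `ε + (1/√n) (2 √(-2 ln ε) ε / σ_H + C M_H / σ_H³)` of `Q⁻¹` in the
normal-approximation bound; `C` is the Berry-Esseen constant. -/
def normalArg (C : ℝ) (n : ℕ) (ε : ℝ) : ℝ :=
  ε + 1 / √n * (2 * √(-2 * Real.log ε) / W.sigmaH * ε + C * W.thirdH / W.sigmaH ^ 3)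

/-- The normal-approximation bound
`C - [ln ε + ln (-2 ln ε / (σ_H² n)) - ln (1 + √(-2 ln ε / n) / σ_H)] / n
  - (σ_H / √n) Q⁻¹(ε + (1/√n) (2 √(-2 ln ε) ε / σ_H + C M_H / σ_H³))`. -/
def normalBound (C : ℝ) (n : ℕ) (ε : ℝ) : ℝ :=
  W.capacity -
    (Real.log ε + Real.log (-2 * Real.log ε / (W.sigmaH ^ 2 * n))
      - Real.log (1 + √(-2 * Real.log ε / n) / W.sigmaH)) / n -
    W.sigmaH / √n * gaussianQInv (W.normalArg C n ε)

end BinaryChannel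

/-- A channel code of block length `n` for binary inputs and output alphabet `𝓨`: a positive
number of equiprobable messages, a codeword for each message, and disjoint measurable decision
regions (outputs in no region are decoding failures). -/
structure ChannelCode (𝓨 : Type*) [MeasurableSpace 𝓨] (n : ℕ) where
  size : ℕ
  size_pos : 0 < size
  codeword : Fin size → Fin n → Fin 2
  region : Fin size → Set (Fin n → 𝓨)
  measurableSet_region : ∀ m, MeasurableSet (region m)
  disjoint_region : Pairwise (fun m m' => Disjoint (region m) (region m'))

namespace ChannelCode

variable {𝓨 : Type*} [MeasurableSpace 𝓨] {n : ℕ}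

/-- The rate in nats per channel use. -/
def rate (c : ChannelCode 𝓨 n) : ℝ := Real.log c.size / n

/-- The average word error probability over the channel `W`. -/
def avgError {μ : Measure 𝓨} (c : ChannelCode 𝓨 n) (W : BinaryChannel 𝓨 μ) : ℝ :=
  (∑ m, (W.blockLaw (c.codeword m)).real (c.region m)ᶜ) / c.size

end ChannelCode

end

/-!
The heart of the matter is a counting argument. Let `x` be a codeword with decision region `D`, and
let `B = B(x, δ)` be its outer mirror image, the outputs for which `-(1/n) ln p(x|y) > H + δ`. On `B`,
Bayes' rule bounds the density of the channel law with respect to the output law by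
`e^{n (ln 2 - H - δ)}`, so the channel law of `B ∩ D` is at most that factor times the output
probability of `B ∩ D`. By symmetry, `B` has the same channel probability for every codeword,
namely the tail probability of `-(1/n) ln p(Xⁿ|Yⁿ)` at `H + δ`. Averaging over the codewords and
using that the regions are disjoint gives
`M (tail - ε) ≤ e^{n (ln 2 - H - δ)} P(B_{n,δ})`
(`BinaryChannel.IsSymmetric.size_mul_le`); with the assumed lower bound on the tail and
`ln 2 - H ≤ C` this is the general converse
(`BinaryChannel.IsSymmetric.rate_le_converseBound`). Everything else is a lower bound on the tail of
a sum of i.i.d. random variables, to be inserted in that converse.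

The best Berry-Esseen constant is defined as an infimum, which means something only if the
Berry-Esseen theorem holds with some constant. It is proved by Lindeberg's method in Bergström's form:
the summands are replaced by Gaussians one at a time, inside a test function that is the tail
function of a Gaussian whose variance is that of the summands already replaced plus `a²`. The third
derivative of the test function, averaged over the law of the remaining sum, is controlled by
induction on the number of summands, since that law has tails close to Gaussian ones
(`abs_smooth_sumLaw_sub_le`). With `a` a large multiple of the third moment the induction closes,
once the smoothing has been removed (`abs_sub_le_of_smooth`, `exists_abs_sumLaw_sub_le`).

For the tail at `δ(l)` the law is tilted so that the threshold becomes the mean. The tail is then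
`e^{-n r}` times `E[e^{-aU}; U > 0]` with `U` nearly Gaussian, and the Berry-Esseen theorem bounds
this from below by the prefactor (`le_setIntegral_exp_neg`, `le_pi_real_of_tilted`,
`BinaryChannel.xiLower_mul_exp_le_tailProb`). When the error probability tends to zero, it is written
as a lower bound for `Q(√(2u))`, with `u = n^α` or `u = α ln n`; a tilt slightly below
`√(2u/n) / σ_H`, expansions of the cumulant generating function at `0` and the monotonicity of
the Mills ratio show that the tail exceeds the required level
(`BinaryChannel.exists_errorLevel_le_tailProb`). For a constant error probability the Berry-Esseen
theorem is applied to the sum itself (`BinaryChannel.gaussianQ_sub_le_tailProb`).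
-/

open Filter Topology Set

/-! ### The Gaussian tail function -/

lemma gaussianPDFReal_zero_one (x : ℝ) :
    gaussianPDFReal 0 1 x = (√(2 * Real.pi))⁻¹ * Real.exp (-x ^ 2 / 2) := by
  simp [gaussianPDFReal]

lemma gaussianQ_eq_real (z : ℝ) : gaussianQ z = (gaussianReal 0 1).real (Ioi z) := by
  rw [measureReal_def, gaussianReal_apply_eq_integral 0 one_ne_zero,
    ENNReal.toReal_ofReal (setIntegral_nonneg measurableSet_Ioi
      (fun x _ => gaussianPDFReal_nonneg 0 1 x)), gaussianQ, ← integral_const_mul]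
  simp_rw [gaussianPDFReal_zero_one]

/-- Tail probabilities of a centred Gaussian of positive variance, by scaling. -/
lemma gaussianReal_real_Ioi {v : ℝ≥0} (hv : v ≠ 0) (z : ℝ) :
    (gaussianReal 0 v).real (Ioi z) = gaussianQ (z / √v) := by
  have hs : 0 < √(v : ℝ) := Real.sqrt_pos.2 (by positivity)
  have h := gaussianReal_map_const_mul (μ := 0) (v := 1) (√(v : ℝ))
  have hv' : (.mk (√(v : ℝ) ^ 2) (sq_nonneg _) * 1 : ℝ≥0) = v := by
    ext; simp
  rw [mul_zero, hv'] at h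
  rw [← h, map_measureReal_apply (by fun_prop) measurableSet_Ioi, gaussianQ_eq_real]
  congr 1
  ext x
  simp [div_lt_iff₀' hs]

lemma gaussianPDFReal_le_one (x : ℝ) : gaussianPDFReal 0 1 x ≤ 1 := by
  rw [gaussianPDFReal_zero_one]
  have h1 : 1 ≤ √(2 * Real.pi) := by
    rw [Real.one_le_sqrt]; nlinarith [Real.pi_gt_three]
  have h2 : Real.exp (-x ^ 2 / 2) ≤ 1 := by
    rw [Real.exp_le_one_iff]; nlinarith [sq_nonneg x]
  exact mul_le_one₀ (inv_le_one_of_one_le₀ h1) (Real.exp_pos _).le h2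

lemma continuous_gaussianPDFReal_zero_one : Continuous (gaussianPDFReal 0 1) := by
  have : gaussianPDFReal 0 1 = fun x => (√(2 * Real.pi))⁻¹ * Real.exp (-x ^ 2 / 2) :=
    funext gaussianPDFReal_zero_one
  rw [this]; fun_prop

lemma gaussianQ_sub_gaussianQ {x y : ℝ} (h : x ≤ y) :
    gaussianQ x - gaussianQ y = ∫ t in x..y, gaussianPDFReal 0 1 t := by
  rw [gaussianQ, gaussianQ, ← integral_const_mul, ← integral_const_mul]
  simp_rw [← gaussianPDFReal_zero_one]
  have hi := integrable_gaussianPDFReal 0 1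
  rw [intervalIntegral.integral_of_le h, sub_eq_iff_eq_add,
    ← setIntegral_union (Ioc_disjoint_Ioi le_rfl) measurableSet_Ioi hi.integrableOn hi.integrableOn,
    Ioc_union_Ioi_eq_Ioi h]

lemma gaussianQ_eq_sub (x : ℝ) :
    gaussianQ x = gaussianQ 0 - ∫ t in (0 : ℝ)..x, gaussianPDFReal 0 1 t := by
  rcases le_total 0 x with h | h
  · rw [← gaussianQ_sub_gaussianQ h]; ring
  · rw [intervalIntegral.integral_symm, ← gaussianQ_sub_gaussianQ h]; ring

lemma hasDerivAt_gaussianQ (x : ℝ) : HasDerivAt gaussianQ (-gaussianPDFReal 0 1 x) x := by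
  have h := (continuous_gaussianPDFReal_zero_one.integral_hasStrictDerivAt 0 x).hasDerivAt
  rw [show gaussianQ = fun x => gaussianQ 0 - ∫ t in (0 : ℝ)..x, gaussianPDFReal 0 1 t from
    funext gaussianQ_eq_sub]
  exact h.const_sub _

lemma continuous_gaussianQ : Continuous gaussianQ :=
  continuous_iff_continuousAt.2 fun x => (hasDerivAt_gaussianQ x).continuousAt

lemma strictAnti_gaussianQ : StrictAnti gaussianQ :=
  strictAnti_of_deriv_neg fun x => by
    rw [(hasDerivAt_gaussianQ x).deriv]
    exact neg_lt_zero.2 (gaussianPDFReal_pos 0 1 x one_ne_zero)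

lemma gaussianQ_nonneg (x : ℝ) : 0 ≤ gaussianQ x := by
  rw [gaussianQ_eq_real]; exact measureReal_nonneg

lemma gaussianQ_neg (x : ℝ) : gaussianQ (-x) = 1 - gaussianQ x := by
  have h := gaussianReal_map_neg (μ := 0) (v := 1)
  have : NullSingletonClass (gaussianReal 0 1) := nullSingletonClass_gaussianReal one_ne_zero
  rw [neg_zero] at h
  rw [gaussianQ_eq_real, gaussianQ_eq_real, ← h, map_measureReal_apply (by fun_prop)
    measurableSet_Ioi, h, ← probReal_compl_eq_one_sub measurableSet_Ioi, compl_Ioi]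
  have : (fun y : ℝ => -y) ⁻¹' Ioi (-x) = Iio x := by ext; simp
  rw [this]
  exact measureReal_congr Iio_ae_eq_Iic

lemma gaussianQ_zero : gaussianQ 0 = 1 / 2 := by
  have h := gaussianQ_neg 0
  rw [neg_zero] at h
  linarith

lemma tendsto_gaussianQ_atTop : Tendsto gaussianQ atTop (𝓝 0) := by
  have h : Tendsto (fun x : ℝ => (gaussianReal 0 1) (Ioi x)) atTop (𝓝 0) := by
    have := tendsto_measure_iInter_atTop (μ := gaussianReal 0 1) (s := fun x : ℝ => Ioi x)
      (fun _ => measurableSet_Ioi.nullMeasurableSet) (fun a b hab => Ioi_subset_Ioi hab)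
      ⟨0, measure_ne_top _ _⟩
    have he : (⋂ x : ℝ, Ioi x) = ∅ := by
      ext y; simp only [mem_iInter, mem_Ioi, mem_empty_iff_false, iff_false, not_forall, not_lt]
      exact ⟨y, le_rfl⟩
    rwa [he, measure_empty] at this
  have h2 := (ENNReal.tendsto_toReal ENNReal.zero_ne_top).comp h
  refine h2.congr fun x => ?_
  rw [gaussianQ_eq_real]; rfl

lemma tendsto_gaussianQ_atBot : Tendsto gaussianQ atBot (𝓝 1) := by
  have h := (tendsto_gaussianQ_atTop.comp tendsto_neg_atBot_atTop).const_sub 1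
  rw [sub_zero] at h
  refine h.congr fun x => ?_
  simp [gaussianQ_neg]

lemma exists_gaussianQ_eq {q : ℝ} (h0 : 0 < q) (h1 : q < 1) : ∃ x, gaussianQ x = q := by
  obtain ⟨a, ha⟩ := (tendsto_gaussianQ_atTop.eventually (gt_mem_nhds h0)).exists
  obtain ⟨b, hb⟩ := (tendsto_gaussianQ_atBot.eventually (lt_mem_nhds h1)).exists
  exact mem_range_of_exists_le_of_exists_ge continuous_gaussianQ ⟨a, ha.le⟩ ⟨b, hb.le⟩

lemma gaussianQ_gaussianQInv {q : ℝ} (h0 : 0 < q) (h1 : q < 1) :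
    gaussianQ (gaussianQInv q) = q :=
  Function.invFun_eq (exists_gaussianQ_eq h0 h1)

lemma gaussianQInv_gaussianQ (x : ℝ) : gaussianQInv (gaussianQ x) = x :=
  Function.leftInverse_invFun strictAnti_gaussianQ.injective x

lemma abs_gaussianQ_sub_le (x y : ℝ) : |gaussianQ x - gaussianQ y| ≤ |x - y| := by
  have h := Convex.norm_image_sub_le_of_norm_hasDerivWithin_le (f := gaussianQ) (C := 1)
    (s := univ) (fun x _ => (hasDerivAt_gaussianQ x).hasDerivWithinAt)
    (fun x _ => by
      rw [norm_neg, Real.norm_of_nonneg (gaussianPDFReal_nonneg _ _ _)]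
      exact gaussianPDFReal_le_one x) convex_univ (mem_univ y) (mem_univ x)
  simpa using h

/-- `Q` is locally bi-Lipschitz, so its inverse is Lipschitz at every point of `(0, 1)`. -/
lemma exists_abs_gaussianQInv_sub_le {q : ℝ} (h0 : 0 < q) (h1 : q < 1) :
    ∃ K : ℝ, 0 ≤ K ∧ ∀ᶠ p in 𝓝 q, |gaussianQInv p - gaussianQInv q| ≤ K * |p - q| := by
  obtain ⟨z, rfl⟩ := exists_gaussianQ_eq h0 h1
  obtain ⟨w, hw, hm⟩ := (isCompact_Icc (a := z - 1) (b := z + 1)).exists_isMinOn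
    ⟨z, by constructor <;> linarith⟩ continuous_gaussianPDFReal_zero_one.continuousOn
  set m := gaussianPDFReal 0 1 w
  have hmpos : 0 < m := gaussianPDFReal_pos 0 1 w one_ne_zero
  have hmv : ∀ x ∈ Icc (z - 1) (z + 1), ∀ y ∈ Icc (z - 1) (z + 1), x ≤ y →
      m * (y - x) ≤ gaussianQ x - gaussianQ y := by
    intro x hx y hy hxy
    have := (convex_Icc (z - 1) (z + 1)).mul_sub_le_image_sub_of_le_deriv
      (f := fun x => -gaussianQ x) (C := m) continuous_gaussianQ.neg.continuousOn
      (fun x _ => (hasDerivAt_gaussianQ x).neg.differentiableAt.differentiableWithinAt)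
      (fun x hx => by
        rw [show deriv (fun x => -gaussianQ x) x = _ from (hasDerivAt_gaussianQ x).neg.deriv,
          neg_neg]
        exact hm (interior_subset hx)) x hx y hy hxy
    linarith
  refine ⟨m⁻¹, (inv_pos.2 hmpos).le, ?_⟩
  have hn : Ioo (gaussianQ (z + 1)) (gaussianQ (z - 1)) ∈ 𝓝 (gaussianQ z) :=
    Ioo_mem_nhds (strictAnti_gaussianQ (by linarith)) (strictAnti_gaussianQ (by linarith))
  filter_upwards [hn] with p hp
  obtain ⟨y, rfl⟩ := exists_gaussianQ_eq ((gaussianQ_nonneg _).trans_lt hp.1)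
    (hp.2.trans_le (by rw [gaussianQ_eq_real]; exact measureReal_le_one))
  have hy : y ∈ Icc (z - 1) (z + 1) :=
    ⟨(strictAnti_gaussianQ.lt_iff_gt.1 hp.2).le, (strictAnti_gaussianQ.lt_iff_gt.1 hp.1).le⟩
  have hz : z ∈ Icc (z - 1) (z + 1) := by constructor <;> linarith
  rw [gaussianQInv_gaussianQ, gaussianQInv_gaussianQ, inv_mul_eq_div, le_div_iff₀' hmpos]
  rcases le_total y z with h | h
  · have := hmv y hy z hz h
    rw [abs_of_nonpos (by linarith)]
    exact le_trans (by linarith) (le_abs_self _)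
  · have := hmv z hz y hy h
    rw [abs_of_nonneg (by linarith)]
    exact le_trans (by linarith) (neg_le_abs _)

lemma exp_mul_gaussianQ (x : ℝ) :
    Real.exp (x ^ 2 / 2) * gaussianQ x =
      (√(2 * Real.pi))⁻¹ * ∫ s in Ioi (0 : ℝ), Real.exp (-(x * s) - s ^ 2 / 2) := by
  have h := (measurePreserving_add_right volume x).setIntegral_preimage_emb
    (measurableEmbedding_addRight x) (fun t : ℝ => Real.exp (-t ^ 2 / 2)) (Ioi x)
  have hp : (fun y : ℝ => y + x) ⁻¹' Ioi x = Ioi 0 := by ext; simp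
  rw [hp] at h
  rw [gaussianQ, ← h, mul_left_comm, ← integral_const_mul]
  congr 2
  ext s
  rw [← Real.exp_add]
  congr 1
  ring

/-- The Mills ratio `e^{x²/2} Q(x)` is decreasing. -/
lemma antitone_exp_mul_gaussianQ : Antitone fun x => Real.exp (x ^ 2 / 2) * gaussianQ x := by
  have hi : ∀ x : ℝ, Integrable (fun s : ℝ => Real.exp (-(x * s) - s ^ 2 / 2)) := by
    intro x
    have h := ((integrable_exp_neg_mul_sq (b := 1 / 2) (by norm_num)).comp_add_right x).const_mul
      (Real.exp (x ^ 2 / 2))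
    refine h.congr (ae_of_all _ fun s => ?_)
    simp only
    rw [← Real.exp_add]
    congr 1
    ring
  intro x y hxy
  simp only [exp_mul_gaussianQ]
  refine mul_le_mul_of_nonneg_left ?_ (by positivity)
  refine setIntegral_mono_on (hi y).integrableOn (hi x).integrableOn measurableSet_Ioi
    fun s hs => ?_
  rw [Real.exp_le_exp]
  nlinarith [mul_le_mul_of_nonneg_right hxy (le_of_lt (show (0 : ℝ) < s from hs))]

lemma hasDerivAt_gaussianPDFReal (x : ℝ) :
    HasDerivAt (gaussianPDFReal 0 1) (-x * gaussianPDFReal 0 1 x) x := by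
  rw [show gaussianPDFReal 0 1 = fun x => (√(2 * Real.pi))⁻¹ * Real.exp (-x ^ 2 / 2) from
    funext gaussianPDFReal_zero_one]
  have h1 : HasDerivAt (fun x : ℝ => -x ^ 2 / 2) (-x) x := by
    have := ((hasDerivAt_pow 2 x).neg.div_const 2)
    refine this.congr_deriv ?_
    push_cast; ring
  refine (h1.exp.const_mul _).congr_deriv ?_
  ring

/-- The classical lower bound on the Gaussian tail. -/
lemma le_gaussianQ {x : ℝ} (hx : 0 < x) :
    gaussianPDFReal 0 1 x * (1 / x - 1 / x ^ 3) ≤ gaussianQ x := by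
  set g : ℝ → ℝ := fun x => gaussianQ x - gaussianPDFReal 0 1 x * (x⁻¹ - (x ^ 3)⁻¹) with hg
  have hd : ∀ y ∈ Ioi (0 : ℝ), HasDerivAt g (-3 * gaussianPDFReal 0 1 y / y ^ 4) y := by
    intro y hy
    have hy0 : y ≠ 0 := (ne_of_gt hy)
    have h1 := (hasDerivAt_inv hy0).sub ((hasDerivAt_pow 3 y).inv (pow_ne_zero 3 hy0))
    refine ((hasDerivAt_gaussianQ y).sub ((hasDerivAt_gaussianPDFReal y).mul h1)).congr_deriv ?_
    simp only [Pi.sub_apply, Pi.inv_apply]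
    field_simp
    push_cast
    ring
  have hanti : AntitoneOn g (Ioi 0) := by
    refine antitoneOn_of_deriv_nonpos (convex_Ioi 0)
      (fun y hy => (hd y hy).continuousAt.continuousWithinAt)
      (fun y hy => (hd y (interior_subset hy)).differentiableAt.differentiableWithinAt) ?_
    intro y hy
    rw [(hd y (interior_subset hy)).deriv]
    have := gaussianPDFReal_nonneg 0 1 y
    exact div_nonpos_of_nonpos_of_nonneg (by linarith) (by positivity)
  have hlim : Tendsto g atTop (𝓝 0) := by
    have h1 : Tendsto (fun x : ℝ => gaussianPDFReal 0 1 x * (x⁻¹ - (x ^ 3)⁻¹)) atTop (𝓝 0) := by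
      have h2 : Tendsto (fun x : ℝ => x⁻¹ - (x ^ 3)⁻¹) atTop (𝓝 0) := by
        have := (tendsto_inv_atTop_zero (𝕜 := ℝ)).sub
          (tendsto_inv_atTop_zero.comp (tendsto_pow_atTop (α := ℝ) (n := 3) (by norm_num)))
        simpa using this
      refine squeeze_zero_norm' (a := fun x : ℝ => |x⁻¹ - (x ^ 3)⁻¹|) (Eventually.of_forall ?_)
        (by simpa using h2.abs)
      intro x
      rw [norm_mul, Real.norm_of_nonneg (gaussianPDFReal_nonneg _ _ _), Real.norm_eq_abs]
      exact mul_le_of_le_one_left (abs_nonneg _) (gaussianPDFReal_le_one x)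
    simpa using tendsto_gaussianQ_atTop.sub h1
  have h0 : 0 ≤ g x := by
    refine le_of_tendsto hlim ?_
    filter_upwards [eventually_ge_atTop x] with y hy
    exact hanti hx (hx.trans_le hy) hy
  simp only [hg] at h0
  rw [one_div, one_div]
  linarith

/-! ### Tails of convolutions, smoothing, and one Lindeberg replacement -/

lemma conv_real_Ioi (L M : Measure ℝ) [IsProbabilityMeasure L] [IsProbabilityMeasure M] (c : ℝ) :
    (L.conv M).real (Ioi c) = ∫ s, M.real (Ioi (c - s)) ∂L := by
  have h := integral_indicator_one (μ := L.conv M) (measurableSet_Ioi (a := c))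
  rw [← h, integral_conv]
  · congr 1
    ext s
    rw [← integral_indicator_one measurableSet_Ioi]
    congr 1
    ext y
    simp [indicator, sub_lt_iff_lt_add']
  · exact (integrable_const (1 : ℝ)).indicator measurableSet_Ioi

/-- If two laws have tails within `D` of one another, their integrals of a function vanishing at
`-∞` differ by at most `D` times its total variation. -/
lemma abs_integral_sub_integral_le {L M : Measure ℝ} [IsProbabilityMeasure L]
    [IsProbabilityMeasure M] {D : ℝ}
    (hD : ∀ u, |L.real (Ioi u) - M.real (Ioi u)| ≤ D) {f f' : ℝ → ℝ}
    (hf : ∀ x, HasDerivAt f (f' x) x) (hf' : Integrable f')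
    (hlim : Tendsto f atBot (𝓝 0)) :
    |∫ x, f x ∂L - ∫ x, f x ∂M| ≤ D * ∫ x, |f' x| := by
  have key : ∀ (P : Measure ℝ) [IsProbabilityMeasure P],
      ∫ x, f x ∂P = ∫ u, f' u * P.real (Ioi u) := by
    intro P _
    have h1 : ∀ x, f x = ∫ u, (Ioi u).indicator (fun _ => f' u) x := by
      intro x
      have := integral_Iic_of_hasDerivAt_of_tendsto' (a := x) (fun y _ => hf y)
        hf'.integrableOn hlim
      rw [sub_zero, integral_Iic_eq_integral_Iio, ← integral_indicator measurableSet_Iio] at this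
      rw [← this]
      congr 1
    have hint : Integrable (Function.uncurry fun (x : ℝ) (u : ℝ) =>
        (Ioi u).indicator (fun _ => f' u) x) (P.prod volume) := by
      have h2 : Integrable (fun z : ℝ × ℝ => f' z.2) (P.prod volume) := by
        simpa using (integrable_const (1 : ℝ) (μ := P)).mul_prod hf'
      have hm : MeasurableSet {z : ℝ × ℝ | z.2 < z.1} := measurableSet_lt measurable_snd measurable_fst
      refine (h2.indicator hm).congr (ae_of_all _ fun z => ?_)
      simp [indicator, Function.uncurry]
    calc ∫ x, f x ∂P = ∫ x, (∫ u, (Ioi u).indicator (fun _ => f' u) x) ∂P := by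
          congr 1; ext x; exact h1 x
      _ = ∫ u, (∫ x, (Ioi u).indicator (fun _ => f' u) x ∂P) := integral_integral_swap hint
      _ = _ := by
          congr 1; ext u
          rw [integral_indicator_const _ measurableSet_Ioi, smul_eq_mul, mul_comm]
  have hmeas : ∀ (P : Measure ℝ) [IsProbabilityMeasure P],
      Integrable fun u => f' u * P.real (Ioi u) := by
    intro P _
    have hanti : Antitone fun u => P.real (Ioi u) :=
      fun a b hab => measureReal_mono (Ioi_subset_Ioi hab)
    refine hf'.mul_bdd (c := 1) hanti.measurable.aestronglyMeasurable (ae_of_all _ fun u => ?_)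
    rw [Real.norm_of_nonneg measureReal_nonneg]
    exact measureReal_le_one
  rw [key L, key M, ← integral_sub (hmeas L) (hmeas M), ← integral_const_mul, ← Real.norm_eq_abs]
  refine norm_integral_le_of_norm_le (hf'.abs.const_mul D) (ae_of_all _ fun u => ?_)
  rw [← mul_sub, norm_mul, mul_comm]
  exact mul_le_mul_of_nonneg_right (hD u) (abs_nonneg _)

/-- Differentiation under the integral of a function smoothed by the law `L` at scale `a`. -/
lemma hasDerivAt_integral_comp_add_div (L : Measure ℝ) [IsProbabilityMeasure L] (a : ℝ)
    {f f' : ℝ → ℝ} (hf : ∀ x, HasDerivAt f (f' x) x) (hf'c : Continuous f')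
    {B B' : ℝ} (hB : ∀ x, |f x| ≤ B) (hB' : ∀ x, |f' x| ≤ B') (x : ℝ) :
    HasDerivAt (fun x => ∫ s, f ((x + s) / a) ∂L) (a⁻¹ * ∫ s, f' ((x + s) / a) ∂L) x := by
  have hfc : Continuous f := continuous_iff_continuousAt.2 fun x => (hf x).continuousAt
  have h := hasDerivAt_integral_of_dominated_loc_of_deriv_le (μ := L) (x₀ := x)
    (F := fun x s => f ((x + s) / a)) (F' := fun x s => f' ((x + s) / a) * a⁻¹) (s := univ)
    (bound := fun _ => B' * |a⁻¹|) univ_mem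
    (Eventually.of_forall fun y => by fun_prop) ?_ (by fun_prop) ?_
    (integrable_const _) ?_
  · rw [← integral_const_mul]
    refine h.2.congr_deriv ?_
    simp_rw [mul_comm]
  · exact Integrable.of_bound (by fun_prop) B (ae_of_all _ fun s => hB _)
  · refine ae_of_all _ fun s y _ => ?_
    rw [norm_mul]
    exact mul_le_mul_of_nonneg_right (hB' _) (norm_nonneg _)
  · refine ae_of_all _ fun s y _ => ?_
    have h1 : HasDerivAt (fun y : ℝ => (y + s) / a) a⁻¹ y := by
      simpa [div_eq_mul_inv] using ((hasDerivAt_id y).add_const s).mul_const a⁻¹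
    exact (hf _).comp y h1

/-- Second order Taylor expansion with a (non-sharp) cubic remainder. -/
lemma abs_taylor_two_sub_le {h0 h1 h2 h3 : ℝ → ℝ} (d0 : ∀ x, HasDerivAt h0 (h1 x) x)
    (d1 : ∀ x, HasDerivAt h1 (h2 x) x) (d2 : ∀ x, HasDerivAt h2 (h3 x) x) {B : ℝ}
    (hB : ∀ x, |h3 x| ≤ B) (x y : ℝ) :
    |h0 (x + y) - h0 x - h1 x * y - h2 x * (y ^ 2 / 2)| ≤ B * |y| ^ 3 := by
  have hBn : 0 ≤ B := (abs_nonneg _).trans (hB 0)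
  have hseg : ∀ z ∈ uIcc x (x + y), |z - x| ≤ |y| := by
    intro z hz
    have := abs_sub_left_of_mem_uIcc hz
    simpa using this
  have hconv : Convex ℝ (uIcc x (x + y)) := convex_uIcc x (x + y)
  have hx : x ∈ uIcc x (x + y) := left_mem_uIcc
  have e2 : ∀ z ∈ uIcc x (x + y), |h2 z - h2 x| ≤ B * |y| := by
    intro z hz
    refine (hconv.norm_image_sub_le_of_norm_hasDerivWithin_le (C := B)
      (fun w _ => (d2 w).hasDerivWithinAt) (fun w _ => hB w) hx hz).trans ?_
    exact mul_le_mul_of_nonneg_left (hseg z hz) hBn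
  have e1 : ∀ z ∈ uIcc x (x + y), |h1 z - h1 x - h2 x * (z - x)| ≤ B * |y| ^ 2 := by
    intro z hz
    have hd : ∀ w ∈ uIcc x (x + y), HasDerivWithinAt (fun w => h1 w - h1 x - h2 x * (w - x))
        (h2 w - h2 x) (uIcc x (x + y)) w := fun w _ => by
      have := ((d1 w).sub_const (h1 x)).sub (((hasDerivAt_id w).sub_const x).const_mul (h2 x))
      refine (this.congr_deriv ?_).hasDerivWithinAt
      simp
    have := hconv.norm_image_sub_le_of_norm_hasDerivWithin_le hd (fun w hw => e2 w hw) hx hz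
    simp only [sub_self, mul_zero, sub_zero, Real.norm_eq_abs] at this
    refine this.trans ?_
    rw [pow_two, ← mul_assoc]
    exact mul_le_mul_of_nonneg_left (hseg z hz) (by positivity)
  have hd : ∀ w ∈ uIcc x (x + y),
      HasDerivWithinAt (fun w => h0 w - h0 x - h1 x * (w - x) - h2 x * ((w - x) ^ 2 / 2))
        (h1 w - h1 x - h2 x * (w - x)) (uIcc x (x + y)) w := fun w _ => by
    have h3 := ((hasDerivAt_id w).sub_const x)
    have := (((d0 w).sub_const (h0 x)).sub (h3.const_mul (h1 x))).sub
      (((h3.pow 2).div_const 2).const_mul (h2 x))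
    refine (this.congr_deriv ?_).hasDerivWithinAt
    simp
  have := hconv.norm_image_sub_le_of_norm_hasDerivWithin_le hd (fun w hw => e1 w hw) hx
    (right_mem_uIcc)
  simp only [sub_self, mul_zero, Real.norm_eq_abs, add_sub_cancel_left] at this
  refine (le_of_eq ?_).trans (this.trans (le_of_eq ?_))
  · simp
  · ring

/-- One Lindeberg replacement: two laws with the same first two moments. -/
lemma abs_integral_sub_le_of_moments {ν ν' : Measure ℝ} [IsProbabilityMeasure ν]
    [IsProbabilityMeasure ν'] (i1 : Integrable (fun x : ℝ => |x| ^ 3) ν)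
    (i1' : Integrable (fun x : ℝ => |x| ^ 3) ν') (hm : ∫ x, x ∂ν = ∫ x, x ∂ν')
    (hv : ∫ x, x ^ 2 ∂ν = ∫ x, x ^ 2 ∂ν')
    {h0 h1 h2 h3 : ℝ → ℝ} (d0 : ∀ x, HasDerivAt h0 (h1 x) x)
    (d1 : ∀ x, HasDerivAt h1 (h2 x) x) (d2 : ∀ x, HasDerivAt h2 (h3 x) x) {B A : ℝ}
    (hA : ∀ x, |h0 x| ≤ A) (hB : ∀ x, |h3 x| ≤ B) (x : ℝ) :
    |∫ y, h0 (x + y) ∂ν - ∫ y, h0 (x + y) ∂ν'| ≤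
      B * (∫ y, |y| ^ 3 ∂ν + ∫ y, |y| ^ 3 ∂ν') := by
  have hc : Continuous h0 := continuous_iff_continuousAt.2 fun x => (d0 x).continuousAt
  have key : ∀ (P : Measure ℝ) [IsProbabilityMeasure P], Integrable (fun x : ℝ => |x| ^ 3) P →
      |∫ y, h0 (x + y) ∂P - (h0 x + h1 x * ∫ y, y ∂P + h2 x * ((∫ y, y ^ 2 ∂P) / 2))| ≤
        B * ∫ y, |y| ^ 3 ∂P := by
    intro P _ i3
    have j1 : Integrable (fun y : ℝ => y) P := by
      refine ((integrable_const (1 : ℝ)).add i3).mono' (by fun_prop) (ae_of_all _ fun y => ?_)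
      rw [Real.norm_eq_abs, Pi.add_apply]
      nlinarith [abs_nonneg y, sq_nonneg (|y| - 1), mul_nonneg (abs_nonneg y) (sq_nonneg (|y| - 1))]
    have j2 : Integrable (fun y : ℝ => y ^ 2) P := by
      refine ((integrable_const (1 : ℝ)).add i3).mono' (by fun_prop) (ae_of_all _ fun y => ?_)
      rw [Real.norm_eq_abs, Pi.add_apply, abs_of_nonneg (sq_nonneg y), ← sq_abs]
      nlinarith [abs_nonneg y, sq_nonneg (|y| - 1), mul_nonneg (abs_nonneg y) (sq_nonneg (|y| - 1))]
    have j0 : Integrable (fun y => h0 (x + y)) P :=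
      Integrable.of_bound (by fun_prop) A (ae_of_all _ fun s => hA _)
    have e : ∫ y, h0 (x + y) ∂P - (h0 x + h1 x * ∫ y, y ∂P + h2 x * ((∫ y, y ^ 2 ∂P) / 2)) =
        ∫ y, (h0 (x + y) - h0 x - h1 x * y - h2 x * (y ^ 2 / 2)) ∂P := by
      rw [integral_sub, integral_sub, integral_sub, integral_const, integral_const_mul,
        integral_const_mul, integral_div]
      · simp; ring
      · exact j0
      · exact integrable_const _
      · exact j0.sub (integrable_const _)
      · exact j1.const_mul _
      · exact (j0.sub (integrable_const _)).sub (j1.const_mul _)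
      · exact (j2.div_const 2).const_mul _
    rw [e, ← integral_const_mul, ← Real.norm_eq_abs]
    exact norm_integral_le_of_norm_le (i3.const_mul B)
      (ae_of_all _ fun y => abs_taylor_two_sub_le d0 d1 d2 hB x y)
  have k1 := key ν i1
  have k2 := key ν' i1'
  rw [hm, hv] at k1
  rw [mul_add]
  rw [abs_le] at *
  constructor <;> linarith [k1.1, k1.2, k2.1, k2.2]

/-! ### Sums of independent variables and Gaussian smoothing -/

/-- The law of the sum of `n` independent random variables of law `ν`. -/
noncomputable def sumLaw (ν : Measure ℝ) (n : ℕ) : Measure ℝ :=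
  (Measure.pi (fun _ : Fin n => ν)).map (fun x => ∑ i, x i)

instance (ν : Measure ℝ) [IsProbabilityMeasure ν] (n : ℕ) : IsProbabilityMeasure (sumLaw ν n) :=
  Measure.isProbabilityMeasure_map (by fun_prop)

lemma sumLaw_zero (ν : Measure ℝ) [IsProbabilityMeasure ν] : sumLaw ν 0 = Measure.dirac 0 := by
  simp [sumLaw, Measure.map_const]

lemma sumLaw_succ (ν : Measure ℝ) [IsProbabilityMeasure ν] (n : ℕ) :
    sumLaw ν (n + 1) = (sumLaw ν n).conv ν := by
  have h := (measurePreserving_piFinSuccAbove (fun _ : Fin (n + 1) => ν) (Fin.last n)).symm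
  rw [sumLaw, ← h.map_eq, Measure.map_map (by fun_prop) (MeasurableEquiv.measurable _), Measure.conv,
    sumLaw]
  have h2 := Measure.map_prod_map (Measure.pi (fun _ : Fin n => ν)) ν
    (f := fun x => ∑ i, x i) (g := id) (by fun_prop) measurable_id
  rw [Measure.map_id] at h2
  rw [h2, Measure.map_map (by fun_prop) (by fun_prop), ← Measure.prod_swap, 
    Measure.map_map (by fun_prop) (by fun_prop)]
  congr 1
  ext x
  simp [Fin.sum_univ_castSucc, MeasurableEquiv.piFinSuccAbove, Fin.insertNthEquiv]

lemma hasDerivAt_gaussianQ_neg (x : ℝ) :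
    HasDerivAt (fun x => gaussianQ (-x)) (gaussianPDFReal 0 1 x) x := by
  have h := (hasDerivAt_gaussianQ (-x)).comp x (hasDerivAt_neg x)
  refine h.congr_deriv ?_
  simp [gaussianPDFReal_zero_one]

lemma hasDerivAt_gaussianPDFReal_deriv (x : ℝ) :
    HasDerivAt (fun x => -x * gaussianPDFReal 0 1 x) ((x ^ 2 - 1) * gaussianPDFReal 0 1 x) x := by
  refine ((hasDerivAt_neg x).mul (hasDerivAt_gaussianPDFReal x)).congr_deriv ?_
  ring

lemma hasDerivAt_gaussianPDFReal_deriv_two (x : ℝ) :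
    HasDerivAt (fun x => (x ^ 2 - 1) * gaussianPDFReal 0 1 x)
      ((3 * x - x ^ 3) * gaussianPDFReal 0 1 x) x := by
  refine (((hasDerivAt_pow 2 x).sub_const 1).mul (hasDerivAt_gaussianPDFReal x)).congr_deriv ?_
  push_cast
  ring

lemma sq_mul_gaussianPDFReal_le (x : ℝ) : x ^ 2 * gaussianPDFReal 0 1 x ≤ 2 := by
  have h1 : (√(2 * Real.pi))⁻¹ ≤ 1 := by
    refine inv_le_one_of_one_le₀ ?_
    rw [Real.one_le_sqrt]; nlinarith [Real.pi_gt_three]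
  have h2 : x ^ 2 * Real.exp (-x ^ 2 / 2) ≤ 2 := by
    have := Real.add_one_le_exp (x ^ 2 / 2)
    rw [neg_div, Real.exp_neg, ← div_eq_mul_inv, div_le_iff₀ (Real.exp_pos _)]
    linarith
  rw [gaussianPDFReal_zero_one]
  calc x ^ 2 * ((√(2 * Real.pi))⁻¹ * Real.exp (-x ^ 2 / 2))
      = (√(2 * Real.pi))⁻¹ * (x ^ 2 * Real.exp (-x ^ 2 / 2)) := by ring
    _ ≤ 1 * 2 := mul_le_mul h1 h2 (by positivity) zero_le_one
    _ = 2 := by ring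

lemma abs_gaussianPDFReal_deriv_le (x : ℝ) : |-x * gaussianPDFReal 0 1 x| ≤ 3 := by
  have h0 := gaussianPDFReal_nonneg 0 1 x
  rw [abs_mul, abs_neg, abs_of_nonneg h0]
  have h1 : |x| ≤ 1 + x ^ 2 := by rw [← sq_abs]; nlinarith [sq_nonneg (|x| - 1), abs_nonneg x]
  nlinarith [sq_mul_gaussianPDFReal_le x, gaussianPDFReal_le_one x]

lemma abs_gaussianPDFReal_deriv_two_le (x : ℝ) : |(x ^ 2 - 1) * gaussianPDFReal 0 1 x| ≤ 3 := by
  have h0 := gaussianPDFReal_nonneg 0 1 x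
  rw [abs_le]
  constructor <;>
  nlinarith [sq_mul_gaussianPDFReal_le x, gaussianPDFReal_le_one x, mul_nonneg (sq_nonneg x) h0]

lemma abs_gaussianPDFReal_le_one (x : ℝ) : |gaussianPDFReal 0 1 x| ≤ 1 := by
  rw [abs_of_nonneg (gaussianPDFReal_nonneg 0 1 x)]; exact gaussianPDFReal_le_one x

lemma abs_gaussianQ_le_one (x : ℝ) : |gaussianQ x| ≤ 1 := by
  rw [abs_of_nonneg (gaussianQ_nonneg x), gaussianQ_eq_real]; exact measureReal_le_one

lemma integrable_pow_mul_gaussianPDFReal (k : ℕ) :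
    Integrable fun x : ℝ => x ^ k * gaussianPDFReal 0 1 x := by
  have h := (integrable_rpow_mul_exp_neg_mul_sq (b := 1 / 2) (by norm_num) (s := k)
    (by have : (0 : ℝ) ≤ k := k.cast_nonneg
        linarith)).const_mul (√(2 * Real.pi))⁻¹
  refine h.congr (ae_of_all _ fun x => ?_)
  simp only [gaussianPDFReal_zero_one, Real.rpow_natCast]
  rw [show -x ^ 2 / 2 = -(1 / 2) * x ^ 2 by ring]
  ring

lemma integrable_gaussianPDFReal_deriv_three :
    Integrable fun x : ℝ => (3 * x - x ^ 3) * gaussianPDFReal 0 1 x := by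
  have h := ((integrable_pow_mul_gaussianPDFReal 1).const_mul 3).sub
    (integrable_pow_mul_gaussianPDFReal 3)
  refine h.congr (ae_of_all _ fun x => ?_)
  simp only [Pi.sub_apply]
  ring

lemma tendsto_gaussianPDFReal_deriv_two_atBot :
    Tendsto (fun x : ℝ => (x ^ 2 - 1) * gaussianPDFReal 0 1 x) atBot (𝓝 0) := by
  refine tendsto_zero_of_hasDerivAt_of_integrableOn_Iic (a := 0)
    (fun x _ => hasDerivAt_gaussianPDFReal_deriv_two x)
    integrable_gaussianPDFReal_deriv_three.integrableOn ?_
  refine Integrable.integrableOn ?_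
  have h := (integrable_pow_mul_gaussianPDFReal 2).sub (integrable_pow_mul_gaussianPDFReal 0)
  refine h.congr (ae_of_all _ fun x => ?_)
  simp only [Pi.sub_apply]
  ring

/-- Total variation of the second derivative of the standard Gaussian density. -/
noncomputable def gaussianDerivVariation : ℝ :=
  ∫ x : ℝ, |(3 * x - x ^ 3) * gaussianPDFReal 0 1 x|

lemma gaussianDerivVariation_nonneg : 0 ≤ gaussianDerivVariation :=
  integral_nonneg fun _ => abs_nonneg _

/-- Smoothing `L` by an independent centred Gaussian of standard deviation `a`. -/
lemma integral_gaussianQ_neg_div (L : Measure ℝ) [IsProbabilityMeasure L] {a : ℝ} (ha : 0 < a)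
    (x : ℝ) : ∫ s, gaussianQ (-((x + s) / a)) ∂L =
      (L.conv (gaussianReal 0 (Real.toNNReal (a ^ 2)))).real (Ioi (-x)) := by
  have hv : Real.toNNReal (a ^ 2) ≠ 0 := by
    rw [Ne, Real.toNNReal_eq_zero, not_le]; positivity
  rw [conv_real_Ioi]
  congr 1
  ext s
  rw [gaussianReal_real_Ioi hv, Real.coe_toNNReal _ (sq_nonneg a), Real.sqrt_sq ha.le]
  congr 1
  ring

lemma integral_gaussianQ_gaussianReal (m : ℝ≥0) {a : ℝ} (ha : 0 < a) (x : ℝ) :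
    ∫ s, gaussianQ (-((x + s) / a)) ∂(gaussianReal 0 m) = gaussianQ (-(x / √(a ^ 2 + m))) := by
  rw [integral_gaussianQ_neg_div _ ha, gaussianReal_conv_gaussianReal, add_zero,
    gaussianReal_real_Ioi]
  · rw [NNReal.coe_add, Real.coe_toNNReal _ (sq_nonneg a), add_comm (m : ℝ), neg_div]
  · have : 0 < Real.toNNReal (a ^ 2) := Real.toNNReal_pos.2 (by positivity)
    positivity

section Smoothing

variable (L : Measure ℝ) [IsProbabilityMeasure L] (a : ℝ)

lemma hasDerivAt_smooth_zero (x : ℝ) :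
    HasDerivAt (fun x => ∫ s, gaussianQ (-((x + s) / a)) ∂L)
      (a⁻¹ * ∫ s, gaussianPDFReal 0 1 ((x + s) / a) ∂L) x :=
  hasDerivAt_integral_comp_add_div L a (f := fun x => gaussianQ (-x)) hasDerivAt_gaussianQ_neg
    continuous_gaussianPDFReal_zero_one (fun _ => abs_gaussianQ_le_one _)
    abs_gaussianPDFReal_le_one x

lemma hasDerivAt_smooth_one (x : ℝ) :
    HasDerivAt (fun x => a⁻¹ * ∫ s, gaussianPDFReal 0 1 ((x + s) / a) ∂L)
      (a⁻¹ ^ 2 * ∫ s, (fun y => -y * gaussianPDFReal 0 1 y) ((x + s) / a) ∂L) x := by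
  refine ((hasDerivAt_integral_comp_add_div L a hasDerivAt_gaussianPDFReal
    (continuous_neg.mul continuous_gaussianPDFReal_zero_one)
    abs_gaussianPDFReal_le_one abs_gaussianPDFReal_deriv_le x).const_mul a⁻¹).congr_deriv ?_
  ring

lemma hasDerivAt_smooth_two (x : ℝ) :
    HasDerivAt (fun x => a⁻¹ ^ 2 * ∫ s, (fun y => -y * gaussianPDFReal 0 1 y) ((x + s) / a) ∂L)
      (a⁻¹ ^ 3 * ∫ s, (fun y => (y ^ 2 - 1) * gaussianPDFReal 0 1 y) ((x + s) / a) ∂L) x := by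
  refine ((hasDerivAt_integral_comp_add_div L a hasDerivAt_gaussianPDFReal_deriv
    (((continuous_pow 2).sub continuous_const).mul continuous_gaussianPDFReal_zero_one)
    abs_gaussianPDFReal_deriv_le abs_gaussianPDFReal_deriv_two_le x).const_mul
      (a⁻¹ ^ 2)).congr_deriv ?_
  ring

end Smoothing

/-- For a Gaussian law the third derivative of the smoothed tail is again explicit. -/
lemma abs_smooth_three_gaussianReal_le (m : ℝ≥0) {a : ℝ} (ha : 0 < a) (x : ℝ) :
    |a⁻¹ ^ 3 * ∫ s, (fun y => (y ^ 2 - 1) * gaussianPDFReal 0 1 y) ((x + s) / a)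
      ∂(gaussianReal 0 m)| ≤ 3 * (√(a ^ 2 + m))⁻¹ ^ 3 := by
  set b := √(a ^ 2 + m) with hb
  have hb0 : 0 < b := Real.sqrt_pos.2 (by positivity)
  set L := gaussianReal 0 m
  have e0 : (fun x => ∫ s, gaussianQ (-((x + s) / a)) ∂L) =
      fun x => ∫ s, gaussianQ (-((x + s) / b)) ∂(Measure.dirac 0) := by
    ext x
    rw [integral_gaussianQ_gaussianReal m ha, integral_dirac, add_zero]
  have e1 : (fun x => a⁻¹ * ∫ s, gaussianPDFReal 0 1 ((x + s) / a) ∂L) = fun x =>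
      b⁻¹ * ∫ s, gaussianPDFReal 0 1 ((x + s) / b) ∂(Measure.dirac 0) := by
    ext x
    refine (hasDerivAt_smooth_zero L a x).unique ?_
    rw [e0]
    exact hasDerivAt_smooth_zero _ b x
  have e2 : (fun x => a⁻¹ ^ 2 * ∫ s, (fun y => -y * gaussianPDFReal 0 1 y) ((x + s) / a) ∂L) =
      fun x => b⁻¹ ^ 2 * ∫ s, (fun y => -y * gaussianPDFReal 0 1 y) ((x + s) / b)
        ∂(Measure.dirac 0) := by
    ext x
    refine (hasDerivAt_smooth_one L a x).unique ?_
    rw [e1]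
    exact hasDerivAt_smooth_one _ b x
  have e3 := hasDerivAt_smooth_two L a x
  rw [e2] at e3
  rw [e3.unique (hasDerivAt_smooth_two _ b x), integral_dirac, abs_mul,
    abs_of_nonneg (by positivity : 0 ≤ b⁻¹ ^ 3), mul_comm]
  exact mul_le_mul_of_nonneg_right (abs_gaussianPDFReal_deriv_two_le _) (by positivity)

lemma abs_smooth_three_le {L : Measure ℝ} [IsProbabilityMeasure L] {m : ℝ≥0} {D : ℝ}
    (hD : ∀ u, |L.real (Ioi u) - (gaussianReal 0 m).real (Ioi u)| ≤ D) {a : ℝ} (ha : 0 < a)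
    (x : ℝ) :
    |a⁻¹ ^ 3 * ∫ s, (fun y => (y ^ 2 - 1) * gaussianPDFReal 0 1 y) ((x + s) / a) ∂L| ≤
      3 * (√(a ^ 2 + m))⁻¹ ^ 3 + a⁻¹ ^ 3 * (D * gaussianDerivVariation) := by
  set g : ℝ → ℝ := fun y => (y ^ 2 - 1) * gaussianPDFReal 0 1 y
  set g' : ℝ → ℝ := fun y => (3 * y - y ^ 3) * gaussianPDFReal 0 1 y with hg'
  have hint : Integrable fun s => a⁻¹ * g' ((x + s) / a) := by
    have := ((integrable_gaussianPDFReal_deriv_three.comp_div ha.ne').comp_add_left x).const_mul a⁻¹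
    exact this
  have h := abs_integral_sub_integral_le hD (f := fun s => g ((x + s) / a))
    (f' := fun s => a⁻¹ * g' ((x + s) / a)) (fun s => ?_) hint ?_
  · have hv : ∫ s, |a⁻¹ * g' ((x + s) / a)| = gaussianDerivVariation := by
      simp_rw [abs_mul, abs_of_pos (inv_pos.2 ha)]
      rw [integral_const_mul, integral_add_left_eq_self (fun s => |g' (s / a)|) x,
        Measure.integral_comp_div (fun s => |g' s|) a, abs_of_pos ha, smul_eq_mul, ← mul_assoc,
        inv_mul_cancel₀ ha.ne', one_mul, gaussianDerivVariation]
    rw [hv] at h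
    have h2 := abs_smooth_three_gaussianReal_le m ha x
    have ha3 : 0 < a⁻¹ ^ 3 := by positivity
    set I := ∫ s, g ((x + s) / a) ∂L
    set J := ∫ s, g ((x + s) / a) ∂(gaussianReal 0 m)
    calc |a⁻¹ ^ 3 * I| = |a⁻¹ ^ 3 * J + a⁻¹ ^ 3 * (I - J)| := by congr 1; ring
      _ ≤ |a⁻¹ ^ 3 * J| + |a⁻¹ ^ 3 * (I - J)| := abs_add_le _ _
      _ ≤ _ := by
        refine add_le_add h2 ?_
        rw [abs_mul, abs_of_pos ha3]
        exact mul_le_mul_of_nonneg_left h ha3.le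
  · have h1 : HasDerivAt (fun y : ℝ => (x + y) / a) a⁻¹ s := by
      simpa [div_eq_mul_inv] using ((hasDerivAt_id s).const_add x).mul_const a⁻¹
    refine ((hasDerivAt_gaussianPDFReal_deriv_two _).comp s h1).congr_deriv ?_
    rw [mul_comm]
  · refine tendsto_gaussianPDFReal_deriv_two_atBot.comp ?_
    exact (tendsto_atBot_add_const_left _ x tendsto_id).atBot_div_const ha

/-! ### The swapping argument and the removal of the smoothing -/

/-- The summand `j^{-1/2} (N - j)^{-3/2}` is dominated by a telescoping difference. -/
lemma inv_sqrt_mul_le_telescope {p q N : ℝ} (hq : 0 ≤ q) (hp : p = q + 1) (hN : 1 ≤ N - p) :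
    (√(N - p))⁻¹ ^ 3 * (√p)⁻¹ ≤ 4 / N * (√p / √(N - p) - √q / √(N - q)) := by
  have hp0 : 0 < p := by linarith
  have hN0 : 0 < N := by linarith
  have e1 : √p ^ 2 = p := Real.sq_sqrt hp0.le
  have e2 : √q ^ 2 = q := Real.sq_sqrt hq
  have e3 : √(N - p) ^ 2 = N - p := Real.sq_sqrt (by linarith)
  have e4 : √(N - q) ^ 2 = N - q := Real.sq_sqrt (by linarith)
  have hP : 0 < √p := Real.sqrt_pos.2 hp0
  have hQ : 0 ≤ √q := Real.sqrt_nonneg q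
  have hR : 1 ≤ √(N - p) := by rwa [Real.one_le_sqrt]
  have hS : 0 < √(N - q) := Real.sqrt_pos.2 (by linarith)
  have hQP : √q ≤ √p := Real.sqrt_le_sqrt (by linarith)
  set P := √p
  set Q := √q
  set R := √(N - p)
  set S := √(N - q)
  have hR0 : 0 < R := by linarith
  have hNe : N = P ^ 2 + R ^ 2 := by rw [e1, e3]; ring
  have hSR : S ^ 2 = R ^ 2 + 1 := by rw [e3, e4]; linarith
  have hPQ : P ^ 2 = Q ^ 2 + 1 := by rw [e1, e2]; linarith
  have hkey : (P * S - Q * R) * (P * S + Q * R) = N := by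
    have : (P * S - Q * R) * (P * S + Q * R) = P ^ 2 * S ^ 2 - Q ^ 2 * R ^ 2 := by ring
    rw [this, hSR, hNe]
    have : Q ^ 2 = P ^ 2 - 1 := by linarith
    rw [this]; ring
  have hpos : 0 < P * S + Q * R := by positivity
  have hdiff : P / R - Q / S = N / (R * S * (P * S + Q * R)) := by
    rw [← hkey]; field_simp
  have hbound : S * (P * S + Q * R) ≤ 4 * P * R ^ 2 := by
    have h1 : S * R ≤ 2 * R ^ 2 := by nlinarith [sq_nonneg (S - R)]
    have h2 : Q * (S * R) ≤ P * (2 * R ^ 2) := mul_le_mul hQP h1 (by positivity) hP.le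
    have h3 : P * S ^ 2 ≤ P * (2 * R ^ 2) := by
      refine mul_le_mul_of_nonneg_left ?_ hP.le
      nlinarith
    nlinarith
  have hN' : N ≠ 0 := hN0.ne'
  rw [hdiff, show 4 / N * (N / (R * S * (P * S + Q * R))) = 4 / (R * S * (P * S + Q * R)) by
    field_simp]
  rw [inv_pow, ← mul_inv, inv_eq_one_div, div_le_div_iff₀ (by positivity) (by positivity)]
  calc 1 * (R * S * (P * S + Q * R)) = R * (S * (P * S + Q * R)) := by ring
    _ ≤ R * (4 * P * R ^ 2) := mul_le_mul_of_nonneg_left hbound hR0.le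
    _ = 4 * (R ^ 3 * P) := by ring

lemma integrable_abs_pow_gaussianReal :
    Integrable (fun x : ℝ => |x| ^ 3) (gaussianReal 0 1) := by
  have h := (memLp_id_gaussianReal (μ := 0) (v := 1) 3).integrable_norm_pow (by norm_num)
  simpa using h

lemma integral_sq_gaussianReal : ∫ x : ℝ, x ^ 2 ∂(gaussianReal 0 1) = 1 := by
  have h := variance_id_gaussianReal (μ := 0) (v := 1)
  rw [variance_of_integral_eq_zero (by fun_prop) (by simp)] at h
  simpa using h

/-- The Lindeberg swapping argument: comparison of the smoothed tails of a normalized sum and of a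
Gaussian, given a priori bounds for all shorter sums. -/
lemma abs_smooth_sumLaw_sub_le {ν : Measure ℝ} [IsProbabilityMeasure ν]
    (i3 : Integrable (fun x : ℝ => |x| ^ 3) ν) (hm : ∫ x, x ∂ν = 0) (hv : ∫ x, x ^ 2 ∂ν = 1)
    {n : ℕ} (hn : 0 < n) {κ : ℝ}
    (hD : ∀ k < n, ∀ u, |(sumLaw ν k).real (Ioi u) - (gaussianReal 0 k).real (Ioi u)| ≤
      κ * (√(k + 1 : ℝ))⁻¹) {a : ℝ} (ha : 1 ≤ a) (x : ℝ) :
    |∫ s, gaussianQ (-((x + s) / a)) ∂(sumLaw ν n) - gaussianQ (-(x / √(a ^ 2 + n)))| ≤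
      (∫ y, |y| ^ 3 ∂ν + ∫ y, |y| ^ 3 ∂(gaussianReal 0 1)) *
        (3 + 4 * gaussianDerivVariation * κ / a) / √n := by
  set N : ℝ := a ^ 2 + n with hN
  set Γ := ∫ y, |y| ^ 3 ∂ν + ∫ y, |y| ^ 3 ∂(gaussianReal 0 1) with hΓ
  have hΓ0 : 0 ≤ Γ := add_nonneg (integral_nonneg fun _ => by positivity)
    (integral_nonneg fun _ => by positivity)
  have ha0 : 0 < a := by linarith
  have hn0 : (0 : ℝ) < n := by exact_mod_cast hn
  set V := gaussianDerivVariation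
  have hV : 0 ≤ V := gaussianDerivVariation_nonneg
  have hκ : 0 ≤ κ := by
    have := (abs_nonneg _).trans (hD 0 hn 0)
    simpa using this
  set T : ℕ → ℝ := fun k => ∫ s, gaussianQ (-((x + s) / √(N - k))) ∂(sumLaw ν k) with hT
  have hT0 : T 0 = gaussianQ (-(x / √N)) := by simp [hT, sumLaw_zero]
  have hTn : T n = ∫ s, gaussianQ (-((x + s) / a)) ∂(sumLaw ν n) := by
    simp only [hT, hN, add_sub_cancel_right, Real.sqrt_sq ha0.le]
  set f : ℕ → ℝ := fun k => √(k : ℝ) / √(N - k) with hf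
  have hstep : ∀ k ∈ Finset.range n, |T (k + 1) - T k| ≤
      Γ * (3 * (√(n : ℝ))⁻¹ ^ 3 + V * κ * (4 / N) * (f (k + 1) - f k)) := by
    intro k hk
    have hkn : k + 1 ≤ n := Finset.mem_range.1 hk
    have hkn' : (k : ℝ) + 1 ≤ n := by exact_mod_cast hkn
    set b := √(N - (k + 1 : ℕ)) with hb
    have hNk : 1 ≤ N - (k + 1 : ℕ) := by
      push_cast; nlinarith
    have hb0 : 0 < b := Real.sqrt_pos.2 (by linarith)
    have hb2 : b ^ 2 = N - (k + 1 : ℕ) := Real.sq_sqrt (by linarith)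
    set L := sumLaw ν k with hL
    have hA : ∀ z, |∫ s, gaussianQ (-((z + s) / b)) ∂L| ≤ 1 := by
      intro z
      rw [integral_gaussianQ_neg_div L hb0, abs_of_nonneg measureReal_nonneg]
      exact measureReal_le_one
    have hmain := abs_integral_sub_le_of_moments i3 integrable_abs_pow_gaussianReal
      (by rw [hm]; simp) (by rw [hv, integral_sq_gaussianReal])
      (hasDerivAt_smooth_zero L b) (hasDerivAt_smooth_one L b) (hasDerivAt_smooth_two L b)
      hA (abs_smooth_three_le (hD k (by omega)) hb0) x
    have hmeas : Continuous fun z : ℝ × ℝ => gaussianQ (-((x + z.1 + z.2) / b)) :=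
      continuous_gaussianQ.comp (by fun_prop)
    have hq : ∀ (P : Measure ℝ) [IsProbabilityMeasure P],
        ∫ y, (∫ s, gaussianQ (-((x + y + s) / b)) ∂L) ∂P =
          ∫ s, (∫ y, gaussianQ (-((x + (s + y)) / b)) ∂P) ∂L := by
      intro P _
      rw [integral_integral_swap]
      · congr 1; ext s; congr 1; ext y
        rw [add_assoc, add_comm y s]
      · exact Integrable.of_bound (C := 1) hmeas.aestronglyMeasurable
          (ae_of_all _ fun z => abs_gaussianQ_le_one _)
    have h1 : ∫ y, (∫ s, gaussianQ (-((x + y + s) / b)) ∂L) ∂ν = T (k + 1) := by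
      rw [hq ν, hT]
      simp only
      rw [sumLaw_succ, integral_conv]
      exact Integrable.of_bound (C := 1) (continuous_gaussianQ.comp
        (by fun_prop)).aestronglyMeasurable (ae_of_all _ fun z => abs_gaussianQ_le_one _)
    have h2 : ∫ y, (∫ s, gaussianQ (-((x + y + s) / b)) ∂L) ∂(gaussianReal 0 1) = T k := by
      rw [hq _, hT]
      simp only
      congr 1
      ext s
      simp_rw [← add_assoc]
      rw [integral_gaussianQ_gaussianReal 1 hb0, hb2]
      congr 4
      push_cast; ring
    rw [h1, h2] at hmain
    refine hmain.trans ?_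
    rw [mul_comm Γ]
    refine mul_le_mul_of_nonneg_right (add_le_add ?_ ?_) hΓ0
    · refine mul_le_mul_of_nonneg_left (pow_le_pow_left₀ (by positivity) ?_ 3) (by norm_num)
      refine inv_anti₀ (Real.sqrt_pos.2 hn0) (Real.sqrt_le_sqrt ?_)
      rw [hb2]
      push_cast
      nlinarith
    · have := inv_sqrt_mul_le_telescope (p := (k + 1 : ℕ)) (q := k) (N := N) k.cast_nonneg
        (by push_cast; ring) hNk
      calc b⁻¹ ^ 3 * (κ * (√(k + 1 : ℝ))⁻¹ * V)
          = V * κ * (b⁻¹ ^ 3 * (√((k + 1 : ℕ) : ℝ))⁻¹) := by push_cast; ring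
        _ ≤ V * κ * (4 / N * (f (k + 1) - f k)) :=
            mul_le_mul_of_nonneg_left this (by positivity)
        _ = _ := by ring
  have hsum : |T n - T 0| ≤ ∑ k ∈ Finset.range n,
      Γ * (3 * (√(n : ℝ))⁻¹ ^ 3 + V * κ * (4 / N) * (f (k + 1) - f k)) := by
    rw [← Finset.sum_range_sub]
    exact (Finset.abs_sum_le_sum_abs _ _).trans (Finset.sum_le_sum hstep)
  rw [hT0, hTn] at hsum
  refine hsum.trans ?_
  rw [← Finset.mul_sum, Finset.sum_add_distrib, ← Finset.mul_sum, ← Finset.mul_sum,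
    Finset.sum_range_sub, Finset.sum_const, Finset.card_range, nsmul_eq_mul, mul_div_assoc]
  refine mul_le_mul_of_nonneg_left ?_ hΓ0
  have hf0 : f 0 = 0 := by simp [hf]
  have hfn : f n = √n / a := by simp only [hf, hN, add_sub_cancel_right, Real.sqrt_sq ha0.le]
  have hs : 0 < √(n : ℝ) := Real.sqrt_pos.2 hn0
  have hs2 : √(n : ℝ) ^ 2 = n := Real.sq_sqrt hn0.le
  have e1 : 3 * (n * (√(n : ℝ))⁻¹ ^ 3) = 3 / √n := by
    nth_rewrite 1 [← hs2]
    field_simp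
  have e2 : 4 / N * (√n / a) ≤ 4 / (√n * a) := by
    rw [div_mul_div_comm, div_le_div_iff₀ (by positivity) (by positivity)]
    have : √(n : ℝ) * √n ≤ N := by rw [← pow_two, hs2, hN]; nlinarith
    nlinarith [mul_le_mul_of_nonneg_right this ha0.le]
  rw [hf0, sub_zero, hfn, e1]
  calc 3 / √n + V * κ * (4 / N) * (√n / a) = 3 / √n + V * κ * (4 / N * (√n / a)) := by ring
    _ ≤ 3 / √n + V * κ * (4 / (√n * a)) := by gcongr
    _ = _ := by field_simp

/-- Removing the smoothing: tails that agree up to `E` after adding Gaussian noise of standard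
deviation `a` agree up to `D / 3 + 4 E / 3 + 4 a ℓ` when one of them is `ℓ`-Lipschitz and `D` is an
a priori bound. -/
lemma abs_sub_le_of_smooth {F G : ℝ → ℝ} (hF : Antitone F) (hG : Antitone G) {D E ℓ a : ℝ}
    (ha : 0 < a) (hℓ : ∀ u v, u ≤ v → G u - G v ≤ ℓ * (v - u))
    (hD : ∀ u, |F u - G u| ≤ D)
    (hE : ∀ u, |∫ z, (F (u - z) - G (u - z)) ∂(gaussianReal 0 (Real.toNNReal (a ^ 2)))| ≤ E)
    (u : ℝ) : |F u - G u| ≤ D / 3 + 4 / 3 * E + 4 * a * ℓ := by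
  set P := gaussianReal 0 (Real.toNNReal (a ^ 2)) with hP
  have hD0 : 0 ≤ D := (abs_nonneg _).trans (hD 0)
  have hE0 : 0 ≤ E := (abs_nonneg _).trans (hE 0)
  have hℓ0 : 0 ≤ ℓ := by
    have h1 := hG (zero_le_one' ℝ)
    have h2 := hℓ 0 1 zero_le_one
    linarith
  -- By Chebyshev's inequality the noise stays within `2 a` with probability at least `3 / 4`. There
  -- the difference at the point shifted by `2 a` keeps its sign and size up to `4 a ℓ`.
  set A : Set ℝ := {z | 2 * a ≤ |z|} with hA
  have hAm : MeasurableSet A := measurableSet_le measurable_const measurable_id.abs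
  have hPA : P.real A ≤ 1 / 4 := by
    have h := meas_ge_le_variance_div_sq (μ := P) (X := id) (memLp_id_gaussianReal 2)
      (c := 2 * a) (by positivity)
    rw [hP, variance_id_gaussianReal, ← hP, Real.coe_toNNReal _ (sq_nonneg a)] at h
    simp only [id, hP, integral_id_gaussianReal, sub_zero] at h
    rw [← hP] at h
    have h2 := ENNReal.toReal_mono ENNReal.ofReal_ne_top h
    rw [ENNReal.toReal_ofReal (by positivity)] at h2
    refine h2.trans (le_of_eq ?_)
    field_simp
    norm_num
  have hPA0 : 0 ≤ P.real A := measureReal_nonneg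
  have hi : ∀ u, Integrable (fun z => F (u - z) - G (u - z)) P := by
    intro u
    refine Integrable.of_bound (C := D) ?_ (ae_of_all _ fun z => hD _)
    exact ((hF.measurable.comp (by fun_prop)).sub
      (hG.measurable.comp (by fun_prop))).aestronglyMeasurable
  have key : ∀ (d : ℝ) (g : ℝ → ℝ), Integrable g P → |∫ z, g z ∂P| ≤ E → (∀ z, -D ≤ g z) →
      (∀ z, |z| < 2 * a → d ≤ g z) → d ≤ D / 3 + 4 / 3 * E := by
    intro d g hg hgE hgD hgd
    rcases le_total d 0 with hd | hd
    · exact hd.trans (by positivity)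
    have h1 : ∫ z, (d - A.indicator (fun _ => D + d) z) ∂P ≤ ∫ z, g z ∂P := by
      refine integral_mono ((integrable_const _).sub ((integrable_const _).indicator hAm)) hg
        fun z => ?_
      by_cases hz : z ∈ A
      · simp only [indicator_of_mem hz]
        linarith [hgD z]
      · simp only [indicator_of_notMem hz]
        rw [sub_zero]
        exact hgd z (not_le.1 hz)
    rw [integral_sub (integrable_const _) ((integrable_const _).indicator hAm), integral_const,
      integral_indicator_const _ hAm, probReal_univ, one_smul, smul_eq_mul] at h1
    have h2 := (le_abs_self _).trans hgE
    nlinarith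
  rw [abs_le]
  constructor
  · have := key (G u - F u - 4 * a * ℓ) (fun z => -(F (u + 2 * a - z) - G (u + 2 * a - z)))
      (hi _).neg (by rw [integral_neg, abs_neg]; exact hE _)
      (fun z => neg_le_neg ((le_abs_self _).trans (hD _))) (fun z hz => ?_)
    · linarith
    · have hz' := abs_lt.1 hz
      have h1 := hF (show u ≤ u + 2 * a - z by linarith)
      have h2 := hℓ u (u + 2 * a - z) (by linarith)
      have h3 : ℓ * (u + 2 * a - z - u) ≤ ℓ * (4 * a) :=
        mul_le_mul_of_nonneg_left (by linarith) hℓ0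
      linarith
  · have := key (F u - G u - 4 * a * ℓ) (fun z => F (u - 2 * a - z) - G (u - 2 * a - z))
      (hi _) (hE _) (fun z => (abs_le.1 (hD _)).1) (fun z hz => ?_)
    · linarith
    · have hz' := abs_lt.1 hz
      have h1 := hF (show u - 2 * a - z ≤ u by linarith)
      have h2 := hℓ (u - 2 * a - z) u (by linarith)
      have h3 : ℓ * (u - (u - 2 * a - z)) ≤ ℓ * (4 * a) :=
        mul_le_mul_of_nonneg_left (by linarith) hℓ0
      linarith

/-! ### The Berry-Esseen theorem -/

lemma one_le_integral_abs_pow {ν : Measure ℝ} [IsProbabilityMeasure ν]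
    (i3 : Integrable (fun x : ℝ => |x| ^ 3) ν) (hv : ∫ x, x ^ 2 ∂ν = 1) :
    1 ≤ ∫ x, |x| ^ 3 ∂ν := by
  have i2 : Integrable (fun y : ℝ => y ^ 2) ν := by
    by_contra h
    rw [integral_undef h] at hv
    exact zero_ne_one hv
  have h : ∫ x, x ^ 2 ∂ν ≤ ∫ x, (2 * |x| ^ 3 + 1) / 3 ∂ν := by
    refine integral_mono i2 (((i3.const_mul 2).add (integrable_const 1)).div_const 3) fun x => ?_
    simp only
    rw [← sq_abs]
    nlinarith [abs_nonneg x, mul_nonneg (abs_nonneg x) (sq_nonneg (|x| - 1)), sq_nonneg (|x| - 1)]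
  rw [hv, integral_div, integral_add (i3.const_mul 2) (integrable_const 1), integral_const_mul,
    integral_const, probReal_univ, one_smul] at h
  linarith

/-- The Berry-Esseen theorem for standardized summands. -/
lemma exists_abs_sumLaw_sub_le : ∃ K : ℝ, 0 ≤ K ∧ ∀ ν : Measure ℝ, IsProbabilityMeasure ν →
    Integrable (fun x : ℝ => |x| ^ 3) ν → ∫ x, x ∂ν = 0 → ∫ x, x ^ 2 ∂ν = 1 → ∀ (n : ℕ) (u : ℝ),
      |(sumLaw ν n).real (Ioi u) - (gaussianReal 0 n).real (Ioi u)| ≤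
        K * (∫ x, |x| ^ 3 ∂ν) * (√(n + 1 : ℝ))⁻¹ := by
  set V := gaussianDerivVariation
  have hV : 0 ≤ V := gaussianDerivVariation_nonneg
  set γ₀ := ∫ x, |x| ^ 3 ∂(gaussianReal 0 1) with hγ₀
  have hγ₀0 : 0 ≤ γ₀ := integral_nonneg fun _ => by positivity
  set c := 1 + γ₀ with hc
  have hc0 : 0 < c := by positivity
  -- `A ≥ 32 c V` makes the inductive term of the smoothed bound at most `K γ / (8 √n)`; after the
  -- smoothing is removed and `√n` replaced by `√(n + 1)` half of `K` remains, and the other half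
  -- absorbs the terms that do not involve `K`.
  set A := 1 + 32 * c * V with hA
  have hA1 : 1 ≤ A := by rw [hA]; nlinarith [mul_nonneg hc0.le hV]
  set K := 24 * (c + A) with hK
  have hK0 : 0 ≤ K := by positivity
  refine ⟨K, hK0, fun ν _ i3 hm hv n => ?_⟩
  set γ := ∫ x, |x| ^ 3 ∂ν
  have hγ : 1 ≤ γ := one_le_integral_abs_pow i3 hv
  induction n using Nat.strong_induction_on with
  | _ n ih =>
  rcases Nat.eq_zero_or_pos n with rfl | hn
  · intro u
    rw [sumLaw_zero]
    simp only [Nat.cast_zero, gaussianReal_zero_var, sub_self, abs_zero]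
    positivity
  have hn0 : (0 : ℝ) < n := by exact_mod_cast hn
  have hs : 0 < √(n : ℝ) := Real.sqrt_pos.2 hn0
  have hnn : (n : ℝ≥0) ≠ 0 := by exact_mod_cast hn.ne'
  set a := A * γ with ha
  have ha1 : 1 ≤ a := one_le_mul_of_one_le_of_one_le hA1 hγ
  have ha0 : 0 < a := by linarith
  set F : ℝ → ℝ := fun u => (sumLaw ν n).real (Ioi u) with hF
  set G : ℝ → ℝ := fun u => (gaussianReal 0 n).real (Ioi u) with hG
  set E := (γ + γ₀) * (3 + 4 * V * (K * γ) / a) / √n with hE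
  have hbdd : ∀ u, |F u - G u| ≤ 1 := fun u => by
    have h1 : F u ≤ 1 := measureReal_le_one
    have h2 : G u ≤ 1 := measureReal_le_one
    have h3 : 0 ≤ F u := measureReal_nonneg
    have h4 : 0 ≤ G u := measureReal_nonneg
    rw [abs_le]; constructor <;> linarith
  have hba : BddAbove (range fun u => |F u - G u|) := ⟨1, by rintro _ ⟨u, rfl⟩; exact hbdd u⟩
  set D := ⨆ u, |F u - G u|
  have hD : ∀ u, |F u - G u| ≤ D := fun u => le_ciSup hba u
  have hsmooth : ∀ u, |∫ z, (F (u - z) - G (u - z))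
      ∂(gaussianReal 0 (Real.toNNReal (a ^ 2)))| ≤ E := by
    intro u
    have h := abs_smooth_sumLaw_sub_le i3 hm hv hn (κ := K * γ) ih ha1 (-u)
    have e : ∀ (P : Measure ℝ) [IsProbabilityMeasure P],
        Integrable (fun z => P.real (Ioi (u - z))) (gaussianReal 0 (Real.toNNReal (a ^ 2))) := by
      intro P _
      refine Integrable.of_bound (C := 1) ?_ (ae_of_all _ fun z => ?_)
      · have hmono : Monotone fun z => P.real (Ioi (u - z)) := fun x y hxy =>
          measureReal_mono (Ioi_subset_Ioi (by linarith))
        exact hmono.measurable.aestronglyMeasurable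
      · rw [Real.norm_of_nonneg measureReal_nonneg]
        exact measureReal_le_one
    simp only [hF, hG]
    rw [integral_sub (e _) (e _), ← conv_real_Ioi, ← conv_real_Ioi, Measure.conv_comm,
      Measure.conv_comm (μ := gaussianReal 0 (Real.toNNReal (a ^ 2)))]
    have e1 := integral_gaussianQ_neg_div (sumLaw ν n) ha0 (-u)
    have e2 := integral_gaussianQ_neg_div (gaussianReal 0 n) ha0 (-u)
    rw [integral_gaussianQ_gaussianReal _ ha0] at e2
    rw [neg_neg] at e1 e2
    rw [← e1, ← e2]
    exact h
  have hLip : ∀ u v, u ≤ v → G u - G v ≤ (√(n : ℝ))⁻¹ * (v - u) := by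
    intro u v huv
    simp only [hG, gaussianReal_real_Ioi hnn]
    refine (le_abs_self _).trans ((abs_gaussianQ_sub_le _ _).trans (le_of_eq ?_))
    rw [← sub_div, abs_div, abs_sub_comm, abs_of_nonneg (by linarith), abs_of_nonneg (by positivity)]
    simp [div_eq_inv_mul]
  have hanti : ∀ (P : Measure ℝ) [IsProbabilityMeasure P], Antitone fun u => P.real (Ioi u) :=
    fun P _ x y hxy => measureReal_mono (Ioi_subset_Ioi hxy)
  have hDle : D ≤ D / 3 + 4 / 3 * E + 4 * a * (√(n : ℝ))⁻¹ :=
    ciSup_le fun u => abs_sub_le_of_smooth (hanti _) (hanti _) ha0 hLip hD hsmooth u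
  intro u
  refine (hD u).trans ?_
  have hEle : E ≤ c * γ * (3 + K / (8 * c)) * (√(n : ℝ))⁻¹ := by
    rw [hE, div_eq_mul_inv]
    refine mul_le_mul_of_nonneg_right ?_ (by positivity)
    refine mul_le_mul ?_ ?_ (by positivity) (by positivity)
    · rw [hc]; nlinarith
    · have : 4 * V * (K * γ) / a ≤ K / (8 * c) := by
        rw [ha, div_le_div_iff₀ (by positivity) (by positivity)]
        have h32 : 32 * c * V ≤ A := by rw [hA]; linarith
        calc 4 * V * (K * γ) * (8 * c) = K * γ * (32 * c * V) := by ring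
          _ ≤ K * γ * A := mul_le_mul_of_nonneg_left h32 (by positivity)
          _ = K * (A * γ) := by ring
      linarith
  have hsn : (√(n : ℝ))⁻¹ ≤ 2 * (√(n + 1 : ℝ))⁻¹ := by
    rw [← div_eq_mul_inv, inv_eq_one_div, div_le_div_iff₀ hs (by positivity), one_mul]
    rw [show (2 : ℝ) = √4 by rw [show (4 : ℝ) = 2 ^ 2 by norm_num, Real.sqrt_sq]; norm_num,
      ← Real.sqrt_mul (by norm_num)]
    refine Real.sqrt_le_sqrt ?_
    have : (1 : ℝ) ≤ n := by exact_mod_cast hn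
    linarith
  have hceq : c * γ * (3 + K / (8 * c)) = γ * (3 * c + K / 8) := by field_simp
  rw [hceq] at hEle
  calc D ≤ 2 * E + 6 * a * (√(n : ℝ))⁻¹ := by linarith
    _ ≤ (2 * (γ * (3 * c + K / 8)) + 6 * a) * (√(n : ℝ))⁻¹ := by linarith
    _ ≤ (2 * (γ * (3 * c + K / 8)) + 6 * a) * (2 * (√(n + 1 : ℝ))⁻¹) :=
        mul_le_mul_of_nonneg_left hsn (by positivity)
    _ = K * γ * (√(n + 1 : ℝ))⁻¹ := by rw [ha, hK]; ring

/-- The Berry-Esseen theorem: some universal constant works. -/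
lemma exists_isBerryEsseenBound : ∃ C, IsBerryEsseenBound C := by
  obtain ⟨K, hK, h⟩ := exists_abs_sumLaw_sub_le
  refine ⟨K, fun ν _ i3 hvar n hn t => ?_⟩
  set m := ∫ u, u ∂ν with hm
  set s := √(Var[id; ν]) with hs
  have hs0 : 0 < s := Real.sqrt_pos.2 hvar
  have hs2 : s ^ 2 = Var[id; ν] := Real.sq_sqrt hvar.le
  have i1 : Integrable (fun x : ℝ => x) ν := by
    refine ((integrable_const (1 : ℝ)).add i3).mono' (by fun_prop) (ae_of_all _ fun y => ?_)
    rw [Real.norm_eq_abs, Pi.add_apply]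
    nlinarith [abs_nonneg y, sq_nonneg (|y| - 1), mul_nonneg (abs_nonneg y) (sq_nonneg (|y| - 1))]
  set g : ℝ → ℝ := fun x => (x - m) / s with hg
  have hgm : Measurable g := by fun_prop
  have hprob : IsProbabilityMeasure (ν.map g) := Measure.isProbabilityMeasure_map hgm.aemeasurable
  have i3' : Integrable (fun x : ℝ => |x| ^ 3) (ν.map g) := by
    rw [integrable_map_measure (by fun_prop) hgm.aemeasurable]
    refine (((i3.add (integrable_const (|m| ^ 3))).const_mul 4).div_const (s ^ 3)).mono'
      (by fun_prop) (ae_of_all _ fun x => ?_)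
    simp only [Function.comp, hg, Pi.add_apply]
    rw [Real.norm_of_nonneg (by positivity), abs_div, abs_of_pos hs0, div_pow]
    gcongr
    have h1 : |x - m| ≤ |x| + |m| := abs_sub _ _
    calc |x - m| ^ 3 ≤ (|x| + |m|) ^ 3 := by gcongr
      _ ≤ 4 * (|x| ^ 3 + |m| ^ 3) := by
        nlinarith [mul_nonneg (add_nonneg (abs_nonneg x) (abs_nonneg m)) (sq_nonneg (|x| - |m|))]
  have hm' : ∫ x, x ∂(ν.map g) = 0 := by
    rw [integral_map hgm.aemeasurable (by fun_prop)]
    simp only [hg]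
    rw [integral_div, integral_sub i1 (integrable_const _), integral_const, probReal_univ, one_smul,
      ← hm, sub_self, zero_div]
  have hv' : ∫ x, x ^ 2 ∂(ν.map g) = 1 := by
    rw [integral_map hgm.aemeasurable (by fun_prop)]
    simp only [hg, div_pow]
    rw [integral_div]
    have : ∫ x, (x - m) ^ 2 ∂ν = Var[id; ν] := by
      rw [variance_eq_integral measurable_id.aemeasurable]; rfl
    rw [this, ← hs2, div_self (by positivity)]
  have hmain := h _ hprob i3' hm' hv' n (√n * t)
  have hn0 : (0 : ℝ) < n := by exact_mod_cast hn
  have hsn : 0 < √(n : ℝ) := Real.sqrt_pos.2 hn0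
  have hnn : (n : ℝ≥0) ≠ 0 := by exact_mod_cast hn.ne'
  have e1 : (sumLaw (ν.map g) n).real (Ioi (√n * t)) = (Measure.pi (fun _ : Fin n => ν)).real
      {x | n * m + t * (√n * s) < ∑ i, x i} := by
    have hp : Measure.pi (fun _ : Fin n => ν.map g) =
        (Measure.pi (fun _ : Fin n => ν)).map (fun x i => g (x i)) :=
      (Measure.pi_map_pi (fun _ => hgm.aemeasurable)).symm
    rw [sumLaw, hp, Measure.map_map (by fun_prop) (by fun_prop),
      map_measureReal_apply (by fun_prop) measurableSet_Ioi]
    congr 1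
    ext x
    simp only [mem_preimage, mem_Ioi, Function.comp, mem_ofPred_eq, hg]
    rw [← Finset.sum_div, lt_div_iff₀ hs0, Finset.sum_sub_distrib, Finset.sum_const,
      Finset.card_univ, Fintype.card_fin, nsmul_eq_mul]
    constructor <;> intro h <;> linarith
  have e2 : (gaussianReal 0 n).real (Ioi (√n * t)) = gaussianQ t := by
    rw [gaussianReal_real_Ioi hnn]
    congr 1
    simp only [NNReal.coe_natCast]
    field_simp
  have e3 : ∫ x, |x| ^ 3 ∂(ν.map g) = (∫ u, |u - m| ^ 3 ∂ν) / s ^ 3 := by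
    rw [integral_map hgm.aemeasurable (by fun_prop), ← integral_div]
    congr 1; ext x
    simp only [hg]
    rw [abs_div, abs_of_pos hs0, div_pow]
  rw [e1, e2, e3] at hmain
  refine hmain.trans ?_
  have hI : 0 ≤ ∫ u, |u - m| ^ 3 ∂ν := integral_nonneg fun _ => by positivity
  calc K * ((∫ u, |u - m| ^ 3 ∂ν) / s ^ 3) * (√(n + 1 : ℝ))⁻¹
      ≤ K * ((∫ u, |u - m| ^ 3 ∂ν) / s ^ 3) * (√(n : ℝ))⁻¹ := by
        refine mul_le_mul_of_nonneg_left ?_ (by positivity)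
        exact inv_anti₀ hsn (Real.sqrt_le_sqrt (by linarith))
    _ = _ := by field_simp

lemma IsBerryEsseenBound.nonneg {C : ℝ} (hC : IsBerryEsseenBound C) : 0 ≤ C := by
  have h := hC (gaussianReal 0 1) inferInstance integrable_abs_pow_gaussianReal
    (by rw [variance_id_gaussianReal]; simp) 1 one_pos 0
  rw [variance_id_gaussianReal, integral_id_gaussianReal] at h
  simp only [Nat.cast_one, NNReal.coe_one, Real.sqrt_one, one_pow, mul_one, sub_zero, div_one] at h
  have h1 : 1 ≤ ∫ x, |x| ^ 3 ∂(gaussianReal 0 1) :=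
    one_le_integral_abs_pow integrable_abs_pow_gaussianReal integral_sq_gaussianReal
  have h2 := (abs_nonneg _).trans h
  exact nonneg_of_mul_nonneg_left h2 (by linarith)

/-- The infimum defining the best constant is attained, and any larger constant works too. -/
lemma isBerryEsseenBound_of_le {C : ℝ} (hC : berryEsseenConst ≤ C) : IsBerryEsseenBound C := by
  intro ν _ i3 hvar n hn t
  set Y := (∫ u, |u - ∫ v, v ∂ν| ^ 3 ∂ν) / (√n * √(Var[id; ν]) ^ 3) with hY
  have hY0 : 0 ≤ Y := div_nonneg (integral_nonneg fun _ => by positivity) (by positivity)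
  rw [mul_div_assoc, ← hY]
  refine le_trans ?_ (mul_le_mul_of_nonneg_right hC hY0)
  set Z := |(Measure.pi fun _ : Fin n => ν).real
    {x | n * (∫ u, u ∂ν) + t * (√n * √(Var[id; ν])) < ∑ i, x i} - gaussianQ t|
  have hpt : ∀ C' ∈ {C : ℝ | IsBerryEsseenBound C}, Z ≤ C' * Y := fun C' hC' => by
    have := hC' ν inferInstance i3 hvar n hn t
    rw [mul_div_assoc, ← hY] at this
    exact this
  rcases hY0.eq_or_lt with h0 | h0
  · obtain ⟨C', hC'⟩ := exists_isBerryEsseenBound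
    have := hpt C' hC'
    rw [← h0, mul_zero] at this ⊢
    exact this
  · rw [← div_le_iff₀ h0]
    refine le_csInf exists_isBerryEsseenBound fun C' hC' => ?_
    rw [div_le_iff₀ h0]
    exact hpt C' hC'

lemma berryEsseenConst_nonneg : 0 ≤ berryEsseenConst :=
  le_csInf exists_isBerryEsseenBound fun _ hC => IsBerryEsseenBound.nonneg hC

/-! ### Bayes' rule, symmetry and capacity -/

lemma pi_withDensity_ofReal {ι : Type*} [Fintype ι] {Ω : ι → Type*}
    [∀ i, MeasurableSpace (Ω i)] (ν : ∀ i, Measure (Ω i)) [∀ i, IsProbabilityMeasure (ν i)]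
    {f : ∀ i, Ω i → ℝ} (h0 : ∀ i x, 0 ≤ f i x)
    (hi : ∀ i, Integrable (f i) (ν i)) :
    Measure.pi (fun i => (ν i).withDensity fun x => ENNReal.ofReal (f i x)) =
      (Measure.pi ν).withDensity fun x => ENNReal.ofReal (∏ i, f i (x i)) := by
  have hfin : ∀ i, IsFiniteMeasure ((ν i).withDensity fun x => ENNReal.ofReal (f i x)) :=
    fun i => isFiniteMeasure_withDensity_ofReal (hi i).hasFiniteIntegral
  refine (Measure.pi_eq fun s hs => ?_)
  have e : ∀ x : ∀ i, Ω i, (univ.pi s).indicator (fun x => ENNReal.ofReal (∏ i, f i (x i))) x =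
      ENNReal.ofReal (∏ i, (s i).indicator (f i) (x i)) := by
    intro x
    by_cases hx : x ∈ univ.pi s
    · rw [indicator_of_mem hx]
      congr 1
      exact Finset.prod_congr rfl fun i _ => (indicator_of_mem (hx i (mem_univ i)) _).symm
    · rw [indicator_of_notMem hx]
      simp only [mem_univ_pi, not_forall] at hx
      obtain ⟨i, hxi⟩ := hx
      rw [Finset.prod_eq_zero (Finset.mem_univ i) (indicator_of_notMem hxi _), ENNReal.ofReal_zero]
  have hnn : ∀ i x, 0 ≤ (s i).indicator (f i) x := fun i x =>
    indicator_nonneg (fun x _ => h0 i x) x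
  have hint : ∀ i, Integrable ((s i).indicator (f i)) (ν i) := fun i => (hi i).indicator (hs i)
  rw [withDensity_apply _ (MeasurableSet.univ_pi hs), ← lintegral_indicator (MeasurableSet.univ_pi hs)]
  simp_rw [e]
  rw [← ofReal_integral_eq_lintegral_ofReal
    (Integrable.fintype_prod_dep hint)
    (ae_of_all _ fun x => Finset.prod_nonneg fun i _ => hnn i _),
    integral_fintype_prod_eq_prod, ENNReal.ofReal_prod_of_nonneg
      fun i _ => integral_nonneg (hnn i)]
  refine Finset.prod_congr rfl fun i _ => ?_
  rw [withDensity_apply _ (hs i), ofReal_integral_eq_lintegral_ofReal (hint i)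
    (ae_of_all _ (hnn i)), ← lintegral_indicator (hs i)]
  congr 1
  ext x
  by_cases hx : x ∈ s i <;> simp [hx]

namespace BinaryChannel

variable {𝓨 : Type*} [MeasurableSpace 𝓨] {μ : Measure 𝓨} (W : BinaryChannel 𝓨 μ)

instance (x : Fin 2) : IsProbabilityMeasure (W.law x) :=
  ⟨by rw [law, withDensity_apply _ MeasurableSet.univ, Measure.restrict_univ, W.lintegral_p]⟩

instance : IsProbabilityMeasure W.output :=
  ⟨by simp [output, ENNReal.inv_two_add_inv_two]⟩

instance : IsProbabilityMeasure W.joint := by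
  refine ⟨?_⟩
  have h : ∀ x : Fin 2, ((W.law x).map (Prod.mk x)) univ = 1 := fun x => by
    rw [Measure.map_apply measurable_prodMk_left MeasurableSet.univ]; simp
  simp [joint, h, ENNReal.inv_two_add_inv_two]

lemma measurable_posteriorProb (x : Fin 2) : Measurable (W.posteriorProb x) := by
  have := W.measurable_p
  unfold posteriorProb
  fun_prop

lemma posteriorProb_nonneg (x : Fin 2) (y : 𝓨) : 0 ≤ W.posteriorProb x y := by
  unfold posteriorProb; positivity

lemma posteriorProb_le_one (x : Fin 2) (y : 𝓨) : W.posteriorProb x y ≤ 1 := by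
  unfold posteriorProb
  refine div_le_one_of_le₀ ?_ (by positivity)
  have h0 := (W.p 0 y).coe_nonneg
  have h1 := (W.p 1 y).coe_nonneg
  fin_cases x <;> simp

lemma output_eq_withDensity : W.output =
    μ.withDensity fun y => ((W.p 0 y + W.p 1 y : ℝ≥0) : ℝ≥0∞) * 2⁻¹ := by
  have h0 := (W.measurable_p 0).coe_nnreal_ennreal
  have h1 := (W.measurable_p 1).coe_nnreal_ennreal
  rw [output, Fin.sum_univ_two, law, law, ← withDensity_smul _ h0, ← withDensity_smul _ h1,
    ← withDensity_add_left (h0.const_smul _)]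
  congr 1
  ext y
  simp only [Pi.add_apply, Pi.smul_apply, smul_eq_mul, ENNReal.coe_add]
  ring

/-- Bayes' rule: given the input `x`, the output has density `2 p(x|y)` with respect to its law
under uniform inputs. -/
lemma law_eq_withDensity (x : Fin 2) : W.law x =
    W.output.withDensity fun y => ENNReal.ofReal (2 * W.posteriorProb x y) := by
  have hm := W.measurable_p
  have hp := W.measurable_posteriorProb x
  rw [output_eq_withDensity, ← withDensity_mul _ (by fun_prop) (by fun_prop), law]
  congr 1
  ext y
  simp only [Pi.mul_apply]
  rw [posteriorProb]
  by_cases hs : W.p 0 y + W.p 1 y = 0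
  · have h0 : W.p 0 y = 0 := (add_eq_zero.1 hs).1
    have h1 : W.p 1 y = 0 := (add_eq_zero.1 hs).2
    have : W.p x y = 0 := by fin_cases x <;> assumption
    rw [hs, this]; simp
  · rw [show ((W.p 0 y + W.p 1 y : ℝ≥0) : ℝ≥0∞) * 2⁻¹ =
      ENNReal.ofReal ((W.p 0 y + W.p 1 y) / 2) by
        rw [ENNReal.ofReal_div_of_pos two_pos, ← NNReal.coe_add, ENNReal.ofReal_coe_nnreal,
          ENNReal.ofReal_ofNat]; rfl, ← ENNReal.ofReal_mul (by positivity)]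
    have hs' : (W.p 0 y : ℝ) + W.p 1 y ≠ 0 := by exact_mod_cast hs
    rw [← ENNReal.ofReal_coe_nnreal]
    congr 1
    field_simp

lemma integrable_two_mul_posteriorProb (x : Fin 2) :
    Integrable (fun y => 2 * W.posteriorProb x y) W.output := by
  refine Integrable.of_bound (C := 2) ((W.measurable_posteriorProb x).const_mul 2).aestronglyMeasurable
    (ae_of_all _ fun y => ?_)
  rw [Real.norm_of_nonneg (by linarith [W.posteriorProb_nonneg x y])]
  linarith [W.posteriorProb_le_one x y]

lemma ae_law_posteriorProb_pos (x : Fin 2) : ∀ᵐ y ∂(W.law x), 0 < W.posteriorProb x y := by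
  have hp := W.measurable_posteriorProb x
  rw [law_eq_withDensity, ae_withDensity_iff (by fun_prop)]
  refine ae_of_all _ fun y hy => ?_
  rw [Ne, ENNReal.ofReal_eq_zero, not_le] at hy
  linarith

lemma measurable_info : Measurable W.info :=
  measurable_from_prod_countable_right fun x =>
    (Real.measurable_log.comp (W.measurable_posteriorProb x)).neg

lemma info_nonneg (w : Fin 2 × 𝓨) : 0 ≤ W.info w :=
  neg_nonneg.2 (Real.log_nonpos (W.posteriorProb_nonneg _ _) (W.posteriorProb_le_one _ _))

/-- The law of `-ln p(X|Y)`. -/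
noncomputable def infoLaw : Measure ℝ := W.joint.map W.info

instance : IsProbabilityMeasure W.infoLaw :=
  Measure.isProbabilityMeasure_map W.measurable_info.aemeasurable

lemma joint_map {α : Type*} [MeasurableSpace α] {f : Fin 2 × 𝓨 → α} (hf : Measurable f) :
    W.joint.map f = ∑ x : Fin 2, (2⁻¹ : ℝ≥0∞) • (W.law x).map fun y => f (x, y) := by
  rw [joint, Fin.sum_univ_two, Fin.sum_univ_two, Measure.map_add _ _ hf, Measure.map_smul,
    Measure.map_smul, Measure.map_map hf measurable_prodMk_left,
    Measure.map_map hf measurable_prodMk_left]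
  rfl

variable {W}

/-- For a symmetric channel `-ln p(x|Y)` has the same law under either input `x`. -/
lemma IsSymmetric.map_law (hsymm : W.IsSymmetric) (x : Fin 2) :
    (W.law x).map (fun y => -Real.log (W.posteriorProb x y)) = W.infoLaw := by
  rw [infoLaw, joint_map W W.measurable_info, Fin.sum_univ_two]
  simp only [info]
  rw [← show _ = _ from hsymm, ← add_smul, ENNReal.inv_two_add_inv_two, one_smul]
  fin_cases x
  · rfl
  · exact hsymm.symm

variable (W)

lemma integrable_joint_iff {f : Fin 2 × 𝓨 → ℝ} (hf : Measurable f) :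
    Integrable f W.joint ↔ ∀ x, Integrable (fun y => f (x, y)) (W.law x) := by
  rw [joint, integrable_finsetSum_measure]
  simp only [Finset.mem_univ, true_imp_iff]
  refine forall_congr' fun x => ?_
  rw [integrable_smul_measure (by simp) (by simp),
    integrable_map_measure hf.aestronglyMeasurable measurable_prodMk_left.aemeasurable]
  rfl

lemma integral_joint {f : Fin 2 × 𝓨 → ℝ} (hf : Measurable f) (hi : Integrable f W.joint) :
    ∫ w, f w ∂W.joint = ∑ x, 2⁻¹ * ∫ y, f (x, y) ∂(W.law x) := by
  have h := hi
  rw [joint, integrable_finsetSum_measure] at h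
  rw [joint, integral_finsetSum_measure h]
  refine Finset.sum_congr rfl fun x _ => ?_
  rw [integral_smul_measure, integral_map measurable_prodMk_left.aemeasurable
    hf.aestronglyMeasurable]
  simp

/-- `E[p(X|Y)^{-1}]` is finite. -/
lemma integrable_exp_info : Integrable (fun w => Real.exp (W.info w)) W.joint := by
  rw [integrable_joint_iff W W.measurable_info.exp]
  intro x
  have hp := W.measurable_posteriorProb x
  have h0 := W.posteriorProb_nonneg x
  rw [law_eq_withDensity, integrable_withDensity_iff (by fun_prop)
    (ae_of_all _ fun y => ENNReal.ofReal_lt_top)]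
  refine Integrable.of_bound (C := 2) ?_ (ae_of_all _ fun y => ?_)
  · have : Measurable fun y => W.info (x, y) := W.measurable_info.comp measurable_prodMk_left
    refine Measurable.aestronglyMeasurable ?_
    fun_prop
  · rw [ENNReal.toReal_ofReal (by linarith [h0 y]), Real.norm_of_nonneg
      (mul_nonneg (Real.exp_pos _).le (by linarith [h0 y])), info]
    rcases (h0 y).eq_or_lt with h | h
    · simp only [← h]; simp
    · simp only [Real.exp_neg, Real.exp_log h]
      rw [mul_left_comm, inv_mul_cancel₀ h.ne', mul_one]

lemma one_mem_integrableExpSet : (1 : ℝ) ∈ integrableExpSet W.info W.joint := by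
  simpa [integrableExpSet] using W.integrable_exp_info

lemma mem_integrableExpSet_of_nonpos {l : ℝ} (hl : l ≤ 0) :
    l ∈ integrableExpSet W.info W.joint := by
  refine Integrable.of_bound (C := 1) (W.measurable_info.const_mul l).exp.aestronglyMeasurable
    (ae_of_all _ fun w => ?_)
  rw [Real.norm_of_nonneg (Real.exp_pos _).le, Real.exp_le_one_iff]
  exact mul_nonpos_of_nonpos_of_nonneg hl (W.info_nonneg w)

lemma mem_interior_integrableExpSet {l m : ℝ} (hlm : l < m)
    (hm : m ∈ integrableExpSet W.info W.joint) :
    l ∈ interior (integrableExpSet W.info W.joint) := by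
  have hsub : Ioo (min l 0 - 1) m ⊆ integrableExpSet W.info W.joint := by
    intro x hx
    rcases le_total x 0 with h | h
    · exact W.mem_integrableExpSet_of_nonpos h
    · exact convex_integrableExpSet.ordConnected.out (W.mem_integrableExpSet_of_nonpos le_rfl) hm
        ⟨h, hx.2.le⟩
  exact interior_maximal hsub isOpen_Ioo ⟨by linarith [min_le_left l 0], hlm⟩

lemma zero_mem_interior_integrableExpSet : (0 : ℝ) ∈ interior (integrableExpSet W.info W.joint) :=
  W.mem_interior_integrableExpSet one_pos W.one_mem_integrableExpSet

lemma integrable_info : Integrable W.info W.joint :=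
  integrable_of_mem_interior_integrableExpSet W.zero_mem_interior_integrableExpSet

lemma mutualInfo_le_two {t : Fin 2 → ℝ} (ht : t ∈ stdSimplex ℝ (Fin 2)) : W.mutualInfo t ≤ 2 := by
  rw [mutualInfo]
  have key : ∀ x, t x * ∫ y, (W.p x y : ℝ) * Real.log (W.p x y / ∑ u, t u * W.p u y) ∂μ ≤ 1 := by
    intro x
    rcases (ht.1 x).eq_or_lt with h | h
    · rw [← h, zero_mul]; exact zero_le_one
    have hp1 : ∫ y, (W.p x y : ℝ) ∂μ = 1 := by
      rw [integral_eq_lintegral_of_nonneg_ae (ae_of_all _ fun y => (W.p x y).coe_nonneg)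
        (W.measurable_p x).coe_nnreal_real.aestronglyMeasurable]
      simp_rw [ENNReal.ofReal_coe_nnreal]
      rw [W.lintegral_p, ENNReal.toReal_one]
    have hpi : Integrable (fun y => (W.p x y : ℝ)) μ := by
      by_contra hn
      rw [integral_undef hn] at hp1
      exact zero_ne_one hp1
    have hle : ∫ y, (W.p x y : ℝ) * Real.log (W.p x y / ∑ u, t u * W.p u y) ∂μ ≤ (t x)⁻¹ := by
      by_cases hi : Integrable
          (fun y => (W.p x y : ℝ) * Real.log (W.p x y / ∑ u, t u * W.p u y)) μ
      · calc _ ≤ ∫ y, (W.p x y : ℝ) * (t x)⁻¹ ∂μ := by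
              refine integral_mono hi (hpi.mul_const _) fun y => ?_
              refine mul_le_mul_of_nonneg_left ?_ (W.p x y).coe_nonneg
              have hq0 : 0 ≤ ∑ u, t u * W.p u y :=
                Finset.sum_nonneg fun u _ => mul_nonneg (ht.1 u) (W.p u y).coe_nonneg
              have hq : t x * W.p x y ≤ ∑ u, t u * W.p u y :=
                Finset.single_le_sum (f := fun u => t u * (W.p u y : ℝ))
                  (fun u _ => mul_nonneg (ht.1 u) (W.p u y).coe_nonneg) (Finset.mem_univ x)
              refine (Real.log_le_self (by positivity)).trans ?_
              rcases hq0.eq_or_lt with h0 | h0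
              · rw [← h0, div_zero]; positivity
              · rw [div_le_iff₀ h0, inv_mul_eq_div, le_div_iff₀' h]
                exact hq
          _ = (t x)⁻¹ := by rw [integral_mul_const, hp1, one_mul]
      · rw [integral_undef hi]; positivity
    calc _ ≤ t x * (t x)⁻¹ := mul_le_mul_of_nonneg_left hle h.le
      _ = 1 := mul_inv_cancel₀ h.ne'
  rw [Fin.sum_univ_two]
  linarith [key 0, key 1]

/-- The uniform input distribution achieves mutual information `ln 2 - H(X|Y)`. -/
lemma log_two_sub_condEntropy_le_capacity : Real.log 2 - W.condEntropy ≤ W.capacity := by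
  have hmem : (fun _ => 1 / 2 : Fin 2 → ℝ) ∈ stdSimplex ℝ (Fin 2) :=
    ⟨fun _ => by norm_num, by norm_num [Fin.sum_univ_two]⟩
  refine le_csSup_of_le ⟨2, ?_⟩ ⟨_, hmem, rfl⟩ (le_of_eq ?_)
  · rintro _ ⟨t, ht, rfl⟩
    exact W.mutualInfo_le_two ht
  have hi := (integrable_joint_iff W W.measurable_info).1 W.integrable_info
  rw [condEntropy, integral_joint W W.measurable_info W.integrable_info, mutualInfo]
  have hx : ∀ x, ∫ y, (W.p x y : ℝ) *
      Real.log (W.p x y / ∑ u, (fun _ => 1 / 2 : Fin 2 → ℝ) u * W.p u y) ∂μ =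
      Real.log 2 - ∫ y, W.info (x, y) ∂(W.law x) := by
    intro x
    have h1 : ∫ y, Real.log (2 * W.posteriorProb x y) ∂(W.law x) =
        ∫ y, (W.p x y : ℝ) * Real.log (2 * W.posteriorProb x y) ∂μ := by
      rw [law, integral_withDensity_eq_integral_smul (W.measurable_p x)]
      rfl
    have h2 : ∫ y, Real.log (2 * W.posteriorProb x y) ∂(W.law x) =
        ∫ y, (Real.log 2 - W.info (x, y)) ∂(W.law x) := by
      refine integral_congr_ae ?_
      filter_upwards [W.ae_law_posteriorProb_pos x] with y hy
      rw [Real.log_mul two_ne_zero hy.ne', info, sub_neg_eq_add]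
    rw [h2, integral_sub (integrable_const _) (hi x), integral_const, probReal_univ, one_smul] at h1
    rw [h1]
    congr 1
    ext y
    congr 2
    rw [posteriorProb, Fin.sum_univ_two, ← mul_add]
    rw [one_div, ← div_div, div_inv_eq_mul]
    ring
  simp_rw [hx, Fin.sum_univ_two]
  ring

end BinaryChannel

/-! ### The general converse -/

namespace BinaryChannel

variable {𝓨 : Type*} [MeasurableSpace 𝓨] {μ : Measure 𝓨} (W : BinaryChannel 𝓨 μ)

instance {n : ℕ} (x : Fin n → Fin 2) : IsProbabilityMeasure (W.blockLaw x) := by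
  unfold blockLaw; infer_instance

instance (n : ℕ) : IsProbabilityMeasure (W.blockOutput n) := by
  unfold blockOutput; infer_instance

lemma measurable_blockPosterior {n : ℕ} (x : Fin n → Fin 2) : Measurable (W.blockPosterior x) := by
  have := W.measurable_posteriorProb
  unfold blockPosterior
  fun_prop

lemma measurableSet_outerMirror {n : ℕ} (x : Fin n → Fin 2) (δ : ℝ) :
    MeasurableSet (W.outerMirror x δ) := by
  have h := W.measurable_blockPosterior x
  exact (measurableSet_lt measurable_const h).inter
    (measurableSet_lt measurable_const ((Real.measurable_log.comp h).const_mul _))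

lemma blockLaw_eq_withDensity {n : ℕ} (x : Fin n → Fin 2) : W.blockLaw x =
    (W.blockOutput n).withDensity fun y => ENNReal.ofReal (2 ^ n * W.blockPosterior x y) := by
  have h := pi_withDensity_ofReal (fun _ : Fin n => W.output)
    (f := fun i y => 2 * W.posteriorProb (x i) y)
    (fun i y => by linarith [W.posteriorProb_nonneg (x i) y])
    (fun i => W.integrable_two_mul_posteriorProb (x i))
  simp_rw [← law_eq_withDensity] at h
  rw [blockLaw, h, blockOutput]
  simp_rw [blockPosterior, Finset.prod_mul_distrib, Finset.prod_const, Finset.card_univ,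
    Fintype.card_fin]

/-- On the outer mirror image the channel law is dominated by a small multiple of the output law. -/
lemma blockLaw_real_inter_le {n : ℕ} (hn : 0 < n) (x : Fin n → Fin 2) (δ : ℝ)
    {D : Set (Fin n → 𝓨)} (hD : MeasurableSet D) :
    (W.blockLaw x).real (W.outerMirror x δ ∩ D) ≤
      Real.exp (n * (Real.log 2 - W.condEntropy - δ)) *
        (W.blockOutput n).real (W.outerMirror x δ ∩ D) := by
  have hn0 : (0 : ℝ) < n := by exact_mod_cast hn
  have hm := (W.measurableSet_outerMirror x δ).inter hD
  have hle : W.blockLaw x (W.outerMirror x δ ∩ D) ≤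
      ENNReal.ofReal (Real.exp (n * (Real.log 2 - W.condEntropy - δ))) *
        W.blockOutput n (W.outerMirror x δ ∩ D) := by
    rw [blockLaw_eq_withDensity, withDensity_apply _ hm, ← setLIntegral_const]
    refine setLIntegral_mono measurable_const fun y hy => ENNReal.ofReal_le_ofReal ?_
    obtain ⟨h0, h1⟩ := hy.1
    have h2 : Real.log (W.blockPosterior x y) ≤ -(n * (W.condEntropy + δ)) := by
      have := mul_lt_mul_of_pos_left h1 hn0
      have e : (n : ℝ) * (-(1 / n) * Real.log (W.blockPosterior x y)) =
        -Real.log (W.blockPosterior x y) := by field_simp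
      rw [e] at this
      linarith
    calc 2 ^ n * W.blockPosterior x y
        = Real.exp (n * Real.log 2) * Real.exp (Real.log (W.blockPosterior x y)) := by
          rw [Real.exp_log h0, mul_comm (n : ℝ), Real.exp_mul, Real.exp_log two_pos,
            Real.rpow_natCast]
      _ = Real.exp (n * Real.log 2 + Real.log (W.blockPosterior x y)) := (Real.exp_add _ _).symm
      _ ≤ _ := Real.exp_le_exp.2 (by linarith)
  have h := ENNReal.toReal_mono
    (ENNReal.mul_ne_top ENNReal.ofReal_ne_top (measure_ne_top _ _)) hle
  rwa [ENNReal.toReal_mul, ENNReal.toReal_ofReal (Real.exp_pos _).le] at h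

lemma neg_log_prod_eq {n : ℕ} {f : Fin n → ℝ} (h : ∀ i, 0 < f i) :
    -(1 / n) * Real.log (∏ i, f i) = (∑ i, -Real.log (f i)) / n := by
  rw [Real.log_prod (fun i _ => (h i).ne'), Finset.sum_neg_distrib]
  ring

lemma measurableSet_lt_sum_div (n : ℕ) (c : ℝ) :
    MeasurableSet {z : Fin n → ℝ | c < (∑ i, z i) / n} :=
  measurableSet_lt measurable_const (by fun_prop)

lemma ae_joint_posteriorProb_pos : ∀ᵐ w ∂W.joint, 0 < W.posteriorProb w.1 w.2 := by
  have hm : MeasurableSet {w : Fin 2 × 𝓨 | 0 < W.posteriorProb w.1 w.2} :=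
    measurableSet_lt measurable_const (measurable_from_prod_countable_right fun x =>
      W.measurable_posteriorProb x)
  have h : ∀ x : Fin 2, ∀ᵐ w ∂((2⁻¹ : ℝ≥0∞) • (W.law x).map (Prod.mk x)),
      0 < W.posteriorProb w.1 w.2 := fun x => by
    refine Measure.ae_smul_measure ?_ _
    rw [ae_map_iff measurable_prodMk_left.aemeasurable hm]
    exact W.ae_law_posteriorProb_pos x
  rw [joint, Fin.sum_univ_two, ae_add_measure_iff]
  exact ⟨h 0, h 1⟩

/-- The tail probability in terms of independent copies of `-ln p(X|Y)`. -/
lemma tailProb_eq (n : ℕ) (δ : ℝ) : W.tailProb n δ =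
    (Measure.pi (fun _ : Fin n => W.infoLaw)).real {z | W.condEntropy + δ < (∑ i, z i) / n} := by
  have hp : Measure.pi (fun _ : Fin n => W.infoLaw) =
      (Measure.pi (fun _ : Fin n => W.joint)).map (fun w i => W.info (w i)) :=
    (Measure.pi_map_pi (fun _ => W.measurable_info.aemeasurable)).symm
  have hmm : Measurable fun (w : Fin n → Fin 2 × 𝓨) i => W.info (w i) :=
    measurable_pi_lambda _ fun i => W.measurable_info.comp (measurable_pi_apply i)
  rw [hp, map_measureReal_apply hmm (measurableSet_lt_sum_div n _), tailProb]
  refine measureReal_congr ?_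
  have hae : ∀ᵐ w ∂(Measure.pi (fun _ : Fin n => W.joint)),
      ∀ i, 0 < W.posteriorProb (w i).1 (w i).2 :=
    ae_all_iff.2 fun i => (Measure.tendsto_eval_ae_ae (μ := fun _ : Fin n => W.joint)
      (i := i)).eventually W.ae_joint_posteriorProb_pos
  filter_upwards [hae] with w hw
  have := neg_log_prod_eq hw
  exact congrArg (W.condEntropy + δ < ·) this |>.to_iff.eq

variable {W}

/-- By symmetry the outer mirror image of every input block has the same probability. -/
lemma IsSymmetric.blockLaw_outerMirror (hsymm : W.IsSymmetric) {n : ℕ} (x : Fin n → Fin 2)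
    (δ : ℝ) : (W.blockLaw x).real (W.outerMirror x δ) = W.tailProb n δ := by
  have hm : ∀ i, Measurable fun y => -Real.log (W.posteriorProb (x i) y) := fun i =>
    (Real.measurable_log.comp (W.measurable_posteriorProb (x i))).neg
  have hp : Measure.pi (fun _ : Fin n => W.infoLaw) =
      (W.blockLaw x).map (fun y i => -Real.log (W.posteriorProb (x i) (y i))) := by
    rw [blockLaw, Measure.pi_map_pi (fun i => (hm i).aemeasurable)]
    congr 1
    ext1 i
    exact (hsymm.map_law (x i)).symm
  have hmm : Measurable fun (y : Fin n → 𝓨) i => -Real.log (W.posteriorProb (x i) (y i)) :=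
    measurable_pi_lambda _ fun i => (hm i).comp (measurable_pi_apply i)
  rw [tailProb_eq, hp, map_measureReal_apply hmm (measurableSet_lt_sum_div n _)]
  refine measureReal_congr ?_
  have hae : ∀ᵐ y ∂(W.blockLaw x), ∀ i, 0 < W.posteriorProb (x i) (y i) :=
    ae_all_iff.2 fun i => (Measure.tendsto_eval_ae_ae (μ := fun i : Fin n => W.law (x i))
      (i := i)).eventually (W.ae_law_posteriorProb_pos (x i))
  filter_upwards [hae] with y hy
  have h1 := neg_log_prod_eq hy
  have h2 : 0 < W.blockPosterior x y := Finset.prod_pos fun i _ => hy i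
  have : (y ∈ W.outerMirror x δ) =
      (W.condEntropy + δ < (∑ i, -Real.log (W.posteriorProb (x i) (y i))) / n) := by
    rw [← h1]
    exact propext ⟨fun h => h.2, fun h => ⟨h2, h⟩⟩
  exact this

/-- The counting bound: a code of average error at most `ε` has at most about
`e^{n (ln 2 - H - δ)} P(B_{n,δ}) / (tail - ε)` codewords, because the parts of the outer mirror
images inside the decision regions are disjoint and each carries probability `tail - ε` on
average. -/
lemma IsSymmetric.size_mul_le (hsymm : W.IsSymmetric) {n : ℕ} (hn : 0 < n) (δ : ℝ) {ε : ℝ}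
    (c : ChannelCode 𝓨 n) (hc : c.avgError W ≤ ε) :
    c.size * (W.tailProb n δ - ε) ≤
      Real.exp (n * (Real.log 2 - W.condEntropy - δ)) * W.mirrorProb n δ := by
  have hM : (0 : ℝ) < c.size := by exact_mod_cast c.size_pos
  set U := ⋃ x : Fin n → Fin 2, W.outerMirror x δ with hU
  rw [ChannelCode.avgError, div_le_iff₀ hM] at hc
  have h1 : ∀ m, W.tailProb n δ - (W.blockLaw (c.codeword m)).real (c.region m)ᶜ ≤
      Real.exp (n * (Real.log 2 - W.condEntropy - δ)) *
        (W.blockOutput n).real (U ∩ c.region m) := by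
    intro m
    have hr := c.measurableSet_region m
    have h2 := measureReal_inter_add_sdiff (μ := W.blockLaw (c.codeword m))
      (s := W.outerMirror (c.codeword m) δ) hr
    have h3 : (W.blockLaw (c.codeword m)).real (W.outerMirror (c.codeword m) δ \ c.region m) ≤
        (W.blockLaw (c.codeword m)).real (c.region m)ᶜ :=
      measureReal_mono fun y hy => hy.2
    rw [hsymm.blockLaw_outerMirror] at h2
    calc _ ≤ (W.blockLaw (c.codeword m)).real
          (W.outerMirror (c.codeword m) δ ∩ c.region m) := by linarith
      _ ≤ _ := W.blockLaw_real_inter_le hn _ δ hr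
      _ ≤ _ := by
          refine mul_le_mul_of_nonneg_left ?_ (Real.exp_pos _).le
          exact measureReal_mono (inter_subset_inter_left _ 
            (subset_iUnion (fun x : Fin n → Fin 2 => W.outerMirror x δ) (c.codeword m)))
  have hsum := Finset.sum_le_sum fun m (_ : m ∈ Finset.univ) => h1 m
  rw [Finset.sum_sub_distrib, Finset.sum_const, Finset.card_univ, Fintype.card_fin, nsmul_eq_mul,
    ← Finset.mul_sum] at hsum
  have hdisj : ∑ m, (W.blockOutput n).real (U ∩ c.region m) ≤ W.mirrorProb n δ := by
    have hUm : MeasurableSet U := MeasurableSet.iUnion fun x => W.measurableSet_outerMirror x δ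
    rw [← measureReal_iUnion_fintype
      (fun m m' h => ((c.disjoint_region h).mono inter_subset_right inter_subset_right))
      (fun m => hUm.inter (c.measurableSet_region m))]
    exact measureReal_mono (iUnion_subset fun m => inter_subset_left)
  have := mul_le_mul_of_nonneg_left hdisj
    (Real.exp_pos (n * (Real.log 2 - W.condEntropy - δ))).le
  linarith

/-- The general converse. -/
theorem IsSymmetric.rate_le_converseBound (hsymm : W.IsSymmetric) (hσ : 0 < W.sigmaH) {n : ℕ}
    {ε δ : ℝ} (hn : 0 < n) (h0 : 0 < ε) (h1 : ε < 1) (h : W.errorLevel n ε ≤ W.tailProb n δ)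
    (c : ChannelCode 𝓨 n) (hc : c.avgError W ≤ ε) : c.rate ≤ W.converseBound n ε δ := by
  have hn0 : (0 : ℝ) < n := by exact_mod_cast hn
  have hM : (0 : ℝ) < c.size := by exact_mod_cast c.size_pos
  have hlog : 0 < -2 * Real.log ε := by linarith [Real.log_neg h0 h1]
  set β := √(-2 * Real.log ε / n) / W.sigmaH with hβ
  have hβ0 : 0 < β := div_pos (Real.sqrt_pos.2 (by positivity)) hσ
  have hβ2 : -2 * Real.log ε / (W.sigmaH ^ 2 * n) = β ^ 2 := by
    rw [hβ, div_pow, Real.sq_sqrt (by positivity)]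
    field_simp
  have hlevel : W.errorLevel n ε = (1 + 2 * β) * ε := by
    rw [errorLevel, hβ]; ring
  have hsize := hsymm.size_mul_le hn δ c hc
  have hlow : c.size * (2 * β * ε) ≤
      Real.exp (n * (Real.log 2 - W.condEntropy - δ)) * W.mirrorProb n δ := by
    refine le_trans (mul_le_mul_of_nonneg_left ?_ hM.le) hsize
    rw [hlevel] at h
    linarith
  have hP : 0 < W.mirrorProb n δ := by
    have : 0 < c.size * (2 * β * ε) := by positivity
    exact pos_of_mul_pos_right (this.trans_le hlow) (Real.exp_pos _).le
  have hlog2 := Real.log_le_log (by positivity) hlow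
  rw [Real.log_mul hM.ne' (by positivity), Real.log_mul (by positivity) h0.ne',
    Real.log_mul (Real.exp_pos _).ne' hP.ne', Real.log_exp] at hlog2
  have hβlog : Real.log (β ^ 2) - Real.log (1 + β) ≤ Real.log (2 * β) := by
    rw [← Real.log_div (by positivity) (by positivity)]
    refine Real.log_le_log (by positivity) ?_
    rw [div_le_iff₀ (by positivity)]
    nlinarith
  have hcap := mul_le_mul_of_nonneg_left W.log_two_sub_condEntropy_le_capacity hn0.le
  rw [ChannelCode.rate, converseBound, hβ2, ← hβ, div_le_iff₀ hn0]
  have e : (W.capacity - δ - (Real.log ε - Real.log (W.mirrorProb n δ) + Real.log (β ^ 2)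
      - Real.log (1 + β)) / n) * n = n * W.capacity - n * δ - (Real.log ε -
      Real.log (W.mirrorProb n δ) + Real.log (β ^ 2) - Real.log (1 + β)) := by
    field_simp
  rw [e]
  linarith

end BinaryChannel

/-! ### Exponential tilting -/

lemma integrableOn_mul_exp_neg {a : ℝ} (ha : 0 < a) (c : ℝ) :
    IntegrableOn (fun t => a * Real.exp (-(a * t))) (Ioi c) := by
  have := (integrableOn_exp_mul_Ioi (neg_lt_zero.2 ha) c).const_mul a
  simp only [neg_mul] at this
  exact this

lemma integral_mul_exp_neg {a : ℝ} (ha : 0 < a) (c : ℝ) :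
    ∫ t in Ioi c, a * Real.exp (-(a * t)) = Real.exp (-(a * c)) := by
  have h := integral_exp_mul_Ioi (neg_lt_zero.2 ha) c
  simp only [neg_mul] at h
  rw [integral_const_mul, h]
  field_simp

/-- Layer-cake form: the exponential moment over a half-line is an average of the probabilities of
intervals, to which the Berry-Esseen theorem applies. -/
lemma setIntegral_exp_neg_eq (P : Measure ℝ) [IsProbabilityMeasure P] {a : ℝ} (ha : 0 < a)
    (ρ : ℝ) : ∫ x in Ioi ρ, Real.exp (-(a * x)) ∂P =
      ∫ t in Ioi ρ, a * Real.exp (-(a * t)) * P.real (Ioc ρ t) := by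
  set f : ℝ → ℝ → ℝ := fun x t =>
    {z : ℝ × ℝ | ρ < z.1 ∧ z.1 ≤ z.2}.indicator (fun z => a * Real.exp (-(a * z.2))) (x, t) with hf
  have hm : MeasurableSet {z : ℝ × ℝ | ρ < z.1 ∧ z.1 ≤ z.2} :=
    (measurableSet_lt measurable_const measurable_fst).inter
      (measurableSet_le measurable_fst measurable_snd)
  have hint : Integrable (Function.uncurry f) (P.prod (volume.restrict (Ioi ρ))) := by
    have h := (integrable_const (1 : ℝ) (μ := P)).mul_prod (integrableOn_mul_exp_neg ha ρ)
    simp only [one_mul] at h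
    exact h.indicator hm
  have hswap := integral_integral_swap hint
  have h1 : ∀ x, ∫ t in Ioi ρ, f x t = (Ioi ρ).indicator (fun x => Real.exp (-(a * x))) x := by
    intro x
    by_cases hx : x ∈ Ioi ρ
    · have hx' : ρ < x := hx
      rw [indicator_of_mem hx, ← integral_mul_exp_neg ha x, ← integral_Ici_eq_integral_Ioi (x := x),
        ← integral_indicator measurableSet_Ioi, ← integral_indicator measurableSet_Ici]
      congr 1
      ext t
      by_cases ht : x ≤ t
      · simp [hf, indicator, hx', ht, hx'.trans_le ht]
      · simp [hf, indicator, ht]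
    · rw [indicator_of_notMem hx]
      rw [mem_Ioi] at hx
      simp [hf, indicator, hx]
  have h2 : ∀ t, ∫ x, f x t ∂P = a * Real.exp (-(a * t)) * P.real (Ioc ρ t) := by
    intro t
    have : (fun x => f x t) = (Ioc ρ t).indicator fun _ => a * Real.exp (-(a * t)) := by
      ext x
      simp [hf, indicator]
    rw [this, integral_indicator_const _ measurableSet_Ioc, smul_eq_mul, mul_comm]
  simp_rw [h1, h2] at hswap
  rw [← hswap, integral_indicator measurableSet_Ioi]

/-- The Laplace transform of a truncated Gaussian. -/
lemma setIntegral_exp_neg_gaussianReal (a ρ : ℝ) :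
    ∫ x in Ioi ρ, Real.exp (-(a * x)) ∂(gaussianReal 0 1) =
      Real.exp (a ^ 2 / 2) * gaussianQ (ρ + a) := by
  have h := (measurePreserving_add_right volume a).setIntegral_preimage_emb
    (measurableEmbedding_addRight a) (fun t : ℝ => Real.exp (-t ^ 2 / 2)) (Ioi (ρ + a))
  have hp : (fun y : ℝ => y + a) ⁻¹' Ioi (ρ + a) = Ioi ρ := by ext; simp
  rw [hp] at h
  rw [← integral_indicator measurableSet_Ioi, integral_gaussianReal_eq_integral_smul one_ne_zero,
    gaussianQ, ← h, mul_left_comm, ← integral_const_mul, ← integral_const_mul,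
    ← integral_indicator measurableSet_Ioi]
  congr 1
  ext x
  by_cases hx : x ∈ Ioi ρ
  · rw [indicator_of_mem hx, indicator_of_mem hx, gaussianPDFReal_zero_one, smul_eq_mul, mul_assoc,
      ← Real.exp_add, ← Real.exp_add]
    congr 2
    ring
  · rw [indicator_of_notMem hx, indicator_of_notMem hx, smul_zero]

/-- Lower bound for `E[e^{-aU}; U > 0]` when `U` is within `κ` of a standard Gaussian: at worst the
mass `2 κ` nearest to `0` is missing. -/
lemma le_setIntegral_exp_neg {P : Measure ℝ} [IsProbabilityMeasure P] {κ : ℝ} (hκ : 2 * κ < 1 / 2)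
    (hP : ∀ t, |P.real (Ioi t) - gaussianQ t| ≤ κ) {a : ℝ} (ha : 0 ≤ a) :
    Real.exp (a ^ 2 / 2) * gaussianQ (gaussianQInv (1 / 2 - 2 * κ) + a) ≤
      ∫ x in Ioi 0, Real.exp (-(a * x)) ∂P := by
  have hκ0 : 0 ≤ κ := (abs_nonneg _).trans (hP 0)
  set ρ := gaussianQInv (1 / 2 - 2 * κ)
  have hQρ : gaussianQ ρ = 1 / 2 - 2 * κ := gaussianQ_gaussianQInv (by linarith) (by linarith)
  have hρ : 0 ≤ ρ := by
    rw [← strictAnti_gaussianQ.le_iff_ge, hQρ, gaussianQ_zero]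
    linarith
  have hP0 := abs_le.1 (hP 0)
  rw [gaussianQ_zero] at hP0
  rcases ha.eq_or_lt with rfl | ha
  · simp only [zero_mul, neg_zero, Real.exp_zero, add_zero]
    rw [hQρ, setIntegral_const, smul_eq_mul]
    simp only [ne_eq, OfNat.ofNat_ne_zero, not_false_eq_true, zero_pow, zero_div, Real.exp_zero,
      one_mul, mul_one]
    linarith
  rw [← setIntegral_exp_neg_gaussianReal, setIntegral_exp_neg_eq _ ha, setIntegral_exp_neg_eq _ ha]
  have hi : ∀ (P : Measure ℝ) [IsProbabilityMeasure P] (ρ : ℝ),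
      IntegrableOn (fun t => a * Real.exp (-(a * t)) * P.real (Ioc ρ t)) (Ioi ρ) := by
    intro P _ ρ
    have hmono : Monotone fun t => P.real (Ioc ρ t) :=
      fun x y hxy => measureReal_mono (Ioc_subset_Ioc_right hxy)
    refine (integrableOn_mul_exp_neg ha ρ).mul_bdd (c := 1)
      hmono.measurable.aestronglyMeasurable (ae_of_all _ fun t => ?_)
    rw [Real.norm_of_nonneg measureReal_nonneg]
    exact measureReal_le_one
  have hIoc : ∀ (P : Measure ℝ) [IsProbabilityMeasure P] (s t : ℝ), s ≤ t →
      P.real (Ioc s t) = P.real (Ioi s) - P.real (Ioi t) := by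
    intro P _ s t hst
    rw [← Ioi_sdiff_Ioi, measureReal_sdiff (Ioi_subset_Ioi hst) measurableSet_Ioi]
  calc _ ≤ ∫ t in Ioi ρ, a * Real.exp (-(a * t)) * P.real (Ioc 0 t) := by
        refine setIntegral_mono_on (hi _ ρ) ((hi P 0).mono_set (Ioi_subset_Ioi hρ))
          measurableSet_Ioi fun t ht => ?_
        refine mul_le_mul_of_nonneg_left ?_ (by positivity)
        have ht' : ρ < t := ht
        rw [hIoc _ _ _ ht'.le, hIoc _ _ _ (hρ.trans ht'.le), ← gaussianQ_eq_real,
          ← gaussianQ_eq_real, hQρ]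
        have := abs_le.1 (hP t)
        linarith
    _ ≤ _ := by
        refine setIntegral_mono_set (hi P 0) ?_ (Ioi_subset_Ioi hρ).eventuallyLE
        exact ae_of_all _ fun t => mul_nonneg (by positivity) measureReal_nonneg

/-- Exponential change of measure for the upper tail of an i.i.d. sum, with the Berry-Esseen theorem
applied under the tilted law. -/
lemma le_pi_real_of_tilted {η : Measure ℝ} [IsProbabilityMeasure η] {C : ℝ}
    (hC : IsBerryEsseenBound C) {l : ℝ} (hl : 0 ≤ l)
    (hi : Integrable (fun x => Real.exp (l * x)) η) {T : Measure ℝ}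
    (hT : T = η.tilted fun x => l * x) (i3 : Integrable (fun x : ℝ => |x| ^ 3) T)
    {m s M : ℝ} (hm : m = ∫ x, x ∂T) (hs : s = √(Var[id; T])) (hs0 : 0 < s)
    (hM : M = ∫ x, |x - m| ^ 3 ∂T) {n : ℕ} (hn : 0 < n)
    (hκ : 2 * C * M / (√n * s ^ 3) < 1 / 2) :
    Real.exp (n * l ^ 2 * s ^ 2 / 2) *
        gaussianQ (gaussianQInv (1 / 2 - 2 * C * M / (√n * s ^ 3)) + √n * l * s) *
        Real.exp (-n * (l * m - Real.log (∫ x, Real.exp (l * x) ∂η))) ≤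
      (Measure.pi fun _ : Fin n => η).real {x | n * m < ∑ i, x i} := by
  have hn0 : (0 : ℝ) < n := by exact_mod_cast hn
  have hsn : 0 < √(n : ℝ) := Real.sqrt_pos.2 hn0
  have hsn2 : √(n : ℝ) ^ 2 = n := Real.sq_sqrt hn0.le
  have hTp : IsProbabilityMeasure T := hT ▸ isProbabilityMeasure_tilted hi
  set Z := ∫ x, Real.exp (l * x) ∂η with hZ
  have hZ0 : 0 < Z := integral_exp_pos hi
  have hvar : 0 < Var[id; T] := Real.sqrt_pos.1 (hs ▸ hs0)
  set a := √n * l * s with ha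
  set U : (Fin n → ℝ) → ℝ := fun x => (∑ i, x i - n * m) / (√n * s) with hU
  have hUm : Measurable U := by fun_prop
  set P := (Measure.pi fun _ : Fin n => T).map U with hP
  have hPp : IsProbabilityMeasure P := Measure.isProbabilityMeasure_map hUm.aemeasurable
  have hBE : ∀ t, |P.real (Ioi t) - gaussianQ t| ≤ C * M / (√n * s ^ 3) := by
    intro t
    have h := hC T hTp i3 hvar n hn t
    rw [← hs, ← hm, ← hM] at h
    rw [hP, map_measureReal_apply hUm measurableSet_Ioi]
    have e : U ⁻¹' Ioi t = {x | n * m + t * (√n * s) < ∑ i, x i} := by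
      ext x
      simp only [mem_preimage, mem_Ioi, hU, mem_ofPred_eq]
      rw [lt_div_iff₀ (by positivity)]
      constructor <;> intro h <;> linarith
    rw [e]
    exact h
  have e2 : 2 * C * M / (√n * s ^ 3) = 2 * (C * M / (√n * s ^ 3)) := by ring
  rw [e2] at hκ ⊢
  have hmain := le_setIntegral_exp_neg hκ hBE (a := a) (by positivity)
  have hpi : (Measure.pi fun _ : Fin n => T) = (Measure.pi fun _ : Fin n => η).withDensity
      fun x => ENNReal.ofReal (∏ i, Real.exp (l * x i) / Z) := by
    have := pi_withDensity_ofReal (fun _ : Fin n => η) (f := fun _ x => Real.exp (l * x) / Z)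
      (fun _ x => by positivity) (fun _ => hi.div_const _)
    rw [← this, hT]
    rfl
  have hpre : U ⁻¹' Ioi 0 = {x | n * m < ∑ i, x i} := by
    ext x
    simp only [mem_preimage, mem_Ioi, hU, mem_ofPred_eq]
    rw [lt_div_iff₀ (by positivity), zero_mul, sub_pos]
  have hms : MeasurableSet {x : Fin n → ℝ | n * m < ∑ i, x i} :=
    measurableSet_lt measurable_const (by fun_prop)
  have hint : ∫ x in Ioi 0, Real.exp (-(a * x)) ∂P =
      Real.exp (n * (l * m - Real.log Z)) *
        (Measure.pi fun _ : Fin n => η).real {x | n * m < ∑ i, x i} := by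
    rw [hP, setIntegral_map measurableSet_Ioi (by fun_prop) hUm.aemeasurable, hpre, hpi,
      setIntegral_withDensity_eq_setIntegral_toReal_smul (by fun_prop)
        (ae_of_all _ fun x => ENNReal.ofReal_lt_top) _ hms,
      mul_comm (Real.exp _) (Measure.real _ _), ← smul_eq_mul (Measure.real _ _),
      ← setIntegral_const]
    congr 1
    ext x
    rw [ENNReal.toReal_ofReal (Finset.prod_nonneg fun i _ => by positivity), smul_eq_mul,
      Finset.prod_div_distrib, Finset.prod_const, Finset.card_univ, Fintype.card_fin,
      ← Real.exp_sum, ← Finset.mul_sum]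
    have hZn : Z ^ n = Real.exp (n * Real.log Z) := by
      rw [mul_comm, Real.exp_mul, Real.exp_log hZ0, Real.rpow_natCast]
    rw [hZn, ← Real.exp_sub, ← Real.exp_add]
    congr 1
    simp only [hU, ha]
    field_simp
    ring
  have hE : Real.exp (n * (l * m - Real.log Z)) * Real.exp (-n * (l * m - Real.log Z)) = 1 := by
    rw [← Real.exp_add, neg_mul, add_neg_cancel, Real.exp_zero]
  have ha2 : a ^ 2 / 2 = n * l ^ 2 * s ^ 2 / 2 := by rw [ha, mul_pow, mul_pow, hsn2]
  rw [hint, ha2] at hmain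
  calc _ ≤ (Real.exp (n * (l * m - Real.log Z)) *
        (Measure.pi fun _ : Fin n => η).real {x | n * m < ∑ i, x i}) *
          Real.exp (-n * (l * m - Real.log Z)) :=
        mul_le_mul_of_nonneg_right hmain (Real.exp_pos _).le
    _ = _ := by rw [mul_right_comm, hE, one_mul]

lemma tilted_map {Ω : Type*} [MeasurableSpace Ω] (μ : Measure Ω) {g : Ω → ℝ} (hg : Measurable g)
    {f : ℝ → ℝ} (hf : Measurable f) :
    (μ.tilted fun ω => f (g ω)).map g = (μ.map g).tilted f := by
  ext s hs
  rw [Measure.map_apply hg hs, tilted_apply' _ _ (hg hs), tilted_apply' _ _ hs,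
    setLIntegral_map hs (by fun_prop) hg, integral_map hg.aemeasurable (by fun_prop)]

namespace BinaryChannel

variable {𝓨 : Type*} [MeasurableSpace 𝓨] {μ : Measure 𝓨} (W : BinaryChannel 𝓨 μ)

lemma isProbabilityMeasure_tiltedJoint {l : ℝ} (hl : l ∈ integrableExpSet W.info W.joint) :
    IsProbabilityMeasure (W.tiltedJoint l) :=
  isProbabilityMeasure_tilted hl

lemma tiltedSigma_sq (l : ℝ) : W.tiltedSigma l ^ 2 = Var[W.info; W.tiltedJoint l] :=
  Real.sq_sqrt (variance_nonneg _ _)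

variable {W}

lemma tiltedSigma_pos (hσ : 0 < W.sigmaH) {l : ℝ}
    (hl : l ∈ interior (integrableExpSet W.info W.joint)) : 0 < W.tiltedSigma l := by
  have hl' : l ∈ integrableExpSet W.info W.joint := interior_subset hl
  have hp := W.isProbabilityMeasure_tiltedJoint hl'
  have h2 : MemLp W.info 2 (W.tiltedJoint l) := by
    exact_mod_cast memLp_tilted_mul hl 2
  refine Real.sqrt_pos.2 ((variance_nonneg _ _).lt_of_ne' fun h0 => ?_)
  have h2' : Integrable (fun w => (W.info w - ∫ w, W.info w ∂(W.tiltedJoint l)) ^ 2)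
      (W.tiltedJoint l) := (h2.sub (memLp_const _)).integrable_sq
  rw [variance_eq_integral W.measurable_info.aemeasurable,
    integral_eq_zero_iff_of_nonneg (fun _ => sq_nonneg _) h2'] at h0
  have h1 : ∀ᵐ w ∂W.joint, W.info w = ∫ w, W.info w ∂(W.tiltedJoint l) := by
    refine (absolutelyContinuous_tilted (f := fun w => l * W.info w) hl').ae_le ?_
    filter_upwards [h0] with w hw
    exact sub_eq_zero.1 (pow_eq_zero_iff two_ne_zero |>.1 hw)
  have h3 : Var[W.info; W.joint] = 0 := by
    rw [variance_congr h1, variance_eq_integral aemeasurable_const]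
    simp
  rw [sigmaH, h3, Real.sqrt_zero] at hσ
  exact lt_irrefl 0 hσ

variable (W)

/-- The explicit lower bound on the tail at `δ(l)`. -/
lemma xiLower_mul_exp_le_tailProb {C : ℝ} (hC : IsBerryEsseenBound C) (hσ : 0 < W.sigmaH) {l : ℝ}
    (hl : 0 ≤ l) (hli : l ∈ interior (integrableExpSet W.info W.joint)) {n : ℕ} (hn : 0 < n)
    (hκ : 2 * C * W.tiltedThird l / (√n * W.tiltedSigma l ^ 3) < 1 / 2) :
    W.xiLower C l n * Real.exp (-n * (l * W.tiltedMean l - cgf W.info W.joint l)) ≤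
      W.tailProb n (W.tiltedDelta l) := by
  have hn0 : (0 : ℝ) < n := by exact_mod_cast hn
  have hg := W.measurable_info
  have hT : (W.tiltedJoint l).map W.info = W.infoLaw.tilted fun x => l * x :=
    tilted_map W.joint hg (by fun_prop)
  have hl' : Integrable (fun x => Real.exp (l * x)) W.infoLaw := by
    rw [infoLaw, integrable_map_measure (by fun_prop) hg.aemeasurable]
    exact interior_subset (s := integrableExpSet W.info W.joint) hli
  have i3 : Integrable (fun x : ℝ => |x| ^ 3) ((W.tiltedJoint l).map W.info) := by
    rw [integrable_map_measure (by fun_prop) hg.aemeasurable]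
    have := (memLp_tilted_mul hli 3).integrable_norm_pow (by norm_num)
    simp only [Real.norm_eq_abs] at this
    exact this
  have h := le_pi_real_of_tilted hC hl hl' hT i3 (m := W.tiltedMean l) (s := W.tiltedSigma l)
    (M := W.tiltedThird l) ?_ ?_ (W.tiltedSigma_pos hσ hli) ?_ hn hκ
  · rw [tailProb_eq]
    have e1 : ∫ x, Real.exp (l * x) ∂W.infoLaw = mgf W.info W.joint l := by
      rw [infoLaw, integral_map hg.aemeasurable (by fun_prop)]
      rfl
    have e2 : {z : Fin n → ℝ | W.condEntropy + W.tiltedDelta l < (∑ i, z i) / n} =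
        {z | n * W.tiltedMean l < ∑ i, z i} := by
      ext z
      simp only [mem_ofPred_eq, tiltedDelta]
      rw [lt_div_iff₀ hn0, add_sub_cancel, mul_comm]
    rw [e1] at h
    rw [e2]
    exact h
  · rw [integral_map hg.aemeasurable (by fun_prop)]
    rfl
  · rw [variance_map measurable_id.aemeasurable hg.aemeasurable]
    rfl
  · rw [integral_map hg.aemeasurable (by fun_prop)]
    rfl

/-- `r(δ(l))` is at least the value of the exponent at `l`; the supremum is finite since it is
attained at `l` by convexity of the cumulant generating function. -/
lemma sub_cgf_le_rateFn {l : ℝ} (hl : 0 ≤ l)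
    (hli : l ∈ interior (integrableExpSet W.info W.joint)) :
    l * W.tiltedMean l - cgf W.info W.joint l ≤ W.rateFn (W.tiltedDelta l) := by
  have hl' : l ∈ integrableExpSet W.info W.joint := interior_subset hli
  have hm : W.tiltedMean l = (∫ w, W.info w * Real.exp (l * W.info w) ∂W.joint) /
      mgf W.info W.joint l := by
    rw [← deriv_cgf hli, ← integral_tilted_mul_self hli]
    rfl
  have hmgf : 0 < mgf W.info W.joint l := mgf_pos hl'
  have hmi : ∫ w, W.info w * Real.exp (l * W.info w) ∂W.joint =
      W.tiltedMean l * mgf W.info W.joint l := by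
    rw [hm, div_mul_cancel₀ _ hmgf.ne']
  set m := W.tiltedMean l
  have hδ : W.condEntropy + W.tiltedDelta l = m := by rw [tiltedDelta]; ring
  have hXi : Integrable (fun w => W.info w * Real.exp (l * W.info w)) W.joint := by
    simpa using integrable_pow_mul_exp_of_mem_interior_integrableExpSet hli 1
  rw [rateFn, hδ]
  refine le_csSup ⟨l * m - cgf W.info W.joint l, ?_⟩ ⟨l, ⟨hl, hl'⟩, rfl⟩
  rintro _ ⟨s, ⟨_, hs⟩, rfl⟩
  have key : Real.exp ((s - l) * m) * mgf W.info W.joint l ≤ mgf W.info W.joint s := by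
    have e : Real.exp ((s - l) * m) * mgf W.info W.joint l =
        ∫ w, Real.exp ((s - l) * m) * ((s - l) * (W.info w * Real.exp (l * W.info w)) +
          (1 - (s - l) * m) * Real.exp (l * W.info w)) ∂W.joint := by
      rw [integral_const_mul, integral_add (hXi.const_mul _) (Integrable.const_mul hl' _),
        integral_const_mul, integral_const_mul, hmi]
      simp only [mgf]
      ring
    rw [e]
    refine integral_mono ((((hXi.const_mul _).add (Integrable.const_mul hl' _))).const_mul _) hs
      fun w => ?_
    simp only
    have h1 := Real.add_one_le_exp ((s - l) * (W.info w - m))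
    have h2 : Real.exp (s * W.info w) = Real.exp ((s - l) * m) * (Real.exp (l * W.info w) *
        Real.exp ((s - l) * (W.info w - m))) := by
      rw [← Real.exp_add, ← Real.exp_add]
      congr 1
      ring
    rw [h2]
    refine mul_le_mul_of_nonneg_left ?_ (Real.exp_pos _).le
    have := mul_le_mul_of_nonneg_left h1 (Real.exp_pos (l * W.info w)).le
    linarith
  have h := Real.log_le_log (by positivity) key
  rw [Real.log_mul (Real.exp_pos _).ne' hmgf.ne', Real.log_exp] at h
  simp only [cgf]
  linarith

lemma mem_interior_of_lt_lambdaStar {l : ℝ} (hl : (l : EReal) < W.lambdaStar) :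
    l ∈ interior (integrableExpSet W.info W.joint) := by
  obtain ⟨_, ⟨m, ⟨_, hm⟩, rfl⟩, hlm⟩ := lt_sSup_iff.1 hl
  exact W.mem_interior_integrableExpSet (EReal.coe_lt_coe_iff.1 hlm) hm

lemma errorLevel_le_tailProb_of_eq_xiLower (hσ : 0 < W.sigmaH) {C : ℝ} (hC : berryEsseenConst ≤ C)
    {n : ℕ} {ε δ l : ℝ} (hn : 0 < n) (hl : 0 ≤ l) (hls : (l : EReal) < W.lambdaStar)
    (hδ : W.tiltedDelta l = δ)
    (hκ : 2 * C * W.tiltedThird l / (√n * W.tiltedSigma l ^ 3) < 1 / 2)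
    (h : W.errorLevel n ε = W.xiLower C l n * Real.exp (-n * W.rateFn δ)) :
    W.errorLevel n ε ≤ W.tailProb n δ := by
  have hli := W.mem_interior_of_lt_lambdaStar hls
  rw [h]
  subst hδ
  refine le_trans ?_ (W.xiLower_mul_exp_le_tailProb (isBerryEsseenBound_of_le hC) hσ hl hli hn hκ)
  refine mul_le_mul_of_nonneg_left (Real.exp_le_exp.2 ?_)
    (mul_nonneg (Real.exp_pos _).le (gaussianQ_nonneg _))
  have hn0 : (0 : ℝ) < n := by exact_mod_cast hn
  have := mul_le_mul_of_nonneg_left (W.sub_cgf_le_rateFn hl hli) hn0.le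
  linarith

end BinaryChannel

/-! ### Expansions for small tilts -/

/-- Near a point where it is analytic, a function with second derivative `v` at `0` has the
expected expansions of its first two derivatives and of `l f'(l) - f(l)`. -/
lemma AnalyticAt.exists_expansion {f : ℝ → ℝ} (hf : AnalyticAt ℝ f 0) (h0 : f 0 = 0) :
    ∃ c > 0, ∃ r > 0, ∀ l, 0 ≤ l → l ≤ r →
      |iteratedDeriv 2 f l - iteratedDeriv 2 f 0| ≤ c * l ∧
      deriv f 0 + iteratedDeriv 2 f 0 * l - c * l ^ 2 ≤ deriv f l ∧
      l * deriv f l - f l ≤ iteratedDeriv 2 f 0 * l ^ 2 / 2 + c * l ^ 3 := by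
  have e2 : iteratedDeriv 2 f = deriv (deriv f) := by rw [iteratedDeriv_succ, iteratedDeriv_one]
  rw [e2]
  set v := deriv (deriv f) 0
  have hO := hf.deriv.deriv.differentiableAt.isBigO_sub
  obtain ⟨c, hc0, hc⟩ := hO.exists_pos
  have hev := hc.bound.and (hf.eventually_analyticAt)
  obtain ⟨r, hr, hball⟩ := Metric.eventually_nhds_iff.1 hev
  have hin : ∀ l, 0 ≤ l → l ≤ r / 2 → dist l 0 < r := fun l hl hlr => by
    rw [Real.dist_eq, sub_zero, abs_of_nonneg hl]; linarith
  have h2 : ∀ l, 0 ≤ l → l ≤ r / 2 → |deriv (deriv f) l - v| ≤ c * l := fun l hl hlr => by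
    have := (hball (hin l hl hlr)).1
    rwa [Real.norm_eq_abs, Real.norm_eq_abs, sub_zero, abs_of_nonneg hl] at this
  have hd0 : ∀ l, 0 ≤ l → l ≤ r / 2 → HasDerivAt f (deriv f l) l := fun l hl hlr =>
    (hball (hin l hl hlr)).2.differentiableAt.hasDerivAt
  have hd1 : ∀ l, 0 ≤ l → l ≤ r / 2 → HasDerivAt (deriv f) (deriv (deriv f) l) l :=
    fun l hl hlr => (hball (hin l hl hlr)).2.deriv.differentiableAt.hasDerivAt
  have hmono : ∀ {g g' : ℝ → ℝ}, (∀ l ∈ Icc 0 (r / 2), HasDerivAt g (g' l) l) →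
      (∀ l ∈ Icc 0 (r / 2), 0 ≤ g' l) → ∀ l, 0 ≤ l → l ≤ r / 2 → g 0 ≤ g l := by
    intro g g' hg hg' l hl hlr
    refine monotoneOn_of_deriv_nonneg (convex_Icc 0 (r / 2))
      (fun x hx => (hg x hx).continuousAt.continuousWithinAt)
      (fun x hx => (hg x (interior_subset hx)).differentiableAt.differentiableWithinAt)
      (fun x hx => by
        rw [(hg x (interior_subset hx)).deriv]
        exact hg' x (interior_subset hx)) ⟨le_rfl, by linarith⟩ ⟨hl, hlr⟩ hl
  refine ⟨c, hc0, r / 2, by linarith, fun l hl hlr => ⟨h2 l hl hlr, ?_, ?_⟩⟩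
  · have := hmono (g := fun x => deriv f x - v * x + c * x ^ 2)
      (g' := fun x => deriv (deriv f) x - v + 2 * c * x) (fun x hx => ?_) (fun x hx => ?_) l hl hlr
    · simp only [mul_zero, sub_zero] at this
      nlinarith
    · refine (((hd1 x hx.1 hx.2).sub ((hasDerivAt_id x).const_mul v)).add
        ((hasDerivAt_pow 2 x).const_mul c)).congr_deriv ?_
      push_cast; ring
    · have := (abs_le.1 (h2 x hx.1 hx.2)).1
      have := mul_nonneg hc0.le hx.1
      linarith
  · have := hmono (g := fun x => v * x ^ 2 / 2 + c * x ^ 3 - (x * deriv f x - f x))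
      (g' := fun x => v * x + 3 * c * x ^ 2 - x * deriv (deriv f) x)
      (fun x hx => ?_) (fun x hx => ?_) l hl hlr
    · simp only [h0] at this
      linarith
    · refine (((((hasDerivAt_pow 2 x).const_mul v).div_const 2).add
        ((hasDerivAt_pow 3 x).const_mul c)).sub
        (((hasDerivAt_id x).mul (hd1 x hx.1 hx.2)).sub (hd0 x hx.1 hx.2))).congr_deriv ?_
      push_cast
      simp only [id]
      ring
    · have h3 := (abs_le.1 (h2 x hx.1 hx.2)).2
      have h4 := mul_le_mul_of_nonneg_left h3 hx.1
      have h5 := mul_nonneg hc0.le (sq_nonneg x)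
      nlinarith

lemma exists_gaussianQInv_half_sub_le :
    ∃ K > 0, ∃ r > 0, ∀ κ, 0 ≤ κ → κ ≤ r → 0 ≤ gaussianQInv (1 / 2 - 2 * κ) ∧
      gaussianQInv (1 / 2 - 2 * κ) ≤ K * κ := by
  obtain ⟨K, hK, h⟩ := exists_abs_gaussianQInv_sub_le (q := 1 / 2) (by norm_num) (by norm_num)
  obtain ⟨r, hr, hball⟩ := Metric.eventually_nhds_iff.1 h
  refine ⟨2 * K + 1, by linarith, min (r / 4) (1 / 8), by positivity, fun κ h0 hκ => ⟨?_, ?_⟩⟩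
  · have h1 : gaussianQ (gaussianQInv (1 / 2 - 2 * κ)) = 1 / 2 - 2 * κ :=
      gaussianQ_gaussianQInv (by linarith [min_le_right (r / 4) (1 / 8 : ℝ)]) (by linarith)
    rw [← strictAnti_gaussianQ.le_iff_ge, h1, gaussianQ_zero]
    linarith
  · have h1 : gaussianQInv (1 / 2) = 0 := by rw [← gaussianQ_zero, gaussianQInv_gaussianQ]
    have e : (1 / 2 - 2 * κ) - 1 / 2 = -(2 * κ) := by ring
    have h2 := hball (y := 1 / 2 - 2 * κ) (by
      rw [Real.dist_eq, e, abs_neg, abs_of_nonneg (by linarith)]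
      linarith [min_le_left (r / 4) (1 / 8 : ℝ)])
    rw [h1, sub_zero, e, abs_neg, abs_of_nonneg (by linarith : 0 ≤ 2 * κ)] at h2
    have := le_abs_self (gaussianQInv (1 / 2 - 2 * κ))
    linarith

/-- The error level `e^{-u} / (2 √(π u)) (1 - 1 / (2 u))`, the classical lower bound for
`Q(√(2 u))`. -/
noncomputable def moderateError (u : ℝ) : ℝ :=
  Real.exp (-u) / (2 * √(Real.pi * u)) * (1 - 1 / (2 * u))

lemma moderateError_pos {u : ℝ} (hu : 1 ≤ u) : 0 < moderateError u := by
  have : 1 / (2 * u) < 1 := by rw [div_lt_one (by linarith)]; linarith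
  have hpi := Real.pi_pos
  have h0 : 0 < u := by linarith
  exact mul_pos (by positivity) (by linarith)

lemma moderateError_le_exp {u : ℝ} (hu : 1 ≤ u) : moderateError u ≤ Real.exp (-u) := by
  have h0 : 0 < u := by linarith
  have h1 : 1 ≤ √(Real.pi * u) := by
    rw [Real.one_le_sqrt]
    nlinarith [Real.pi_gt_three]
  have h2 : 0 < 1 / (2 * u) := by positivity
  have h3 : Real.exp (-u) / (2 * √(Real.pi * u)) ≤ Real.exp (-u) :=
    div_le_self (Real.exp_pos _).le (by linarith)
  have h4 : 1 / (2 * u) < 1 := by rw [div_lt_one (by linarith)]; linarith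
  calc moderateError u ≤ Real.exp (-u) * 1 :=
        mul_le_mul h3 (by linarith) (by linarith) (Real.exp_pos _).le
    _ = _ := mul_one _

lemma neg_log_moderateError_le {u : ℝ} (hu : 1 ≤ u) : -Real.log (moderateError u) ≤ 9 * u := by
  have h0 : 0 < u := by linarith
  have hpi := Real.pi_pos
  have h1 : √(Real.pi * u) ≤ 2 * u := by
    rw [Real.sqrt_le_left (by linarith)]
    nlinarith [Real.pi_le_four]
  have h2 : 1 / 2 ≤ 1 - 1 / (2 * u) := by
    have : 1 / (2 * u) ≤ 1 / 2 := by
      apply one_div_le_one_div_of_le <;> linarith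
    linarith
  have h3 : Real.exp (-u) / (8 * u) ≤ moderateError u := by
    calc Real.exp (-u) / (8 * u) = Real.exp (-u) / (2 * (2 * u)) * (1 / 2) := by
          field_simp; norm_num
      _ ≤ _ := by
          unfold moderateError
          gcongr
  have h4 := Real.log_le_log (by positivity) h3
  rw [Real.log_div (Real.exp_pos _).ne' (by positivity), Real.log_exp] at h4
  have h5 := Real.log_le_self (x := 8 * u) (by linarith)
  linarith

lemma moderateError_le_gaussianQ {u : ℝ} (hu : 1 ≤ u) : moderateError u ≤ gaussianQ (√(2 * u)) := by
  have h0 : 0 < u := by linarith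
  have hs : 0 < √(2 * u) := Real.sqrt_pos.2 (by linarith)
  have hs2 : √(2 * u) ^ 2 = 2 * u := Real.sq_sqrt (by linarith)
  refine le_trans (le_of_eq ?_) (le_gaussianQ hs)
  have e1 : 2 * √(Real.pi * u) = √(2 * Real.pi) * √(2 * u) := by
    rw [← Real.sqrt_mul (by positivity), show (2 * Real.pi * (2 * u)) = 2 ^ 2 * (Real.pi * u) by ring,
      Real.sqrt_mul (by positivity : (0 : ℝ) ≤ 2 ^ 2), Real.sqrt_sq (by norm_num)]
  have hp : 0 < √(2 * Real.pi) := Real.sqrt_pos.2 (by positivity)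
  rw [gaussianPDFReal_zero_one, moderateError, e1, show -√(2 * u) ^ 2 / 2 = -u by rw [hs2]; ring,
    show 1 / (2 * u) = 1 / √(2 * u) ^ 2 by rw [hs2]]
  field_simp

namespace BinaryChannel

variable {𝓨 : Type*} [MeasurableSpace 𝓨] {μ : Measure 𝓨} (W : BinaryChannel 𝓨 μ)

lemma tiltedMean_eq_deriv {l : ℝ} (hl : l ∈ interior (integrableExpSet W.info W.joint)) :
    W.tiltedMean l = deriv (cgf W.info W.joint) l :=
  integral_tilted_mul_self hl

lemma tiltedSigma_sq_eq {l : ℝ} (hl : l ∈ interior (integrableExpSet W.info W.joint)) :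
    W.tiltedSigma l ^ 2 = iteratedDeriv 2 (cgf W.info W.joint) l := by
  rw [tiltedSigma_sq]
  exact variance_tilted_mul hl

lemma tiltedJoint_zero : W.tiltedJoint 0 = W.joint := by
  simp [tiltedJoint]

lemma tiltedMean_zero : W.tiltedMean 0 = W.condEntropy := by
  rw [tiltedMean, tiltedJoint_zero, condEntropy]

lemma tiltedSigma_zero : W.tiltedSigma 0 = W.sigmaH := by
  rw [tiltedSigma, tiltedJoint_zero, sigmaH]

/-- The third absolute central moments of the tilted laws are bounded for small tilts. -/
lemma exists_tiltedThird_le : ∃ A > 0, ∀ l, 0 ≤ l → l ≤ 1 / 2 → W.tiltedThird l ≤ A := by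
  have hhalf : (1 / 2 : ℝ) ∈ interior (integrableExpSet W.info W.joint) :=
    W.mem_interior_integrableExpSet (by norm_num) W.one_mem_integrableExpSet
  have hi3 := integrable_pow_mul_exp_of_mem_interior_integrableExpSet hhalf 3
  set A := ∫ w, W.info w ^ 3 * Real.exp (1 / 2 * W.info w) ∂W.joint with hA
  have hA0 : 0 ≤ A := integral_nonneg fun w =>
    mul_nonneg (pow_nonneg (W.info_nonneg w) 3) (Real.exp_pos _).le
  refine ⟨A + (1 + A) ^ 3, by positivity, fun l hl hl2 => ?_⟩
  have hli : l ∈ interior (integrableExpSet W.info W.joint) :=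
    W.mem_interior_integrableExpSet (by linarith) W.one_mem_integrableExpSet
  have hp := W.isProbabilityMeasure_tiltedJoint (interior_subset hli)
  have hX3 : Integrable (fun w => W.info w ^ 3) (W.tiltedJoint l) := by
    have h := (memLp_tilted_mul hli 3).integrable_norm_pow (by norm_num)
    refine Integrable.congr h (ae_of_all _ fun w => ?_)
    simp [abs_of_nonneg (W.info_nonneg w)]
  have hX1 : Integrable W.info (W.tiltedJoint l) :=
    memLp_one_iff_integrable.1 (by exact_mod_cast memLp_tilted_mul hli 1)
  have hmgf : 1 ≤ mgf W.info W.joint l := by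
    have : ∫ w, (1 : ℝ) ∂W.joint ≤ mgf W.info W.joint l :=
      integral_mono (integrable_const _) (interior_subset (s := integrableExpSet W.info W.joint) hli)
        fun w => Real.one_le_exp (mul_nonneg hl (W.info_nonneg w))
    simpa using this
  have hE3 : ∫ w, W.info w ^ 3 ∂(W.tiltedJoint l) ≤ A := by
    rw [tiltedJoint, integral_tilted_mul_eq_mgf]
    refine integral_mono_of_nonneg (ae_of_all _ fun w => ?_) hi3 (ae_of_all _ fun w => ?_)
    · exact smul_nonneg (by positivity) (pow_nonneg (W.info_nonneg w) 3)
    · simp only [smul_eq_mul]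
      rw [mul_comm]
      refine mul_le_mul_of_nonneg_left ?_ (pow_nonneg (W.info_nonneg w) 3)
      refine (div_le_self (Real.exp_pos _).le hmgf).trans (Real.exp_le_exp.2 ?_)
      exact mul_le_mul_of_nonneg_right hl2 (W.info_nonneg w)
  have hm0 : 0 ≤ W.tiltedMean l := integral_nonneg W.info_nonneg
  have hm1 : W.tiltedMean l ≤ 1 + A := by
    calc W.tiltedMean l ≤ ∫ w, (1 + W.info w ^ 3) ∂(W.tiltedJoint l) := by
          refine integral_mono hX1 ((integrable_const _).add hX3) fun w => ?_
          have := W.info_nonneg w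
          simp only
          nlinarith [mul_nonneg this (sq_nonneg (W.info w - 1)), sq_nonneg (W.info w - 1)]
      _ ≤ 1 + A := by
          rw [integral_add (integrable_const _) hX3, integral_const, probReal_univ, one_smul]
          linarith
  calc W.tiltedThird l ≤ ∫ w, (W.info w ^ 3 + W.tiltedMean l ^ 3) ∂(W.tiltedJoint l) := by
        refine integral_mono_of_nonneg (ae_of_all _ fun w => by positivity)
          (hX3.add (integrable_const _)) (ae_of_all _ fun w => ?_)
        have hx := W.info_nonneg w
        simp only
        rcases abs_cases (W.info w - W.tiltedMean l) with ⟨h, _⟩ | ⟨h, _⟩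
        · rw [h]
          have : (W.info w - W.tiltedMean l) ^ 3 ≤ W.info w ^ 3 :=
            pow_le_pow_left₀ (by linarith) (by linarith) 3
          have := pow_nonneg hm0 3
          linarith
        · rw [h]
          have : (-(W.info w - W.tiltedMean l)) ^ 3 ≤ W.tiltedMean l ^ 3 :=
            pow_le_pow_left₀ (by linarith) (by linarith) 3
          have := pow_nonneg hx 3
          linarith
    _ = ∫ w, W.info w ^ 3 ∂(W.tiltedJoint l) + W.tiltedMean l ^ 3 := by
        rw [integral_add hX3 (integrable_const _), integral_const, probReal_univ, one_smul]
    _ ≤ _ := add_le_add hE3 (pow_le_pow_left₀ hm0 hm1 3)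

/-- Expansion of the tilted quantities for small tilts. -/
lemma exists_tilted_expansion (hσ : 0 < W.sigmaH) : ∃ c > 0, ∃ r > 0, ∀ l, 0 ≤ l → l ≤ r →
    l ∈ interior (integrableExpSet W.info W.joint) ∧
    W.sigmaH ^ 2 * l - c * l ^ 2 ≤ W.tiltedDelta l ∧
    l * W.tiltedMean l - cgf W.info W.joint l ≤ W.sigmaH ^ 2 * l ^ 2 / 2 + c * l ^ 3 ∧
    W.tiltedSigma l ≤ W.sigmaH + c * l ∧ W.sigmaH / 2 ≤ W.tiltedSigma l ∧
    W.tiltedThird l ≤ c := by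
  obtain ⟨c, hc, r, hr, h⟩ := (analyticAt_cgf W.zero_mem_interior_integrableExpSet).exists_expansion
    (by simp)
  obtain ⟨A, hA, hthird⟩ := W.exists_tiltedThird_le
  set σ := W.sigmaH with hσdef
  refine ⟨c + c / σ + A, by positivity, min (min r (1 / 2)) (σ ^ 2 / (2 * c)), by positivity,
    fun l hl hlr => ?_⟩
  have hl1 : l ≤ r := hlr.trans ((min_le_left _ _).trans (min_le_left _ _))
  have hl2 : l ≤ 1 / 2 := hlr.trans ((min_le_left _ _).trans (min_le_right _ _))
  have hl3 : c * l ≤ σ ^ 2 / 2 := by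
    have := hlr.trans (min_le_right _ _)
    rw [le_div_iff₀ (by positivity)] at this
    linarith
  have hli : l ∈ interior (integrableExpSet W.info W.joint) :=
    W.mem_interior_integrableExpSet (by linarith) W.one_mem_integrableExpSet
  obtain ⟨h1, h2, h3⟩ := h l hl hl1
  rw [← W.tiltedSigma_sq_eq hli, ← W.tiltedSigma_sq_eq W.zero_mem_interior_integrableExpSet,
    tiltedSigma_zero] at h1
  rw [← W.tiltedSigma_sq_eq W.zero_mem_interior_integrableExpSet, ← W.tiltedMean_eq_deriv hli,
    ← W.tiltedMean_eq_deriv W.zero_mem_interior_integrableExpSet, tiltedSigma_zero,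
    tiltedMean_zero] at h2
  rw [← W.tiltedSigma_sq_eq W.zero_mem_interior_integrableExpSet, ← W.tiltedMean_eq_deriv hli,
    tiltedSigma_zero] at h3
  rw [← hσdef] at h1 h2 h3
  have hs0 : 0 ≤ W.tiltedSigma l := Real.sqrt_nonneg _
  have hcσ : 0 < c / σ := by positivity
  have hcσ2 : c / σ * σ = c := div_mul_cancel₀ _ hσ.ne'
  have h1' := abs_le.1 h1
  refine ⟨hli, ?_, ?_, ?_, ?_, ?_⟩
  · rw [tiltedDelta]
    have : 0 ≤ (c / σ + A) * l ^ 2 := by positivity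
    linarith
  · have : 0 ≤ (c / σ + A) * l ^ 3 := by positivity
    linarith
  · have hle : W.tiltedSigma l ≤ σ + c / σ * l := by
      refine (sq_le_sq₀ hs0 (by positivity)).1 ?_
      have e : (σ + c / σ * l) ^ 2 = σ ^ 2 + 2 * (c / σ * σ) * l + (c / σ * l) ^ 2 := by ring
      rw [e, hcσ2]
      nlinarith [sq_nonneg (c / σ * l), mul_nonneg hc.le hl]
    have : 0 ≤ (c + A) * l := by positivity
    linarith
  · refine (sq_le_sq₀ (by positivity) hs0).1 ?_
    nlinarith
  · have := hthird l hl hl2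
    linarith

end BinaryChannel

/-! ### The converse for moderate deviations -/

namespace BinaryChannel

variable {𝓨 : Type*} [MeasurableSpace 𝓨] {μ : Measure 𝓨} (W : BinaryChannel 𝓨 μ)

lemma sqrt_neg_two_log_moderateError_le {u : ℝ} (hu : 1 ≤ u) {n : ℕ} (hn : 0 < n) :
    √(-2 * Real.log (moderateError u) / n) ≤ 5 * √(u / n) := by
  have hn0 : (0 : ℝ) < n := by exact_mod_cast hn
  have h := neg_log_moderateError_le hu
  rw [show (5 : ℝ) = √(5 ^ 2) by rw [Real.sqrt_sq (by norm_num)], ← Real.sqrt_mul (by norm_num),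
    ← mul_div_assoc]
  exact Real.sqrt_le_sqrt (div_le_div_of_nonneg_right (by linarith) hn0.le)

/-- A comparison of Gaussian tails through the monotonicity of the Mills ratio. -/
lemma exp_mul_moderateError_le {u ρ a : ℝ} (hu : 1 ≤ u) (hρ : 0 ≤ ρ) (ha : 0 ≤ a)
    (h : ρ + a ≤ √(2 * u)) :
    Real.exp (u - ρ * √(2 * u)) * moderateError u ≤
      Real.exp (a ^ 2 / 2) * gaussianQ (ρ + a) := by
  have hs2 : √(2 * u) ^ 2 = 2 * u := Real.sq_sqrt (by linarith)
  have h1 := antitone_exp_mul_gaussianQ h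
  simp only [hs2] at h1
  have h2 := moderateError_le_gaussianQ hu
  have h3 : Real.exp (a ^ 2 / 2) * gaussianQ (ρ + a) =
      Real.exp (a ^ 2 / 2 - (ρ + a) ^ 2 / 2) *
        (Real.exp ((ρ + a) ^ 2 / 2) * gaussianQ (ρ + a)) := by
    rw [← mul_assoc, ← Real.exp_add]
    congr 2
    ring
  have hρa := mul_le_mul_of_nonneg_left h hρ
  have hρa0 := mul_nonneg hρ ha
  calc Real.exp (u - ρ * √(2 * u)) * moderateError u
      = Real.exp (-(ρ * √(2 * u))) * (Real.exp (2 * u / 2) * moderateError u) := by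
        rw [← mul_assoc, ← Real.exp_add]; congr 2; ring
    _ ≤ Real.exp (a ^ 2 / 2 - (ρ + a) ^ 2 / 2) * (Real.exp (2 * u / 2) * gaussianQ (√(2 * u))) := by
        refine mul_le_mul (Real.exp_le_exp.2 ?_) (mul_le_mul_of_nonneg_left h2 (Real.exp_pos _).le)
          (mul_nonneg (Real.exp_pos _).le (moderateError_pos hu).le) (Real.exp_pos _).le
        nlinarith [sq_nonneg ρ]
    _ ≤ Real.exp (a ^ 2 / 2 - (ρ + a) ^ 2 / 2) *
        (Real.exp ((ρ + a) ^ 2 / 2) * gaussianQ (ρ + a)) :=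
        mul_le_mul_of_nonneg_left h1 (Real.exp_pos _).le
    _ = _ := h3.symm

/-- The tilt `l = √2 t / σ - K₁ t²` and the resulting bounds. -/
lemma exists_tilt_bounds {σ c K₁ t : ℝ} (hσ : 0 < σ) (hc : 0 < c) (hK₁ : 0 < K₁) (ht : 0 < t)
    (htK : K₁ * σ * t ≤ 1) : ∃ l, 0 ≤ l ∧ l ≤ 2 * t / σ ∧ σ * l = √2 * t - K₁ * σ * t ^ 2 ∧
      c * l ^ 2 ≤ 4 * c / σ ^ 2 * t ^ 2 ∧ c * l ^ 3 ≤ 8 * c / σ ^ 3 * t ^ 3 ∧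
      σ ^ 2 * l ^ 2 / 2 ≤ t ^ 2 - K₁ * σ / 2 * t ^ 3 := by
  have hsq2 : (1 : ℝ) ≤ √2 := by rw [Real.one_le_sqrt]; norm_num
  have hsq2' : √2 ≤ (2 : ℝ) := by rw [Real.sqrt_le_left (by norm_num)]; norm_num
  have hsq22 : √2 ^ 2 = (2 : ℝ) := Real.sq_sqrt (by norm_num)
  have hσl : σ * (√2 * t / σ - K₁ * t ^ 2) = √2 * t - K₁ * σ * t ^ 2 := by field_simp
  have hKt : K₁ * σ * t ^ 2 ≤ t := by
    have := mul_le_mul_of_nonneg_right htK ht.le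
    linarith
  have hKt0 : 0 ≤ K₁ * σ * t ^ 2 := by positivity
  have ht1 := mul_le_mul_of_nonneg_right hsq2 ht.le
  have ht2 := mul_le_mul_of_nonneg_right hsq2' ht.le
  have hl0 : 0 ≤ √2 * t / σ - K₁ * t ^ 2 :=
    nonneg_of_mul_nonneg_right (by rw [hσl]; linarith) hσ
  have hl2 : √2 * t / σ - K₁ * t ^ 2 ≤ 2 * t / σ := by
    rw [le_div_iff₀ hσ, mul_comm, hσl]
    linarith
  generalize √2 * t / σ - K₁ * t ^ 2 = l at *
  refine ⟨l, hl0, hl2, hσl, ?_, ?_, ?_⟩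
  · calc c * l ^ 2 ≤ c * (2 * t / σ) ^ 2 := by gcongr
      _ = _ := by ring
  · calc c * l ^ 3 ≤ c * (2 * t / σ) ^ 3 := by gcongr
      _ = _ := by ring
  · rw [← mul_pow, hσl]
    have h3 : (√2 * t - K₁ * σ * t ^ 2) ^ 2 = 2 * t ^ 2 - 2 * √2 * (K₁ * σ * t ^ 3) +
        (K₁ * σ * t) * (K₁ * σ * t ^ 3) := by
      rw [sub_sq, mul_pow, hsq22]; ring
    have h4 : 0 ≤ K₁ * σ * t ^ 3 := by positivity
    have h5 := mul_le_mul_of_nonneg_right htK h4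
    have h6 := mul_le_mul_of_nonneg_right hsq2 h4
    rw [h3]
    linarith

lemma sqrt_two_mul_eq {n u : ℝ} (hn : 0 < n) : √(2 * u) = √n * (√2 * √(u / n)) := by
  rw [← Real.sqrt_mul (by norm_num), ← Real.sqrt_mul hn.le]
  congr 1
  field_simp

/-- The argument of the Gaussian tail stays below `√(2 u)`. -/
lemma add_sqrt_mul_le {σ c c₃ K₁ n u t l s ρ : ℝ} (hn : 0 < n) (hu : 1 ≤ u) (ht : t = √(u / n))
    (hc₃ : 0 ≤ c₃) (hK₁ : 4 * c / σ ^ 2 + c₃ ≤ K₁ * σ) (hl0 : 0 ≤ l)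
    (hσl : σ * l = √2 * t - K₁ * σ * t ^ 2) (hl2 : c * l ^ 2 ≤ 4 * c / σ ^ 2 * t ^ 2)
    (hs : s ≤ σ + c * l) (hρ : ρ ≤ c₃ * (√n)⁻¹) : ρ + √n * l * s ≤ √(2 * u) := by
  have hsn : 0 < √n := Real.sqrt_pos.2 hn
  have hnt : n * t ^ 2 = u := by
    rw [ht, Real.sq_sqrt (by positivity)]
    field_simp
  have h1 : l * s ≤ √2 * t - K₁ * σ * t ^ 2 + 4 * c / σ ^ 2 * t ^ 2 := by
    calc l * s ≤ l * (σ + c * l) := mul_le_mul_of_nonneg_left hs hl0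
      _ = σ * l + c * l ^ 2 := by ring
      _ ≤ _ := by rw [hσl]; linarith
  have h2 : c₃ * (√n)⁻¹ ≤ √n * (c₃ * t ^ 2) := by
    have : (√n)⁻¹ ≤ √n * t ^ 2 := by
      rw [inv_le_iff_one_le_mul₀ hsn, mul_right_comm, ← pow_two, Real.sq_sqrt hn.le, hnt]
      exact hu
    calc _ ≤ c₃ * (√n * t ^ 2) := mul_le_mul_of_nonneg_left this hc₃
      _ = _ := by ring
  rw [sqrt_two_mul_eq hn, ← ht]
  calc ρ + √n * l * s ≤ √n * (c₃ * t ^ 2) +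
        √n * (√2 * t - K₁ * σ * t ^ 2 + 4 * c / σ ^ 2 * t ^ 2) := by
        rw [mul_assoc]
        exact add_le_add (hρ.trans h2) (mul_le_mul_of_nonneg_left h1 hsn.le)
    _ = √n * (√2 * t - (K₁ * σ - (4 * c / σ ^ 2 + c₃)) * t ^ 2) := by ring
    _ ≤ √n * (√2 * t) := by
        refine mul_le_mul_of_nonneg_left ?_ hsn.le
        have := mul_nonneg (sub_nonneg.2 hK₁) (sq_nonneg t)
        linarith

/-- The exponent gained from `K₁` absorbs all corrections of relative order `t`. -/
lemma mul_le_exponent {σ c c₃ K₁ n u t l R ρ : ℝ} (hσ : 0 < σ) (hn : 0 < n) (hu : 1 ≤ u)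
    (ht : t = √(u / n)) (hc₃ : 0 ≤ c₃)
    (hK₁ : 2 * c₃ + 10 / σ ≤ K₁ * σ / 2 - 8 * c / σ ^ 3)
    (hl3 : c * l ^ 3 ≤ 8 * c / σ ^ 3 * t ^ 3)
    (hlσ : σ ^ 2 * l ^ 2 / 2 ≤ t ^ 2 - K₁ * σ / 2 * t ^ 3)
    (hR : R ≤ σ ^ 2 * l ^ 2 / 2 + c * l ^ 3) (hρ : ρ ≤ c₃ * (√n)⁻¹) :
    10 / σ * t ≤ (u - ρ * √(2 * u)) + -n * R := by
  have hsn : 0 < √n := Real.sqrt_pos.2 hn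
  have hu0 : 0 < u := by linarith
  have ht0 : 0 < t := ht ▸ Real.sqrt_pos.2 (by positivity)
  have hnt : n * t ^ 2 = u := by
    rw [ht, Real.sq_sqrt (by positivity)]
    field_simp
  have hsq2' : √2 ≤ (2 : ℝ) := by rw [Real.sqrt_le_left (by norm_num)]; norm_num
  have hρa : ρ * √(2 * u) ≤ 2 * c₃ * t := by
    calc ρ * √(2 * u) ≤ c₃ * (√n)⁻¹ * (√n * (2 * t)) := by
          rw [sqrt_two_mul_eq hn, ← ht]; gcongr
      _ = 2 * c₃ * t := by field_simp
  have h2 : n * R ≤ u - n * t ^ 3 * (K₁ * σ / 2 - 8 * c / σ ^ 3) := by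
    calc _ ≤ n * (t ^ 2 - K₁ * σ / 2 * t ^ 3 + 8 * c / σ ^ 3 * t ^ 3) :=
          mul_le_mul_of_nonneg_left (by linarith) hn.le
      _ = n * t ^ 2 - n * t ^ 3 * (K₁ * σ / 2 - 8 * c / σ ^ 3) := by ring
      _ = _ := by rw [hnt]
  have h4 : t ≤ n * t ^ 3 := by
    have : n * t ^ 3 = u * t := by rw [← hnt]; ring
    rw [this]
    exact le_mul_of_one_le_left ht0.le hu
  have h5 : t * (2 * c₃ + 10 / σ) ≤ n * t ^ 3 * (K₁ * σ / 2 - 8 * c / σ ^ 3) :=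
    mul_le_mul h4 hK₁ (by positivity) (by positivity)
  linarith

lemma errorLevel_moderateError_le (hσ : 0 < W.sigmaH) {u : ℝ} (hu : 1 ≤ u) {n : ℕ} (hn : 0 < n) :
    W.errorLevel n (moderateError u) ≤
      Real.exp (10 / W.sigmaH * √(u / n)) * moderateError u := by
  rw [errorLevel]
  refine mul_le_mul_of_nonneg_right ?_ (moderateError_pos hu).le
  have h1 := sqrt_neg_two_log_moderateError_le hu hn
  have h2 := Real.add_one_le_exp (10 / W.sigmaH * √(u / n))
  have h3 : 2 / W.sigmaH * √(-2 * Real.log (moderateError u) / n) ≤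
      2 / W.sigmaH * (5 * √(u / n)) := mul_le_mul_of_nonneg_left h1 (by positivity)
  have h4 : 2 / W.sigmaH * (5 * √(u / n)) = 10 / W.sigmaH * √(u / n) := by ring
  linarith

/-- Moderate deviations: the tilt is `l = √2 t / σ - K₁ t²`, `t = √(u / n)`, where `K₁` is large
enough for the gain `n K₁ σ t³ / 2` in the exponent to outweigh every correction of relative order
`t`. -/
lemma exists_errorLevel_le_tailProb (hσ : 0 < W.sigmaH) : ∃ K > 0, ∃ r > 0, ∀ (n : ℕ) (u : ℝ),
    0 < n → 1 ≤ u → √(u / n) ≤ r → ∃ δ,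
      √2 * W.sigmaH * √(u / n) - K * (u / n) ≤ δ ∧
      W.errorLevel n (moderateError u) ≤ W.tailProb n δ := by
  obtain ⟨c, hc, r₁, hr₁, hexp⟩ := W.exists_tilted_expansion hσ
  obtain ⟨KQ, hKQ, r₂, hr₂, hQ⟩ := exists_gaussianQInv_half_sub_le
  have hBE := isBerryEsseenBound_of_le le_rfl
  have hB0 := berryEsseenConst_nonneg
  generalize berryEsseenConst = B at hBE hB0
  have hlevel := @errorLevel_moderateError_le _ _ _ W hσ
  have hxi := fun (l : ℝ) (hl : 0 ≤ l) hli => @xiLower_mul_exp_le_tailProb _ _ _ W B hBE hσ l hl hli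
  generalize hσdef : W.sigmaH = σ at *
  obtain ⟨c₂, hc₂⟩ : ∃ c₂, c₂ = 8 * B * c / σ ^ 3 := ⟨_, rfl⟩
  have hc₂0 : 0 ≤ c₂ := by rw [hc₂]; positivity
  have hc₃0 : 0 ≤ KQ * c₂ := by positivity
  obtain ⟨c₃, hc₃⟩ : ∃ c₃, c₃ = KQ * c₂ := ⟨_, rfl⟩
  rw [← hc₃] at hc₃0
  obtain ⟨K₁, hK₁⟩ : ∃ K₁, K₁ =
      (4 * c / σ ^ 2 + c₃) / σ + 2 * (8 * c / σ ^ 3 + 2 * c₃ + 10 / σ) / σ := ⟨_, rfl⟩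
  have hK₁0 : 0 < K₁ := by rw [hK₁]; positivity
  have hK₁σ : K₁ * σ = (4 * c / σ ^ 2 + c₃) + 2 * (8 * c / σ ^ 3 + 2 * c₃ + 10 / σ) := by
    rw [hK₁]; field_simp
  have hK₁a : 4 * c / σ ^ 2 + c₃ ≤ K₁ * σ := by
    have : 0 ≤ 2 * (8 * c / σ ^ 3 + 2 * c₃ + 10 / σ) := by positivity
    linarith
  have hK₁b : 2 * c₃ + 10 / σ ≤ K₁ * σ / 2 - 8 * c / σ ^ 3 := by
    have : 0 ≤ 4 * c / σ ^ 2 + c₃ := by positivity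
    linarith
  clear hK₁ hK₁σ
  refine ⟨K₁ * σ ^ 2 + 4 * c / σ ^ 2, by positivity,
    min (min (r₁ * σ / 2) (1 / (K₁ * σ))) (min (r₂ / (c₂ + 1)) (1 / (5 * (c₂ + 1)))),
    by positivity, fun n u hn hu hr => ?_⟩
  have hn0 : (0 : ℝ) < n := by exact_mod_cast hn
  have hsn : 0 < √(n : ℝ) := Real.sqrt_pos.2 hn0
  have hsn2 : √(n : ℝ) ^ 2 = n := Real.sq_sqrt hn0.le
  have hu0 : 0 < u := by linarith
  obtain ⟨t, ht⟩ : ∃ t, t = √(u / n) := ⟨_, rfl⟩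
  have ht2 : t ^ 2 = u / n := by rw [ht, Real.sq_sqrt (by positivity)]
  have ht0 : 0 < t := ht ▸ Real.sqrt_pos.2 (by positivity)
  have hinv : (√(n : ℝ))⁻¹ ≤ t := by
    rw [ht, ← Real.sqrt_inv, inv_eq_one_div]
    exact Real.sqrt_le_sqrt (div_le_div_of_nonneg_right hu hn0.le)
  specialize hlevel hu hn
  rw [← ht] at hr hlevel ⊢
  have htr₁ : t ≤ r₁ * σ / 2 := hr.trans ((min_le_left _ _).trans (min_le_left _ _))
  have htK : K₁ * σ * t ≤ 1 := by
    have := hr.trans ((min_le_left _ _).trans (min_le_right _ _))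
    rwa [le_div_iff₀ (by positivity), mul_comm] at this
  have htr₂ : c₂ * t ≤ r₂ := by
    have := hr.trans ((min_le_right _ _).trans (min_le_left _ _))
    rw [le_div_iff₀ (by positivity)] at this
    linarith
  have ht5 : c₂ * t ≤ 1 / 5 := by
    have := hr.trans ((min_le_right _ _).trans (min_le_right _ _))
    rw [le_div_iff₀ (by positivity)] at this
    linarith
  clear hr
  obtain ⟨l, hl0, hl2, hσl, hl2sq, hl3, hlσ⟩ := exists_tilt_bounds hσ hc hK₁0 ht0 htK
  have hlr : l ≤ r₁ := hl2.trans (by rw [div_le_iff₀ hσ]; linarith)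
  obtain ⟨hli, hδ, hrate, hsu, hsl, hM⟩ := hexp l hl0 hlr
  have hs0 : 0 < W.tiltedSigma l := by linarith
  refine ⟨W.tiltedDelta l, ?_, ?_⟩
  · rw [← ht2]
    have : σ ^ 2 * l = √2 * σ * t - K₁ * σ ^ 2 * t ^ 2 := by
      rw [pow_two, mul_assoc, hσl]; ring
    linarith
  -- `κ` bounds the Berry-Esseen error under the tilted law.
  obtain ⟨κ, hκ⟩ : ∃ κ, κ = B * W.tiltedThird l / (√n * W.tiltedSigma l ^ 3) := ⟨_, rfl⟩
  have hthird0 : 0 ≤ W.tiltedThird l := integral_nonneg fun _ => by positivity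
  have hκ0 : 0 ≤ κ := by rw [hκ]; positivity
  have hκle : κ ≤ c₂ * (√n)⁻¹ := by
    calc κ ≤ B * c / (√n * (σ / 2) ^ 3) := by rw [hκ]; gcongr
      _ = c₂ * (√n)⁻¹ := by rw [hc₂]; field_simp; norm_num
  have hκt : κ ≤ c₂ * t := hκle.trans (mul_le_mul_of_nonneg_left hinv hc₂0)
  have e2 : 2 * B * W.tiltedThird l / (√n * W.tiltedSigma l ^ 3) = 2 * κ := by rw [hκ]; ring
  have hmain := hxi l hl0 hli hn (by rw [e2]; linarith)
  refine le_trans ?_ hmain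
  obtain ⟨hρ0, hρ⟩ := hQ κ hκ0 (hκt.trans htr₂)
  have hρn : gaussianQInv (1 / 2 - 2 * κ) ≤ c₃ * (√n)⁻¹ := by
    calc _ ≤ KQ * κ := hρ
      _ ≤ KQ * (c₂ * (√n)⁻¹) := mul_le_mul_of_nonneg_left hκle hKQ.le
      _ = _ := by rw [hc₃]; ring
  have e3 : (n : ℝ) * l ^ 2 * W.tiltedSigma l ^ 2 / 2 = (√n * l * W.tiltedSigma l) ^ 2 / 2 := by
    rw [mul_pow, mul_pow, hsn2]
  rw [xiLower, e2, e3]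
  have hsum := add_sqrt_mul_le hn0 hu ht hc₃0 hK₁a hl0 hσl hl2sq hsu hρn
  have hmills := exp_mul_moderateError_le hu hρ0 (by positivity) hsum
  have hexpo := mul_le_exponent hσ hn0 hu ht hc₃0 hK₁b hl3 hlσ hrate hρn
  calc _ ≤ Real.exp (10 / σ * t) * moderateError u := hlevel
    _ ≤ Real.exp ((u - gaussianQInv (1 / 2 - 2 * κ) * √(2 * u)) +
        -n * (l * W.tiltedMean l - cgf W.info W.joint l)) * moderateError u :=
        mul_le_mul_of_nonneg_right (Real.exp_le_exp.2 hexpo) (moderateError_pos hu).le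
    _ = (Real.exp (u - gaussianQInv (1 / 2 - 2 * κ) * √(2 * u)) * moderateError u) *
        Real.exp (-n * (l * W.tiltedMean l - cgf W.info W.joint l)) := by
        rw [Real.exp_add]; ring
    _ ≤ _ := mul_le_mul_of_nonneg_right hmills (Real.exp_pos _).le

lemma mirrorProb_le_one (n : ℕ) (δ : ℝ) : W.mirrorProb n δ ≤ 1 := measureReal_le_one

lemma log_mirrorProb_nonpos (n : ℕ) (δ : ℝ) : Real.log (W.mirrorProb n δ) ≤ 0 :=
  Real.log_nonpos measureReal_nonneg (W.mirrorProb_le_one n δ)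

variable {W}

/-- The converse in the moderate deviations regime, uniformly in the exponent `u`. -/
theorem IsSymmetric.exists_rate_le_moderate (hsymm : W.IsSymmetric) (hσ : 0 < W.sigmaH) (K₀ : ℝ) :
    ∃ (K r : ℝ), 0 < r ∧ ∀ (n : ℕ) (u : ℝ), 0 < n → 1 ≤ u → √(u / n) ≤ r →
      Real.log n ≤ K₀ * u → ∀ c : ChannelCode 𝓨 n, c.avgError W ≤ moderateError u →
        c.rate ≤ W.capacity - √2 * W.sigmaH * √(u / n) + K * (u / n) := by
  obtain ⟨K, hK, r, hr, h⟩ := W.exists_errorLevel_le_tailProb hσ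
  set σ := W.sigmaH with hσdef
  refine ⟨K + 9 + (K₀ + σ ^ 2) + 5 * r / σ, r, hr, fun n u hn hu hur hlog c hc => ?_⟩
  have hn0 : (0 : ℝ) < n := by exact_mod_cast hn
  have hu0 : 0 < u := by linarith
  obtain ⟨δ, hδ, hδ2⟩ := h n u hn hu hur
  have hε := moderateError_pos hu
  have hε1 : moderateError u < 1 := (moderateError_le_exp hu).trans_lt
    (by rw [Real.exp_lt_one_iff]; linarith)
  refine (hsymm.rate_le_converseBound hσ hn hε hε1 hδ2 c hc).trans ?_
  rw [converseBound, ← hσdef]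
  have h1 := neg_log_moderateError_le hu
  have h2 := W.log_mirrorProb_nonpos n δ
  have h3 : -(Real.log n + σ ^ 2) ≤ Real.log (-2 * Real.log (moderateError u) / (σ ^ 2 * n)) := by
    have h5 : 1 ≤ -2 * Real.log (moderateError u) := by
      have := Real.log_le_log hε (moderateError_le_exp hu)
      rw [Real.log_exp] at this
      linarith
    have h6 : (σ ^ 2 * n)⁻¹ ≤ -2 * Real.log (moderateError u) / (σ ^ 2 * n) := by
      rw [inv_eq_one_div]; gcongr
    have h7 := Real.log_le_log (by positivity) h6
    rw [Real.log_inv, Real.log_mul (by positivity) hn0.ne'] at h7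
    have := Real.log_le_self (sq_nonneg σ)
    linarith
  have h4 : Real.log (1 + √(-2 * Real.log (moderateError u) / n) / σ) ≤ 5 * r / σ := by
    have h5 : √(-2 * Real.log (moderateError u) / n) / σ ≤ 5 * r / σ := by
      gcongr
      exact (sqrt_neg_two_log_moderateError_le hu hn).trans (by linarith)
    have h6 : 0 ≤ √(-2 * Real.log (moderateError u) / n) / σ := by positivity
    have := Real.log_le_sub_one_of_pos
      (by linarith : 0 < 1 + √(-2 * Real.log (moderateError u) / n) / σ)
    linarith
  have h5 : 5 * r / σ ≤ 5 * r / σ * u := le_mul_of_one_le_right (by positivity) hu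
  have h6 : σ ^ 2 ≤ σ ^ 2 * u := le_mul_of_one_le_right (by positivity) hu
  have h7 : -((9 + (K₀ + σ ^ 2) + 5 * r / σ) * (u / n)) ≤ (Real.log (moderateError u) -
      Real.log (W.mirrorProb n δ) + Real.log (-2 * Real.log (moderateError u) / (σ ^ 2 * n))
      - Real.log (1 + √(-2 * Real.log (moderateError u) / n) / σ)) / n := by
    rw [← mul_div_assoc, ← neg_div]
    gcongr
    linarith
  linarith

end BinaryChannel

/-! ### Consequences in the three error regimes -/

namespace BinaryChannel

variable {𝓨 : Type*} [MeasurableSpace 𝓨] {μ : Measure 𝓨} {W : BinaryChannel 𝓨 μ}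

lemma IsSymmetric.exists_rate_le_rpow (hsymm : W.IsSymmetric) (hσ : 0 < W.sigmaH) {α : ℝ}
    (hα : 0 < α) (hα1 : α < 1) : ∃ (K : ℝ) (N : ℕ), ∀ n : ℕ, N ≤ n → ∀ c : ChannelCode 𝓨 n,
      c.avgError W ≤ moderateError ((n : ℝ) ^ α) →
      c.rate ≤ W.capacity - √2 * W.sigmaH * (n : ℝ) ^ (-(1 - α) / 2)
        + K * (n : ℝ) ^ (-(1 - α)) := by
  obtain ⟨K, r, hr, h⟩ := hsymm.exists_rate_le_moderate hσ (1 / α)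
  have htend : Tendsto (fun n : ℕ => (n : ℝ) ^ (-((1 - α) / 2))) atTop (𝓝 0) :=
    (tendsto_rpow_neg_atTop (by linarith)).comp tendsto_natCast_atTop_atTop
  obtain ⟨N, hN⟩ := eventually_atTop.1
    ((htend.eventually (ge_mem_nhds hr)).and (eventually_gt_atTop 0))
  refine ⟨K, N, fun n hn c hc => ?_⟩
  obtain ⟨h1, hn0⟩ := hN n hn
  have hn' : (0 : ℝ) < n := by exact_mod_cast hn0
  have hn1 : (1 : ℝ) ≤ n := by exact_mod_cast hn0
  have e1 : (n : ℝ) ^ α / n = (n : ℝ) ^ (-(1 - α)) := by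
    rw [div_eq_iff hn'.ne', ← Real.rpow_add_one hn'.ne']
    congr 1; ring
  have e2 : √((n : ℝ) ^ α / n) = (n : ℝ) ^ (-(1 - α) / 2) := by
    rw [e1, Real.sqrt_eq_rpow, ← Real.rpow_mul hn'.le]
    congr 1; ring
  have := h n ((n : ℝ) ^ α) hn0 (Real.one_le_rpow hn1 hα.le)
    (by rw [e2, neg_div]; exact h1)
    (by
      have := Real.log_le_rpow_div hn'.le hα
      rw [one_div, inv_mul_eq_div]
      exact this) c hc
  rwa [e2, e1] at this

lemma IsSymmetric.exists_rate_le_log (hsymm : W.IsSymmetric) (hσ : 0 < W.sigmaH) {α : ℝ}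
    (hα : 0 < α) : ∃ (K : ℝ) (N : ℕ), ∀ n : ℕ, N ≤ n → ∀ c : ChannelCode 𝓨 n,
      c.avgError W ≤ moderateError (α * Real.log n) →
      c.rate ≤ W.capacity - W.sigmaH * √(2 * α * Real.log n / n) + K * (Real.log n / n) := by
  obtain ⟨K, r, hr, h⟩ := hsymm.exists_rate_le_moderate hσ (1 / α)
  have hlog : Tendsto (fun n : ℕ => α * Real.log n) atTop atTop :=
    (Real.tendsto_log_atTop.comp tendsto_natCast_atTop_atTop).const_mul_atTop hα
  have htend : Tendsto (fun n : ℕ => √(α * Real.log n / n)) atTop (𝓝 0) := by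
    have h1 : Tendsto (fun x : ℝ => Real.log x / x) atTop (𝓝 0) := by
      have := Real.isLittleO_log_id_atTop.tendsto_div_nhds_zero
      exact this
    have h2 := ((h1.comp tendsto_natCast_atTop_atTop).const_mul α).sqrt
    rw [mul_zero, Real.sqrt_zero] at h2
    refine h2.congr fun n => ?_
    simp only [Function.comp, mul_div_assoc]
  obtain ⟨N, hN⟩ := eventually_atTop.1 (((htend.eventually (ge_mem_nhds hr)).and
    (hlog.eventually_ge_atTop 1)).and (eventually_gt_atTop 0))
  refine ⟨K * α, N, fun n hn c hc => ?_⟩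
  obtain ⟨⟨h1, h2⟩, hn0⟩ := hN n hn
  have := h n (α * Real.log n) hn0 h2 h1 (le_of_eq (by field_simp)) c hc
  refine this.trans (le_of_eq ?_)
  have e : √(2 * α * Real.log n / n) = √2 * √(α * Real.log n / n) := by
    rw [← Real.sqrt_mul (by norm_num)]
    congr 1; ring
  rw [e]
  ring

/-- The Berry-Esseen lower bound on the tail probability. -/
lemma gaussianQ_sub_le_tailProb (hσ : 0 < W.sigmaH) {C : ℝ} (hC : IsBerryEsseenBound C) {n : ℕ}
    (hn : 0 < n) (t : ℝ) :
    gaussianQ t - C * W.thirdH / (√n * W.sigmaH ^ 3) ≤ W.tailProb n (W.sigmaH / √n * t) := by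
  have hn0 : (0 : ℝ) < n := by exact_mod_cast hn
  have hsn : 0 < √(n : ℝ) := Real.sqrt_pos.2 hn0
  have hg := W.measurable_info
  have i3 : Integrable (fun x : ℝ => |x| ^ 3) W.infoLaw := by
    rw [infoLaw, integrable_map_measure (by fun_prop) hg.aemeasurable]
    exact integrable_pow_abs_of_mem_interior_integrableExpSet
      W.zero_mem_interior_integrableExpSet 3
  have hv : Var[id; W.infoLaw] = Var[W.info; W.joint] := by
    rw [infoLaw, variance_map measurable_id.aemeasurable hg.aemeasurable]
    rfl
  have hs : √(Var[id; W.infoLaw]) = W.sigmaH := by rw [hv, sigmaH]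
  have hm : ∫ x, x ∂W.infoLaw = W.condEntropy := by
    rw [infoLaw, integral_map hg.aemeasurable (by fun_prop)]
    rfl
  have hM : ∫ x, |x - W.condEntropy| ^ 3 ∂W.infoLaw = W.thirdH := by
    rw [infoLaw, integral_map hg.aemeasurable (by fun_prop)]
    rfl
  have h := hC W.infoLaw inferInstance i3 (Real.sqrt_pos.1 (hs ▸ hσ)) n hn t
  rw [hs, hm, hM] at h
  have e : {z : Fin n → ℝ | W.condEntropy + W.sigmaH / √n * t < (∑ i, z i) / n} =
      {z | n * W.condEntropy + t * (√n * W.sigmaH) < ∑ i, z i} := by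
    ext z
    simp only [mem_ofPred_eq]
    rw [lt_div_iff₀ hn0]
    have : (W.condEntropy + W.sigmaH / √n * t) * n = n * W.condEntropy + t * (√n * W.sigmaH) := by
      rw [add_mul, show W.sigmaH / √n * t * n = W.sigmaH * t * (n / √n) by ring, Real.div_sqrt]
      ring
    rw [this]
  rw [tailProb_eq, e]
  have := (abs_le.1 h).1
  linarith

lemma IsSymmetric.rate_le_normalBound (hsymm : W.IsSymmetric) (hσ : 0 < W.sigmaH) {C : ℝ}
    (hC : IsBerryEsseenBound C) {ε : ℝ} (h0 : 0 < ε) (h1 : ε < 1) {n : ℕ} (hn : 0 < n)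
    (ha : W.normalArg C n ε < 1) (c : ChannelCode 𝓨 n) (hc : c.avgError W ≤ ε) :
    c.rate ≤ W.normalBound C n ε := by
  have hn0 : (0 : ℝ) < n := by exact_mod_cast hn
  have hsn : 0 < √(n : ℝ) := Real.sqrt_pos.2 hn0
  have hC0 := hC.nonneg
  have hM0 : 0 ≤ W.thirdH := integral_nonneg fun _ => by positivity
  have ha0 : 0 < W.normalArg C n ε := by rw [normalArg]; positivity
  have htail := W.gaussianQ_sub_le_tailProb hσ hC hn (gaussianQInv (W.normalArg C n ε))
  rw [gaussianQ_gaussianQInv ha0 ha] at htail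
  have hlevel : W.errorLevel n ε = W.normalArg C n ε - C * W.thirdH / (√n * W.sigmaH ^ 3) := by
    rw [errorLevel, normalArg, Real.sqrt_div' _ hn0.le]
    field_simp
    ring
  refine (hsymm.rate_le_converseBound hσ hn h0 h1 (hlevel ▸ htail) c hc).trans ?_
  rw [converseBound, normalBound]
  have h2 := div_nonpos_of_nonpos_of_nonneg (W.log_mirrorProb_nonpos n
    (W.sigmaH / √n * gaussianQInv (W.normalArg C n ε))) hn0.le
  rw [sub_add_eq_add_sub, sub_sub, sub_add_eq_sub_sub]
  simp only [add_div, sub_div] at h2 ⊢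
  linarith

lemma normalBound_isBigO (hσ : 0 < W.sigmaH) (C : ℝ) {ε : ℝ} (h0 : 0 < ε) (h1 : ε < 1) :
    (fun n : ℕ => W.normalBound C n ε -
        (W.capacity - W.sigmaH / √n * gaussianQInv ε + Real.log n / n))
      =O[atTop] (fun n : ℕ => 1 / (n : ℝ)) := by
  obtain ⟨K, hK, hQ⟩ := exists_abs_gaussianQInv_sub_le h0 h1
  have hlog : 0 < -2 * Real.log ε := by linarith [Real.log_neg h0 h1]
  set D := 2 * √(-2 * Real.log ε) / W.sigmaH * ε + C * W.thirdH / W.sigmaH ^ 3 with hD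
  have harg : ∀ n : ℕ, W.normalArg C n ε = ε + 1 / √n * D := fun n => rfl
  have hlim : Tendsto (fun n : ℕ => W.normalArg C n ε) atTop (𝓝 ε) := by
    have h2 : Tendsto (fun n : ℕ => 1 / √(n : ℝ)) atTop (𝓝 0) := by
      have := tendsto_inv_atTop_zero.comp
        (Real.tendsto_sqrt_atTop.comp (tendsto_natCast_atTop_atTop (R := ℝ)))
      simp only [one_div]
      exact this
    have := (h2.mul_const D).const_add ε
    simpa [harg] using this
  refine Asymptotics.IsBigO.of_bound (|Real.log ε + Real.log (-2 * Real.log ε / W.sigmaH ^ 2)| +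
    √(-2 * Real.log ε) / W.sigmaH + W.sigmaH * K * |D|) ?_
  filter_upwards [hlim.eventually hQ, eventually_gt_atTop 0] with n hn hn0
  have hn' : (0 : ℝ) < n := by exact_mod_cast hn0
  have hn1 : (1 : ℝ) ≤ n := by exact_mod_cast hn0
  have hsn : 0 < √(n : ℝ) := Real.sqrt_pos.2 hn'
  have hsn2 : √(n : ℝ) * √n = n := Real.mul_self_sqrt hn'.le
  set B := √(-2 * Real.log ε / n) / W.sigmaH with hB
  have hB0 : 0 ≤ B := by positivity
  have hB1 : B ≤ √(-2 * Real.log ε) / W.sigmaH := by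
    rw [hB]
    gcongr
    exact div_le_self hlog.le hn1
  have hL : |Real.log (1 + B)| ≤ √(-2 * Real.log ε) / W.sigmaH := by
    rw [abs_of_nonneg (Real.log_nonneg (by linarith))]
    have := Real.log_le_sub_one_of_pos (by linarith : 0 < 1 + B)
    linarith
  have hlogn : Real.log (-2 * Real.log ε / (W.sigmaH ^ 2 * n)) =
      Real.log (-2 * Real.log ε / W.sigmaH ^ 2) - Real.log n := by
    rw [← div_div, Real.log_div (by positivity) hn'.ne']
  have e : W.normalBound C n ε - (W.capacity - W.sigmaH / √n * gaussianQInv ε + Real.log n / n) =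
      -(Real.log ε + Real.log (-2 * Real.log ε / W.sigmaH ^ 2)) / n + Real.log (1 + B) / n -
        W.sigmaH / √n * (gaussianQInv (W.normalArg C n ε) - gaussianQInv ε) := by
    rw [normalBound, hlogn, ← hB]
    ring
  have hq : |W.sigmaH / √n * (gaussianQInv (W.normalArg C n ε) - gaussianQInv ε)| ≤
      W.sigmaH * K * |D| / n := by
    rw [harg] at hn ⊢
    rw [abs_mul, abs_of_pos (by positivity : 0 < W.sigmaH / √(n : ℝ))]
    refine (mul_le_mul_of_nonneg_left hn (by positivity)).trans (le_of_eq ?_)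
    rw [add_sub_cancel_left, abs_mul, abs_of_pos (by positivity : 0 < 1 / √(n : ℝ))]
    nth_rewrite 3 [← hsn2]
    rw [← div_div]
    ring
  rw [e, Real.norm_eq_abs, Real.norm_of_nonneg (by positivity : (0 : ℝ) ≤ 1 / n), mul_one_div,
    add_div, add_div]
  refine (abs_sub _ _).trans (add_le_add ((abs_add_le _ _).trans (add_le_add ?_ ?_)) hq)
  · rw [abs_div, abs_neg, abs_of_pos hn']
  · rw [abs_div, abs_of_pos hn']
    exact div_le_div_of_nonneg_right hL hn'.le

end BinaryChannel

theorem theorem1 {𝓨 : Type*} [MeasurableSpace 𝓨] {μ : Measure 𝓨} (W : BinaryChannel 𝓨 μ)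
    (hsymm : W.IsSymmetric) (hσ : 0 < W.sigmaH) :
    -- the general converse, for every `δ` subject to the condition, hence for the largest one
    (∀ (n : ℕ) (ε δ : ℝ), 0 < n → 0 < ε → ε < 1 →
      W.errorLevel n ε ≤ W.tailProb n δ →
      ∀ c : ChannelCode 𝓨 n, c.avgError W ≤ ε → c.rate ≤ W.converseBound n ε δ) ∧
    -- 1) `δ = δ(l)` solving the equation with the explicit lower bound on the tail
    (∀ (C : ℝ), berryEsseenConst ≤ C →
      ∀ (n : ℕ) (ε δ l : ℝ), 0 < n → 0 < ε → ε < 1 →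
      0 ≤ l → (l : EReal) < W.lambdaStar → W.tiltedDelta l = δ →
      2 * C * W.tiltedThird l / (√n * W.tiltedSigma l ^ 3) < 1 / 2 →
      W.errorLevel n ε = W.xiLower C l n * Real.exp (-n * W.rateFn δ) →
      ∀ c : ChannelCode 𝓨 n, c.avgError W ≤ ε → c.rate ≤ W.converseBound n ε δ) ∧
    -- 2) error probability about `exp (-n ^ α)`
    (∀ α : ℝ, 0 < α → α < 1 →
      ∃ (K : ℝ) (N : ℕ), ∀ n : ℕ, N ≤ n → ∀ c : ChannelCode 𝓨 n,
        c.avgError W ≤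
          Real.exp (-(n : ℝ) ^ α) / (2 * √(Real.pi * (n : ℝ) ^ α)) *
            (1 - 1 / (2 * (n : ℝ) ^ α)) →
        c.rate ≤ W.capacity - √2 * W.sigmaH * (n : ℝ) ^ (-(1 - α) / 2)
          + K * (n : ℝ) ^ (-(1 - α))) ∧
    -- 3) error probability about `n ^ (-α)`
    (∀ α : ℝ, 0 < α →
      ∃ (K : ℝ) (N : ℕ), ∀ n : ℕ, N ≤ n → ∀ c : ChannelCode 𝓨 n,
        c.avgError W ≤
          (n : ℝ) ^ (-α) / (2 * √(Real.pi * α * Real.log n)) *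
            (1 - 1 / (2 * α * Real.log n)) →
        c.rate ≤ W.capacity - W.sigmaH * √(2 * α * Real.log n / n)
          + K * (Real.log n / n)) ∧
    -- 4) constant error probability: the bound, and its expansion
    (∀ (C : ℝ), berryEsseenConst ≤ C → ∀ ε : ℝ, 0 < ε → ε < 1 →
      (∀ n : ℕ, 0 < n → W.normalArg C n ε < 1 →
        ∀ c : ChannelCode 𝓨 n, c.avgError W ≤ ε → c.rate ≤ W.normalBound C n ε) ∧
      (fun n : ℕ => W.normalBound C n ε -
          (W.capacity - W.sigmaH / √n * gaussianQInv ε + Real.log n / n))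
        =O[Filter.atTop] (fun n : ℕ => 1 / (n : ℝ))) := by
  refine ⟨fun n ε δ hn h0 h1 h c hc => hsymm.rate_le_converseBound hσ hn h0 h1 h c hc,
    fun C hC n ε δ l hn h0 h1 hl hls hδ hκ h c hc => ?_, fun α hα hα1 => ?_, fun α hα => ?_,
    fun C hC ε h0 h1 => ⟨fun n hn ha c hc => ?_, W.normalBound_isBigO hσ C h0 h1⟩⟩
  · exact hsymm.rate_le_converseBound hσ hn h0 h1
      (W.errorLevel_le_tailProb_of_eq_xiLower hσ hC hn hl hls hδ hκ h) c hc
  · exact hsymm.exists_rate_le_rpow hσ hα hα1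
  · obtain ⟨K, N, h⟩ := hsymm.exists_rate_le_log hσ hα
    refine ⟨K, max N 1, fun n hn c hc => h n ((le_max_left _ _).trans hn) c ?_⟩
    have hn0 : (0 : ℝ) < n := by exact_mod_cast (le_max_right N 1).trans hn
    rw [moderateError, ← mul_assoc Real.pi, ← mul_assoc 2 α]
    rwa [Real.rpow_def_of_pos hn0, mul_neg, mul_comm (Real.log _) α] at hc
  · exact hsymm.rate_le_normalBound hσ (isBerryEsseenBound_of_le hC) h0 h1 hn ha c hc
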